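/- Let $N\ge 1$ be an integer and $1\le p<\infty$. For $0<s<1$, an open set $E\subseteq\mathbb{R}^N$ and a compact set $\Sigma\subseteq E$ put $$\widetilde{\rm cap}_{s,p}(\Sigma;E)=\inf\Big\{\iint_{\mathbb{R}^N\times\mathbb{R}^N}\frac{|\varphi(x)-\varphi(y)|^p}{|x-y|^{N+sp}}\,dx\,dy:\ \varphi\in C_c^\infty(E),\ \varphi\ge 1\text{ on }\Sigma\Big\}.$$ Call $q\in[1,\infty]$ admissible for $s$ if $p\le q$ and: $q\le \frac{Np}{N-sp}$ when $sp<N$; $q<\infty$ when $sp=N$; $q\le\infty$ when $sp>N$. Write $N/q=0$ if $q=\infty$; $B_\rho(x_0)$ is the open ball. There is a constant $M=M(N,p,s,q,t)>0$, defined for $0<s<1$, $q$ admissible for $s$, and $t>\sqrt N$, such that the following hold. (i) For all $0<s<1$, all $q$ admissible for $s$, all $x_0\in\mathbb{R}^N$, $r>0$, $R>\sqrt N\,r$, all compact $\Sigma\subseteq\overline{B_r(x_0)}$ and all $u\in C_c^\infty(\mathbb{R}^N)$ with $u=0$ on $\Sigma$, $$\frac{M(N,p,s,q,R/r)}{r^{N/q}}\,\Big(\widetilde{\rm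 cap}_{s,p}(\Sigma;B_R(x_0))\Big)^{1/p}\,\|u\|_{L^q(B_r(x_0))}\le\Big(\iint_{B_R(x_0)\times\mathbb{R}^N}\frac{|u(x)-u(y)|^p}{|x-y|^{N+sp}}\,dx\,dy\Big)^{1/p}.$$ (ii) For every fixed $t>\sqrt N$, $M\sim 1$ as $s\searrow 0$ and as $s\nearrow 1$. That is, $$0<\liminf M(N,p,s,q,t)\le\limsup M(N,p,s,q,t)<\infty,$$ where, as $s\searrow0$, the lower and upper limits are taken over all pairs $(s,q)\to(0,p)$ with $0<s<1$ and $q$ admissible for $s$ (admissibility forces $q\to p$ as $s\searrow 0$), and, as $s\nearrow1$, they are taken over $s$ for each fixed $q$ that is admissible for all $s<1$ close to $1$. (iii) For every fixed $0<s<1$ and $q$ admissible for $s$, the following limits exist and satisfy $$0<\lim_{t\to\sqrt N^{+}}\frac{M(N,p,s,q,t)}{(t-\sqrt N)^s}<\infty,\qquad 0<\lim_{t\to\infty}t^{N/q}\,M(N,p,s,q,t)<\infty.$$ -/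

import Mathlib

open MeasureTheory Filter Topology Asymptotics
open scoped ENNReal ContDiff

noncomputable section

/-- The double integral `∬_{A × B} |u(x) - u(y)|^p / |x - y|^(N + s p) dx dy`, with values in
`[0, ∞]`.  For `A = B = ℝ^N` this is the `p`-th power of the Gagliardo-Slobodeckii seminorm. -/
def gagliardoEnergy {N : ℕ} (s p : ℝ) (A B : Set (EuclideanSpace ℝ (Fin N)))
    (u : EuclideanSpace ℝ (Fin N) → ℝ) : ℝ≥0∞ :=
  ∫⁻ z in A ×ˢ B, ENNReal.ofReal (|u z.1 - u z.2| ^ p / ‖z.1 - z.2‖ ^ ((N : ℝ) + s * p))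
    ∂((volume : Measure (EuclideanSpace ℝ (Fin N))).prod volume)

/-- `φ ∈ C_c^∞(E)`: smooth on `ℝ^N`, with compact support contained in `E`. -/
def IsTestFunction {N : ℕ} (E : Set (EuclideanSpace ℝ (Fin N)))
    (φ : EuclideanSpace ℝ (Fin N) → ℝ) : Prop :=
  ContDiff ℝ ∞ φ ∧ HasCompactSupport φ ∧ tsupport φ ⊆ E

/-- The homogeneous `(s,p)`-capacity of the compact set `S` relative to the open set `E`. -/
def fractionalCapacity {N : ℕ} (s p : ℝ) (S E : Set (EuclideanSpace ℝ (Fin N))) : ℝ≥0∞ :=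
  ⨅ (φ : EuclideanSpace ℝ (Fin N) → ℝ) (_ : IsTestFunction E φ) (_ : ∀ x ∈ S, 1 ≤ φ x),
    gagliardoEnergy s p Set.univ Set.univ φ

/-- The superhomogeneous and subcritical exponents `q ∈ [1, ∞]`: `p ≤ q`, and
`q ≤ N p / (N - s p)` if `s p < N`, `q < ∞` if `s p = N`, `q ≤ ∞` if `s p > N`. -/
def IsSubcritical (N : ℕ) (p s : ℝ) (q : ℝ≥0∞) : Prop :=
  ENNReal.ofReal p ≤ q ∧
    (s * p < N → q ≤ ENNReal.ofReal ((N : ℝ) * p / ((N : ℝ) - s * p))) ∧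
    (s * p = N → q < ⊤)

/-- The real number `N / q`, equal to `0` when `q = ∞`. -/
def dimDiv (N : ℕ) (q : ℝ≥0∞) : ℝ := (N : ℝ) * (q⁻¹).toReal

end

noncomputable section

/-! The core is Maz'ya's argument on balls with `r < R ≤ 2 r` (`exists_capacity_poincare`). Let `c`
be the mean of `u` over `B_R` and write `u = (u - c) + c`. Take a cut-off `η`, equal to 1 on the
closed ball of radius `r`, supported in `B_R`, with Lipschitz constant of order `1 / (R - r)`; its
energy density is at most a multiple of `(R - r) ^ (-s p) / (s (1 - s))`. For `u - c`, the capacity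
is bounded by the energy of `η` and the norm by a Poincaré-Sobolev inequality. For `c ≠ 0`, the
function `η (1 - u / c)` is a competitor for the capacity, so `|c| ^ p * cap` is at most the energy
of `η (u - c)`, which a product rule and the Poincaré inequality in `L^p` control.

For constants stable in `s`, the blow-up `1 / (s (1 - s))` must be offset by a gain in
Poincaré-Sobolev.

Gain `1 - s` (`exists_iterEnergy_le_one_sub_mul`): cut dyadically, the energy of order `s` on the
unit ball is comparable to `∑ x ^ k * a k` with `x = 2 ^ (-p (1 - s))` and `a` independent of `s`.
Midpoints show that `a` is nondecreasing, hence `(1 - x) ∑ x ^ k * a k` increases with `x`, and `1 -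
x ≤ p (1 - s)`. So a Sobolev (`sobolev_ball`) or Morrey (`morrey_ball`) inequality of one fixed
lower order carries over to all `s` up to 1.

Gain `s` (`sobolev_ball_univ`): here the energy must be taken over `ball × ℝ^N`, since over `ball ×
ball` it stays bounded for a fixed smooth `u` as `s → 0`. The mass of the kernel far away is of
order `1 / s`, and so is, relative to `2 ^ (n s p)`, the sum of the dyadic weights up to scale `n`
together with that mass. Dividing by it in Hedberg's argument produces the factor `s`, uniformly in
`q`.

Finally `M` is the best constant for comparable radii, capped at 1, times explicit factors in `t = R
/ r` which only weaken the inequality and impose the two required limits. Larger `R` reduces to `2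
r` by monotonicity of the capacity and of the energy in the domain. -/

abbrev Euc (N : ℕ) := EuclideanSpace ℝ (Fin N)

/-! ### Kernel, difference powers and the energy as an iterated integral. -/

/-- The kernel `‖h‖ ^ (-e)` with values in `[0, ∞]` (equal to `0` at the origin). -/
def rieszKernel {N : ℕ} (e : ℝ) (h : Euc N) : ℝ≥0∞ := ENNReal.ofReal (‖h‖ ^ (-e))

/-- The `p`-th power of the difference of the values of `u` at two points. -/
def diffPow {N : ℕ} (p : ℝ) (u : Euc N → ℝ) (x y : Euc N) : ℝ≥0∞ := ‖u x - u y‖ₑ ^ p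

/-- The difference `diffPow`, restricted to pairs at distance less than `2 * 2 ^ (-k)`. -/
def nearDiff {N : ℕ} (p : ℝ) (u : Euc N → ℝ) (k : ℕ) (x y : Euc N) : ℝ≥0∞ :=
  if (2 : ℝ) ^ k * ‖x - y‖ < 2 then diffPow p u x y else 0

@[fun_prop]
theorem measurable_rieszKernel {N : ℕ} (e : ℝ) : Measurable (rieszKernel (N := N) e) := by
  unfold rieszKernel; fun_prop

@[fun_prop]
theorem Measurable.diffPow_comp {N : ℕ} {α : Type*} [MeasurableSpace α] {p : ℝ} {u : Euc N → ℝ}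
    {f g : α → Euc N} (hu : Measurable u) (hf : Measurable f) (hg : Measurable g) :
    Measurable (fun a => diffPow p u (f a) (g a)) := by
  unfold diffPow
  exact (((hu.comp hf).sub (hu.comp hg)).enorm).pow_const p

@[fun_prop]
theorem Measurable.nearDiff_comp {N : ℕ} {α : Type*} [MeasurableSpace α] {p : ℝ} {u : Euc N → ℝ}
    {k : ℕ} {f g : α → Euc N} (hu : Measurable u) (hf : Measurable f) (hg : Measurable g) :
    Measurable (fun a => nearDiff p u k (f a) (g a)) := by
  unfold nearDiff
  refine Measurable.ite (measurableSet_lt ?_ measurable_const) (hu.diffPow_comp hf hg)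
    measurable_const
  exact (hf.sub hg).norm.const_mul _

theorem diffPow_comm {N : ℕ} (p : ℝ) (u : Euc N → ℝ) (x y : Euc N) :
    diffPow p u x y = diffPow p u y x := by
  unfold diffPow; rw [← enorm_neg, neg_sub]

theorem diffPow_self {N : ℕ} {p : ℝ} (hp : 0 < p) (u : Euc N → ℝ) (x : Euc N) :
    diffPow p u x x = 0 := by
  simp [diffPow, hp]

theorem enorm_add_rpow_le {p : ℝ} (hp : 1 ≤ p) (a b : ℝ) :
    ‖a + b‖ₑ ^ p ≤ 2 ^ (p - 1) * (‖a‖ₑ ^ p + ‖b‖ₑ ^ p) := by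
  refine (ENNReal.rpow_le_rpow (enorm_add_le a b) (by linarith)).trans ?_
  exact ENNReal.rpow_add_le_mul_rpow_add_rpow _ _ hp

theorem diffPow_triangle {N : ℕ} {p : ℝ} (hp : 1 ≤ p) (u : Euc N → ℝ) (x m y : Euc N) :
    diffPow p u x y ≤ 2 ^ (p - 1) * (diffPow p u x m + diffPow p u m y) := by
  unfold diffPow
  simpa using enorm_add_rpow_le hp (u x - u m) (u m - u y)

theorem rieszKernel_neg {N : ℕ} (e : ℝ) (h : Euc N) : rieszKernel e (-h) = rieszKernel e h := by
  simp [rieszKernel]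

theorem rieszKernel_sub_comm {N : ℕ} (e : ℝ) (x y : Euc N) :
    rieszKernel e (x - y) = rieszKernel e (y - x) := by
  rw [← rieszKernel_neg, neg_sub]

theorem gagliardo_integrand_eq {N : ℕ} {p e : ℝ} (hp : 0 ≤ p) (u : Euc N → ℝ) (x y : Euc N) :
    ENNReal.ofReal (|u x - u y| ^ p / ‖x - y‖ ^ e) = diffPow p u x y * rieszKernel e (x - y) := by
  unfold diffPow rieszKernel
  rw [div_eq_mul_inv, ← Real.rpow_neg (norm_nonneg _), ENNReal.ofReal_mul (by positivity),
    ← ENNReal.ofReal_rpow_of_nonneg (abs_nonneg _) hp, Real.enorm_eq_ofReal_abs]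

theorem gagliardoEnergy_eq {N : ℕ} {s p : ℝ} (hp : 0 ≤ p) (A B : Set (Euc N))
    {u : Euc N → ℝ} (hu : Measurable u) :
    gagliardoEnergy s p A B u =
      ∫⁻ x in A, ∫⁻ y in B, diffPow p u x y * rieszKernel (N + s * p) (x - y) := by
  unfold gagliardoEnergy
  simp_rw [gagliardo_integrand_eq hp]
  rw [← Measure.prod_restrict, lintegral_prod]
  exact Measurable.aemeasurable (by fun_prop)

/-! ### Dyadic decomposition of the kernel. -/

/-- Geometric growth with ratio `2 ^ e ≥ 2` makes the last term dominate, with a constant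
independent of `e`. The induction also carries the bound by the next term `(2 ^ n) ^ e`, needed when
that term enters the sum. -/
theorem sum_dyadic_le {e t : ℝ} (he : 1 ≤ e) (ht : 0 < t) (n : ℕ) :
    ∑ k ∈ Finset.range n, (if (2 : ℝ) ^ k < t then ((2 : ℝ) ^ k) ^ e else 0) ≤ 2 * t ^ e := by
  have key : ∀ n : ℕ,
      ∑ k ∈ Finset.range n, (if (2 : ℝ) ^ k < t then ((2 : ℝ) ^ k) ^ e else 0)
        ≤ ((2 : ℝ) ^ n) ^ e ∧
      ∑ k ∈ Finset.range n, (if (2 : ℝ) ^ k < t then ((2 : ℝ) ^ k) ^ e else 0) ≤ 2 * t ^ e := by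
    intro n
    induction n with
    | zero => simp; positivity
    | succ n ih =>
      rw [Finset.sum_range_succ]
      have h2 : ((2 : ℝ) ^ (n + 1)) ^ e = ((2 : ℝ) ^ n) ^ e * 2 ^ e := by
        rw [pow_succ, Real.mul_rpow (by positivity) (by positivity)]
      have h3 : (2 : ℝ) ≤ 2 ^ e := by
        simpa using Real.rpow_le_rpow_of_exponent_le (x := 2) (by norm_num) he
      have h4 : 0 < ((2 : ℝ) ^ n) ^ e := by positivity
      split_ifs with h
      · have h5 : ((2 : ℝ) ^ n) ^ e ≤ t ^ e :=
          Real.rpow_le_rpow (by positivity) h.le (by linarith)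
        constructor
        · rw [h2]; nlinarith [ih.1]
        · linarith [ih.1]
      · constructor
        · rw [h2]; nlinarith [ih.1]
        · linarith [ih.2]
  exact (key n).2

theorem two_pow_mul_norm_lt_iff {N : ℕ} {h : Euc N} (hh : h ≠ 0) (k : ℕ) :
    (2 : ℝ) ^ k * ‖h‖ < 2 ↔ (2 : ℝ) ^ k < 2 / ‖h‖ := by
  rw [lt_div_iff₀ (norm_pos_iff.2 hh)]

theorem tsum_dyadic_le {N : ℕ} {e : ℝ} (he : 1 ≤ e) {h : Euc N} (hh : h ≠ 0) :
    ∑' k : ℕ, (if (2 : ℝ) ^ k * ‖h‖ < 2 then ENNReal.ofReal (((2 : ℝ) ^ k) ^ e) else 0) ≤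
      ENNReal.ofReal (2 * 2 ^ e) * rieszKernel e h := by
  have hpos : 0 < ‖h‖ := norm_pos_iff.2 hh
  refine ENNReal.tsum_le_of_sum_range_le fun n => ?_
  have := sum_dyadic_le he (div_pos two_pos hpos) n
  simp_rw [two_pow_mul_norm_lt_iff hh]
  calc _ = ENNReal.ofReal (∑ k ∈ Finset.range n,
        (if (2 : ℝ) ^ k < 2 / ‖h‖ then ((2 : ℝ) ^ k) ^ e else 0)) := by
        rw [ENNReal.ofReal_sum_of_nonneg]
        · refine Finset.sum_congr rfl fun k _ => ?_
          split_ifs <;> simp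
        · intro k _; split_ifs <;> positivity
    _ ≤ _ := by
        unfold rieszKernel
        rw [← ENNReal.ofReal_mul (by positivity)]
        refine ENNReal.ofReal_le_ofReal (this.trans (le_of_eq ?_))
        rw [Real.div_rpow (by positivity) (by positivity), Real.rpow_neg (by positivity)]
        ring

/-- A single scale suffices, namely `2 ^ n` between `1 / ‖h‖` and `2 / ‖h‖`. Since the cut-off is
strict, the scale is lowered by one when `2 / ‖h‖` is exactly a power of two; `‖h‖ < 2` leaves room
for this. -/
theorem rieszKernel_le_tsum_dyadic {N : ℕ} {e : ℝ} (he : 1 ≤ e) {h : Euc N} (hh : ‖h‖ < 2) :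
    rieszKernel e h ≤
      ∑' k : ℕ, (if (2 : ℝ) ^ k * ‖h‖ < 2 then ENNReal.ofReal (((2 : ℝ) ^ k) ^ e) else 0) := by
  rcases eq_or_ne h 0 with rfl | h0
  · simp [rieszKernel, Real.zero_rpow (show -e ≠ 0 by linarith)]
  have hpos : 0 < ‖h‖ := norm_pos_iff.2 h0
  obtain ⟨n, hn1, hn2⟩ := exists_nat_pow_near (x := 2 / ‖h‖) (y := 2)
    (by rw [le_div_iff₀ hpos]; linarith) (by norm_num)
  rcases hn1.lt_or_eq with hlt | heq
  · refine le_trans ?_ (ENNReal.le_tsum n)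
    rw [if_pos (by rwa [two_pow_mul_norm_lt_iff h0])]
    unfold rieszKernel
    refine ENNReal.ofReal_le_ofReal ?_
    rw [Real.rpow_neg (by positivity), ← Real.inv_rpow (by positivity)]
    refine Real.rpow_le_rpow (by positivity) ?_ (by linarith)
    rw [div_lt_iff₀ hpos, pow_succ] at hn2
    rw [inv_le_iff_one_le_mul₀ hpos]
    nlinarith
  · rcases n with _ | n
    · rw [eq_div_iff hpos.ne'] at heq
      norm_num at heq; linarith
    · refine le_trans ?_ (ENNReal.le_tsum n)
      have h1 : (2 : ℝ) ^ n < 2 / ‖h‖ := by rw [← heq]; exact pow_lt_pow_right₀ (by norm_num) (by simp)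
      rw [if_pos (by rwa [two_pow_mul_norm_lt_iff h0])]
      unfold rieszKernel
      refine ENNReal.ofReal_le_ofReal ?_
      rw [Real.rpow_neg (by positivity), ← Real.inv_rpow (by positivity)]
      refine Real.rpow_le_rpow (by positivity) ?_ (by linarith)
      rw [eq_div_iff hpos.ne', pow_succ] at heq
      rw [inv_le_iff_one_le_mul₀ hpos]
      nlinarith

theorem tsum_nearDiff_le {N : ℕ} {p e : ℝ} (hp : 0 < p) (he : 1 ≤ e) (u : Euc N → ℝ)
    (x y : Euc N) :
    ∑' k : ℕ, ENNReal.ofReal (((2 : ℝ) ^ k) ^ e) * nearDiff p u k x y ≤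
      ENNReal.ofReal (2 * 2 ^ e) * (diffPow p u x y * rieszKernel e (x - y)) := by
  rcases eq_or_ne x y with rfl | h
  · simp [nearDiff, diffPow_self hp]
  have := mul_le_mul_right (tsum_dyadic_le he (sub_ne_zero.2 h)) (diffPow p u x y)
  rw [← ENNReal.tsum_mul_left] at this
  calc _ = _ := by
        refine tsum_congr fun k => ?_
        unfold nearDiff
        split_ifs
        · rw [mul_comm]
        · simp
    _ ≤ _ := this
    _ = _ := by ring

theorem diffPow_mul_rieszKernel_le_tsum {N : ℕ} {p e : ℝ} (he : 1 ≤ e) (u : Euc N → ℝ)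
    {x y : Euc N} (h : ‖x - y‖ < 2) :
    diffPow p u x y * rieszKernel e (x - y) ≤
      ∑' k : ℕ, ENNReal.ofReal (((2 : ℝ) ^ k) ^ e) * nearDiff p u k x y := by
  refine (mul_le_mul_right (rieszKernel_le_tsum_dyadic he h) _).trans (le_of_eq ?_)
  rw [← ENNReal.tsum_mul_left]
  refine tsum_congr fun k => ?_
  unfold nearDiff
  split_ifs
  · rw [mul_comm]
  · simp

/-! ### Contraction of the unit ball towards one of its points. -/

theorem lintegral_comp_smul_add {N : ℕ} {c : ℝ} (hc : 0 < c) (b : Euc N) {f : Euc N → ℝ≥0∞}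
    (hf : Measurable f) :
    ∫⁻ z, f (c • z + b) = ENNReal.ofReal ((c ^ N)⁻¹) * ∫⁻ y, f y := by
  have h1 : ∫⁻ z, f (c • z + b) = ∫⁻ y, f (y + b) ∂(Measure.map (c • ·) volume) := by
    rw [lintegral_map (by fun_prop) (by fun_prop)]
  rw [h1, Measure.map_addHaar_smul _ hc.ne', lintegral_smul_measure, lintegral_add_right_eq_self]
  simp [abs_of_pos hc]

/-- Shrinking the unit ball towards one of its points. -/
theorem lintegral_ball_contract_le {N : ℕ} {k : ℕ} {x : Euc N} (hx : x ∈ Metric.ball (0 : Euc N) 1)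
    {f : Euc N → ℝ≥0∞} (hf : Measurable f) :
    ∫⁻ z in Metric.ball (0 : Euc N) 1, f (x + ((2 : ℝ) ^ k)⁻¹ • (z - x)) ≤
      ENNReal.ofReal (((2 : ℝ) ^ k) ^ (N : ℝ)) *
        ∫⁻ y in Metric.ball (0 : Euc N) 1, if (2 : ℝ) ^ k * ‖x - y‖ < 2 then f y else 0 := by
  set c : ℝ := ((2 : ℝ) ^ k)⁻¹ with hc
  have hcpos : 0 < c := by positivity
  have hc1 : c ≤ 1 := inv_le_one_of_one_le₀ (one_le_pow₀ (by norm_num))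
  have hck : (2 : ℝ) ^ k * c = 1 := by rw [hc]; field_simp
  set g : Euc N → ℝ≥0∞ := (Metric.ball (0 : Euc N) 1).indicator
    (fun y => if (2 : ℝ) ^ k * ‖x - y‖ < 2 then f y else 0) with hg
  have hgm : Measurable g := by
    refine Measurable.indicator ?_ measurableSet_ball
    exact Measurable.ite (measurableSet_lt (by fun_prop) measurable_const) hf measurable_const
  -- By convexity the contracted point stays in the ball; it lies within `2 * 2 ^ (-k)` of `x`, the
  -- ball having diameter 2.
  have hle : ∀ z ∈ Metric.ball (0 : Euc N) 1, f (x + c • (z - x)) ≤ g (c • z + (1 - c) • x) := by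
    intro z hz
    have heq : x + c • (z - x) = c • z + (1 - c) • x := by module
    have hmem : c • z + (1 - c) • x ∈ Metric.ball (0 : Euc N) 1 :=
      (convex_ball (0 : Euc N) 1) hz hx hcpos.le (by linarith) (by ring)
    rw [heq, hg, Set.indicator_of_mem hmem, if_pos]
    have h3 : x - (c • z + (1 - c) • x) = c • (x - z) := by module
    rw [h3, norm_smul, Real.norm_of_nonneg hcpos.le, ← mul_assoc, hck, one_mul]
    rw [mem_ball_zero_iff] at hx hz
    exact (norm_sub_le x z).trans_lt (by linarith)
  calc _ ≤ ∫⁻ z in Metric.ball (0 : Euc N) 1, g (c • z + (1 - c) • x) :=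
        setLIntegral_mono' measurableSet_ball hle
    _ ≤ ∫⁻ z, g (c • z + (1 - c) • x) := setLIntegral_le_lintegral _ _
    _ = _ := by
        rw [lintegral_comp_smul_add hcpos _ hgm, hg, lintegral_indicator measurableSet_ball]
        congr 2
        rw [hc, inv_pow, inv_inv, Real.rpow_natCast]

/-! ### Energies at dyadic scales and comparison of orders. -/

/-- The part of the double integral over the unit ball coming from pairs of points at
distance less than `2 * 2 ^ (-k)`. -/
def nearEnergy {N : ℕ} (p : ℝ) (u : Euc N → ℝ) (k : ℕ) : ℝ≥0∞ :=
  ∫⁻ x in Metric.ball (0 : Euc N) 1, ∫⁻ y in Metric.ball (0 : Euc N) 1, nearDiff p u k x y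

/-- The double integral of `|u x - u y| ^ p * |x - y| ^ (-(N + s p))`. -/
def iterEnergy {N : ℕ} (s p : ℝ) (A B : Set (Euc N)) (u : Euc N → ℝ) : ℝ≥0∞ :=
  ∫⁻ x in A, ∫⁻ y in B, diffPow p u x y * rieszKernel (N + s * p) (x - y)

/-- Passing through the midpoint halves the distance, which moves each difference from scale `k` to
scale `k + 1`. -/
theorem nearDiff_le_midpoint {N : ℕ} {p : ℝ} (hp : 1 ≤ p) (u : Euc N → ℝ) (k : ℕ) (x y : Euc N) :
    nearDiff p u k x y ≤ 2 ^ (p - 1) *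
      (nearDiff p u (k + 1) x (x + ((2 : ℝ) ^ 1)⁻¹ • (y - x)) +
        nearDiff p u (k + 1) y (y + ((2 : ℝ) ^ 1)⁻¹ • (x - y))) := by
  have hm : y + ((2 : ℝ) ^ 1)⁻¹ • (x - y) = x + ((2 : ℝ) ^ 1)⁻¹ • (y - x) := by
    rw [pow_one]; module
  have hx : ‖x - (x + ((2 : ℝ) ^ 1)⁻¹ • (y - x))‖ = 2⁻¹ * ‖x - y‖ := by
    have : x - (x + ((2 : ℝ) ^ 1)⁻¹ • (y - x)) = (2⁻¹ : ℝ) • (x - y) := by rw [pow_one]; module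
    rw [this, norm_smul]; norm_num
  have hy : ‖y - (x + ((2 : ℝ) ^ 1)⁻¹ • (y - x))‖ = 2⁻¹ * ‖x - y‖ := by
    have : y - (x + ((2 : ℝ) ^ 1)⁻¹ • (y - x)) = (2⁻¹ : ℝ) • (y - x) := by rw [pow_one]; module
    rw [this, norm_smul, norm_sub_rev]; norm_num
  have hiff : (2 : ℝ) ^ (k + 1) * (2⁻¹ * ‖x - y‖) = 2 ^ k * ‖x - y‖ := by
    rw [pow_succ]; ring
  rw [hm]
  unfold nearDiff
  rw [hx, hy, hiff]
  split_ifs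
  · rw [diffPow_comm p u y]
    exact diffPow_triangle hp u x _ y
  · simp

/-- The constant is `2 ^ (p - 1)` from the triangle inequality, 2 for the two halves of the segment,
and `2 ^ N` for the Jacobian of the contraction to the midpoint. It says precisely that `2 ^ (k (N +
p)) * nearEnergy p u k` is nondecreasing in `k`, whatever `s` is. -/
theorem nearEnergy_le_succ {N : ℕ} {p : ℝ} (hp : 1 ≤ p) {u : Euc N → ℝ} (hu : Measurable u)
    (k : ℕ) :
    nearEnergy p u k ≤ ENNReal.ofReal (2 ^ ((N : ℝ) + p)) * nearEnergy p u (k + 1) := by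
  have hhalf : ∀ x ∈ Metric.ball (0 : Euc N) 1,
      ∫⁻ y in Metric.ball (0 : Euc N) 1,
        nearDiff p u (k + 1) x (x + ((2 : ℝ) ^ 1)⁻¹ • (y - x)) ≤
      ENNReal.ofReal (((2 : ℝ) ^ 1) ^ (N : ℝ)) *
        ∫⁻ y in Metric.ball (0 : Euc N) 1, nearDiff p u (k + 1) x y := by
    intro x hx
    refine (lintegral_ball_contract_le (k := 1) hx (f := fun y => nearDiff p u (k + 1) x y)
      (by fun_prop)).trans ?_
    gcongr
    split_ifs
    · exact le_rfl
    · exact zero_le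
  have hI : ∫⁻ x in Metric.ball (0 : Euc N) 1, ∫⁻ y in Metric.ball (0 : Euc N) 1,
        nearDiff p u (k + 1) x (x + ((2 : ℝ) ^ 1)⁻¹ • (y - x)) ≤
      ENNReal.ofReal (((2 : ℝ) ^ 1) ^ (N : ℝ)) * nearEnergy p u (k + 1) := by
    refine (setLIntegral_mono' measurableSet_ball hhalf).trans (le_of_eq ?_)
    rw [lintegral_const_mul']
    · rfl
    · exact ENNReal.ofReal_ne_top
  have hswap : ∫⁻ x in Metric.ball (0 : Euc N) 1, ∫⁻ y in Metric.ball (0 : Euc N) 1,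
        nearDiff p u (k + 1) y (y + ((2 : ℝ) ^ 1)⁻¹ • (x - y)) =
      ∫⁻ x in Metric.ball (0 : Euc N) 1, ∫⁻ y in Metric.ball (0 : Euc N) 1,
        nearDiff p u (k + 1) x (x + ((2 : ℝ) ^ 1)⁻¹ • (y - x)) := by
    rw [lintegral_lintegral_swap]
    exact Measurable.aemeasurable (by unfold Function.uncurry; fun_prop)
  calc nearEnergy p u k
      ≤ ∫⁻ x in Metric.ball (0 : Euc N) 1, ∫⁻ y in Metric.ball (0 : Euc N) 1, 2 ^ (p - 1) *
        (nearDiff p u (k + 1) x (x + ((2 : ℝ) ^ 1)⁻¹ • (y - x)) +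
        nearDiff p u (k + 1) y (y + ((2 : ℝ) ^ 1)⁻¹ • (x - y))) := by
        unfold nearEnergy
        gcongr
        exact nearDiff_le_midpoint hp u k _ _
    _ = 2 ^ (p - 1) * ((∫⁻ x in Metric.ball (0 : Euc N) 1, ∫⁻ y in Metric.ball (0 : Euc N) 1,
        nearDiff p u (k + 1) x (x + ((2 : ℝ) ^ 1)⁻¹ • (y - x))) +
        ∫⁻ x in Metric.ball (0 : Euc N) 1, ∫⁻ y in Metric.ball (0 : Euc N) 1,
        nearDiff p u (k + 1) y (y + ((2 : ℝ) ^ 1)⁻¹ • (x - y))) := by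
        have h2 : (2 : ℝ≥0∞) ^ (p - 1) ≠ ⊤ := ENNReal.rpow_ne_top_of_nonneg (by linarith) (by simp)
        rw [← lintegral_add_left, ← lintegral_const_mul' _ _ h2]
        · refine lintegral_congr fun x => ?_
          rw [← lintegral_add_left (by fun_prop), ← lintegral_const_mul' _ _ h2]
        · exact Measurable.lintegral_prod_right' (f := fun z : Euc N × Euc N =>
            nearDiff p u (k + 1) z.1 (z.1 + ((2 : ℝ) ^ 1)⁻¹ • (z.2 - z.1))) (by fun_prop)
    _ ≤ 2 ^ (p - 1) * (ENNReal.ofReal (((2 : ℝ) ^ 1) ^ (N : ℝ)) * nearEnergy p u (k + 1) +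
          ENNReal.ofReal (((2 : ℝ) ^ 1) ^ (N : ℝ)) * nearEnergy p u (k + 1)) := by
        rw [hswap]; gcongr
    _ = _ := by
        rw [← two_mul, ← mul_assoc, ← mul_assoc]
        congr 1
        have h2 : (2 : ℝ≥0∞) = ENNReal.ofReal 2 := by simp
        rw [h2, ENNReal.ofReal_rpow_of_pos two_pos, ← ENNReal.ofReal_mul (by positivity),
          ← ENNReal.ofReal_mul (by positivity), pow_one]
        congr 1
        rw [add_comm (N : ℝ) p, Real.rpow_add two_pos, Real.rpow_sub two_pos, Real.rpow_one]
        ring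

/-- For a nondecreasing sequence `a`, the normalized sums `(1 - x) * ∑ x ^ k * a k` are
nondecreasing in `x ∈ [0, 1)`. -/
theorem one_sub_mul_tsum_mono {a : ℕ → ℝ≥0∞} (ha : Monotone a) {x y : ℝ≥0∞} (hxy : x ≤ y)
    (hy : y < 1) :
    (1 - x) * ∑' k, x ^ k * a k ≤ (1 - y) * ∑' k, y ^ k * a k := by
  have hle : ∑' k, x ^ k * a k ≤ ∑' k, y ^ k * a k :=
    ENNReal.tsum_le_tsum fun k => by gcongr
  by_cases htop : ∑' k, y ^ k * a k = ⊤
  · rw [htop, ENNReal.mul_top (tsub_pos_of_lt hy).ne']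
    exact le_top
  -- Summation by parts: `b` collects the increments of `a`, and `(1 - z) ∑ z ^ k * a k = ∑ z ^ k *
  -- b k` has nonnegative coefficients, so it is monotone in `z`. Finiteness of the sum is needed to
  -- subtract.
  set b : ℕ → ℝ≥0∞ := fun k => Nat.casesOn k (a 0) (fun j => a (j + 1) - a j) with hb
  have key : ∀ z : ℝ≥0∞, z < 1 → ∑' k, z ^ k * a k ≠ ⊤ →
      (1 - z) * ∑' k, z ^ k * a k = ∑' k, z ^ k * b k := by
    intro z hz hfin
    have hS : ∑' k, z ^ k * a k = ∑' k, z ^ k * b k + z * ∑' k, z ^ k * a k := by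
      rw [← ENNReal.tsum_mul_left, tsum_eq_zero_add' (f := fun k => z ^ k * a k) ENNReal.summable,
        tsum_eq_zero_add' (f := fun k => z ^ k * b k) ENNReal.summable, add_assoc, ← ENNReal.tsum_add]
      congr 1
      refine tsum_congr fun k => ?_
      have : a (k + 1) = b (k + 1) + a k := (tsub_add_cancel_of_le (ha (Nat.le_succ k))).symm
      rw [this, pow_succ]; ring
    rw [ENNReal.sub_mul (fun _ _ => hfin), one_mul]
    have hz' : z * ∑' k, z ^ k * a k ≠ ⊤ := ENNReal.mul_ne_top (hz.trans ENNReal.one_lt_top).ne hfin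
    conv_lhs => enter [1]; rw [hS]
    exact ENNReal.add_sub_cancel_right hz'
  rw [key x (hxy.trans_lt hy) (ne_top_of_le_ne_top htop hle), key y hy htop]
  exact ENNReal.tsum_le_tsum fun k => by gcongr

/-- All the dependence on `s` is put into the ratio `2 ^ (-p (1 - s))`, which tends to 1 as `s → 1`.
-/
theorem ofReal_dyadic_eq {N : ℕ} (s p : ℝ) (k : ℕ) :
    ENNReal.ofReal (((2 : ℝ) ^ k) ^ ((N : ℝ) + s * p)) =
      ENNReal.ofReal (2 ^ (-(p * (1 - s)))) ^ k * ENNReal.ofReal (2 ^ ((N : ℝ) + p)) ^ k := by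
  rw [← ENNReal.ofReal_pow (by positivity), ← ENNReal.ofReal_pow (by positivity),
    ← ENNReal.ofReal_mul (by positivity), ← mul_pow, ← Real.rpow_add two_pos,
    ← Real.rpow_natCast_mul (by norm_num), ← Real.rpow_mul_natCast (by norm_num)]
  congr 2
  ring

theorem tsum_nearEnergy_le {N : ℕ} (hN : 1 ≤ N) {s p : ℝ} (hs : 0 ≤ s) (hp : 1 ≤ p)
    {u : Euc N → ℝ} (hu : Measurable u) :
    ∑' k : ℕ, ENNReal.ofReal (((2 : ℝ) ^ k) ^ ((N : ℝ) + s * p)) * nearEnergy p u k ≤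
      ENNReal.ofReal (2 * 2 ^ ((N : ℝ) + s * p)) *
        iterEnergy s p (Metric.ball 0 1) (Metric.ball 0 1) u := by
  have he : 1 ≤ (N : ℝ) + s * p := by
    have : (1 : ℝ) ≤ N := by exact_mod_cast hN
    nlinarith
  unfold nearEnergy iterEnergy
  rw [← lintegral_const_mul' _ _ ENNReal.ofReal_ne_top]
  have h1 : ∀ k : ℕ, ENNReal.ofReal (((2 : ℝ) ^ k) ^ ((N : ℝ) + s * p)) *
      (∫⁻ x in Metric.ball (0 : Euc N) 1, ∫⁻ y in Metric.ball (0 : Euc N) 1, nearDiff p u k x y) =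
      ∫⁻ x in Metric.ball (0 : Euc N) 1, ∫⁻ y in Metric.ball (0 : Euc N) 1,
        ENNReal.ofReal (((2 : ℝ) ^ k) ^ ((N : ℝ) + s * p)) * nearDiff p u k x y := by
    intro k
    rw [← lintegral_const_mul' _ _ ENNReal.ofReal_ne_top]
    refine lintegral_congr fun x => ?_
    rw [← lintegral_const_mul' _ _ ENNReal.ofReal_ne_top]
  simp_rw [h1]
  rw [← lintegral_tsum]
  · refine lintegral_mono fun x => ?_
    dsimp only
    rw [← lintegral_tsum (fun k => Measurable.aemeasurable (by fun_prop)),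
      ← lintegral_const_mul' _ _ ENNReal.ofReal_ne_top]
    exact lintegral_mono fun y => tsum_nearDiff_le (by linarith) he u x y
  · intro k
    refine Measurable.aemeasurable ?_
    exact Measurable.lintegral_prod_right' (f := fun z : Euc N × Euc N =>
      ENNReal.ofReal (((2 : ℝ) ^ k) ^ ((N : ℝ) + s * p)) * nearDiff p u k z.1 z.2) (by fun_prop)

theorem iterEnergy_le_tsum_nearEnergy {N : ℕ} (hN : 1 ≤ N) {s p : ℝ} (hs : 0 ≤ s) (hp : 1 ≤ p)
    {u : Euc N → ℝ} (hu : Measurable u) :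
    iterEnergy s p (Metric.ball 0 1) (Metric.ball 0 1) u ≤
      ∑' k : ℕ, ENNReal.ofReal (((2 : ℝ) ^ k) ^ ((N : ℝ) + s * p)) * nearEnergy p u k := by
  have he : 1 ≤ (N : ℝ) + s * p := by
    have : (1 : ℝ) ≤ N := by exact_mod_cast hN
    nlinarith
  unfold nearEnergy iterEnergy
  have h1 : ∀ k : ℕ, ENNReal.ofReal (((2 : ℝ) ^ k) ^ ((N : ℝ) + s * p)) *
      (∫⁻ x in Metric.ball (0 : Euc N) 1, ∫⁻ y in Metric.ball (0 : Euc N) 1, nearDiff p u k x y) =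
      ∫⁻ x in Metric.ball (0 : Euc N) 1, ∫⁻ y in Metric.ball (0 : Euc N) 1,
        ENNReal.ofReal (((2 : ℝ) ^ k) ^ ((N : ℝ) + s * p)) * nearDiff p u k x y := by
    intro k
    rw [← lintegral_const_mul' _ _ ENNReal.ofReal_ne_top]
    refine lintegral_congr fun x => ?_
    rw [← lintegral_const_mul' _ _ ENNReal.ofReal_ne_top]
  simp_rw [h1]
  rw [← lintegral_tsum]
  · refine setLIntegral_mono' measurableSet_ball fun x hx => ?_
    rw [← lintegral_tsum (fun k => Measurable.aemeasurable (by fun_prop))]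
    refine setLIntegral_mono' measurableSet_ball fun y hy => ?_
    refine diffPow_mul_rieszKernel_le_tsum he u ?_
    rw [mem_ball_zero_iff] at hx hy
    exact (norm_sub_le x y).trans_lt (by linarith)
  · intro k
    refine Measurable.aemeasurable ?_
    exact Measurable.lintegral_prod_right' (f := fun z : Euc N × Euc N =>
      ENNReal.ofReal (((2 : ℝ) ^ k) ^ ((N : ℝ) + s * p)) * nearDiff p u k z.1 z.2) (by fun_prop)

/-- On the unit ball the energy of order `σ` is controlled by `1 - s` times the energy of order
`s ≥ σ`, with a constant that does not depend on `s`. -/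
theorem exists_iterEnergy_le_one_sub_mul {N : ℕ} (hN : 1 ≤ N) {σ p : ℝ} (hσ : 0 ≤ σ) (hσ1 : σ < 1)
    (hp : 1 ≤ p) :
    ∃ C : ℝ, 0 < C ∧ ∀ s : ℝ, σ ≤ s → s < 1 → ∀ u : Euc N → ℝ, Measurable u →
      iterEnergy σ p (Metric.ball 0 1) (Metric.ball 0 1) u ≤
        ENNReal.ofReal (C * (1 - s)) *
          iterEnergy s p (Metric.ball 0 1) (Metric.ball 0 1) u := by
  have hx1 : ∀ τ : ℝ, τ < 1 → (2 : ℝ) ^ (-(p * (1 - τ))) < 1 := fun τ hτ =>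
    Real.rpow_lt_one_of_one_lt_of_neg (by norm_num) (by nlinarith)
  set A : ℝ := 1 - (2 : ℝ) ^ (-(p * (1 - σ))) with hA
  have hApos : 0 < A := by have := hx1 σ hσ1; linarith
  refine ⟨A⁻¹ * (p * (2 * 2 ^ ((N : ℝ) + p))), by positivity, fun s hσs hs1 u hu => ?_⟩
  set a : ℕ → ℝ≥0∞ := fun k => ENNReal.ofReal (2 ^ ((N : ℝ) + p)) ^ k * nearEnergy p u k with ha
  have hmono : Monotone a := by
    refine monotone_nat_of_le_succ fun k => ?_
    simp only [ha]
    rw [pow_succ, mul_assoc]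
    gcongr
    exact nearEnergy_le_succ hp hu k
  have hsum : ∀ τ : ℝ, ∑' k : ℕ, ENNReal.ofReal (((2 : ℝ) ^ k) ^ ((N : ℝ) + τ * p)) *
      nearEnergy p u k = ∑' k : ℕ, ENNReal.ofReal (2 ^ (-(p * (1 - τ)))) ^ k * a k := by
    intro τ
    refine tsum_congr fun k => ?_
    rw [ofReal_dyadic_eq, ha, mul_assoc]
  have hch := one_sub_mul_tsum_mono hmono
    (x := ENNReal.ofReal (2 ^ (-(p * (1 - σ))))) (y := ENNReal.ofReal (2 ^ (-(p * (1 - s)))))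
    (ENNReal.ofReal_le_ofReal (Real.rpow_le_rpow_of_exponent_le (by norm_num) (by nlinarith)))
    (by rw [← ENNReal.ofReal_one]; exact (ENNReal.ofReal_lt_ofReal_iff one_pos).2 (hx1 s hs1))
  rw [← ENNReal.ofReal_one, ← ENNReal.ofReal_sub _ (by positivity),
    ← ENNReal.ofReal_sub _ (by positivity)] at hch
  -- This is where the gain `1 - s` comes from; at order `σ` the corresponding factor is the fixed
  -- positive number `A`.
  have hlog : 1 - (2 : ℝ) ^ (-(p * (1 - s))) ≤ p * (1 - s) := by
    rw [Real.rpow_def_of_pos two_pos]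
    have h1 := Real.add_one_le_exp (Real.log 2 * -(p * (1 - s)))
    have h2 : Real.log 2 ≤ 1 := by linarith [Real.log_two_lt_d9]
    have h3 : 0 ≤ p * (1 - s) := by nlinarith
    nlinarith
  calc iterEnergy σ p (Metric.ball 0 1) (Metric.ball 0 1) u
      ≤ ∑' k : ℕ, ENNReal.ofReal (2 ^ (-(p * (1 - σ)))) ^ k * a k := by
        rw [← hsum]; exact iterEnergy_le_tsum_nearEnergy hN hσ hp hu
    _ = ENNReal.ofReal A⁻¹ * (ENNReal.ofReal A *
          ∑' k : ℕ, ENNReal.ofReal (2 ^ (-(p * (1 - σ)))) ^ k * a k) := by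
        rw [← mul_assoc, ← ENNReal.ofReal_mul (by positivity), inv_mul_cancel₀ hApos.ne']
        simp
    _ ≤ ENNReal.ofReal A⁻¹ * (ENNReal.ofReal (p * (1 - s)) *
          (ENNReal.ofReal (2 * 2 ^ ((N : ℝ) + p)) *
            iterEnergy s p (Metric.ball 0 1) (Metric.ball 0 1) u)) := by
        refine mul_le_mul_right (hch.trans ?_) _
        refine mul_le_mul' (ENNReal.ofReal_le_ofReal hlog) ?_
        rw [← hsum]
        refine (tsum_nearEnergy_le hN (hσ.trans hσs) hp hu).trans ?_
        gcongr
        · norm_num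
        · nlinarith
    _ = _ := by
        have h3 : 0 ≤ p * (1 - s) := by nlinarith
        rw [← mul_assoc, ← mul_assoc, ← ENNReal.ofReal_mul (by positivity),
          ← ENNReal.ofReal_mul (by positivity)]
        congr 2
        ring

/-! ### Hölder, Jensen and Hedberg's argument. -/

theorem lintegral_rpow_le_of_le {α : Type*} [MeasurableSpace α] {μ : Measure α} {f : α → ℝ≥0∞}
    (hf : Measurable f) {p q : ℝ} (hp : 0 < p) (hpq : p ≤ q) :
    ∫⁻ x, f x ^ p ∂μ ≤ (∫⁻ x, f x ^ q ∂μ) ^ (p / q) * μ Set.univ ^ (1 - p / q) := by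
  have h := eLpNorm'_le_eLpNorm'_mul_rpow_measure_univ (μ := μ) (f := f) hp hpq
    hf.aestronglyMeasurable
  have hq : 0 < q := hp.trans_le hpq
  have h2 := ENNReal.rpow_le_rpow h hp.le
  simp only [eLpNorm', enorm_eq_self] at h2
  rw [ENNReal.mul_rpow_of_nonneg _ _ hp.le, ← ENNReal.rpow_mul, ← ENNReal.rpow_mul,
    ← ENNReal.rpow_mul] at h2
  convert h2 using 2
  · rw [one_div, inv_mul_cancel₀ hp.ne', ENNReal.rpow_one]
  · rw [one_div, div_eq_inv_mul]
  · rw [sub_mul]; field_simp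

/-- Jensen's inequality for the `p`-th power, applied to the mean of `a - u`. -/
theorem enorm_sub_average_rpow_le {N : ℕ} {p : ℝ} (hp : 1 ≤ p) {u : Euc N → ℝ} (hu : Continuous u)
    {r : ℝ} (hr : 0 < r) (a : ℝ) :
    ‖a - ⨍ y in Metric.ball (0 : Euc N) r, u y‖ₑ ^ p ≤
      (volume (Metric.ball (0 : Euc N) r))⁻¹ *
        ∫⁻ y in Metric.ball (0 : Euc N) r, ‖a - u y‖ₑ ^ p := by
  set B := Metric.ball (0 : Euc N) r with hB
  set m := volume B with hm
  have hm0 : m ≠ 0 := (Metric.measure_ball_pos _ _ hr).ne'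
  have hmt : m ≠ ⊤ := measure_ball_lt_top.ne
  have hint : IntegrableOn u B :=
    (hu.continuousOn.integrableOn_compact (isCompact_closedBall 0 r)).mono_set
      Metric.ball_subset_closedBall
  have : IsFiniteMeasure (volume.restrict B) := isFiniteMeasure_restrict.2 hmt
  have h1 : a - ⨍ y in B, u y = ⨍ y in B, (a - u y) := by
    rw [setAverage_eq, setAverage_eq, integral_sub (integrable_const _) hint, smul_sub,
      setIntegral_const, smul_smul, inv_mul_cancel₀, one_smul]
    exact ENNReal.toReal_ne_zero.2 ⟨hm0, hmt⟩
  have h2 : ‖a - ⨍ y in B, u y‖ₑ ≤ m⁻¹ * ∫⁻ y in B, ‖a - u y‖ₑ := by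
    rw [h1, setAverage_eq, enorm_smul]
    refine mul_le_mul' (le_of_eq ?_) (enorm_integral_le_lintegral_enorm _)
    rw [measureReal_def, Real.enorm_eq_ofReal (by positivity), ← ENNReal.toReal_inv,
      ENNReal.ofReal_toReal (ENNReal.inv_ne_top.2 hm0)]
  have h3 := lintegral_rpow_le_of_le (μ := volume.restrict B) (f := fun y => ‖a - u y‖ₑ)
    (by fun_prop) one_pos hp
  simp only [ENNReal.rpow_one, Measure.restrict_apply_univ] at h3
  calc _ ≤ (m⁻¹ * ((∫⁻ y in B, ‖a - u y‖ₑ ^ p) ^ (1 / p) * m ^ (1 - 1 / p))) ^ p :=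
        ENNReal.rpow_le_rpow (h2.trans (mul_le_mul_right h3 _)) (by linarith)
    _ = _ := by
        have hp0 : p ≠ 0 := by linarith
        rw [ENNReal.mul_rpow_of_nonneg _ _ (by linarith),
          ENNReal.mul_rpow_of_nonneg _ _ (by linarith), ← ENNReal.rpow_mul, ← ENNReal.rpow_mul,
          one_div, inv_mul_cancel₀ hp0, ENNReal.rpow_one, mul_comm (∫⁻ y in B, ‖a - u y‖ₑ ^ p),
          ← mul_assoc]
        congr 1
        rw [sub_mul, one_mul, inv_mul_cancel₀ hp0, ← ENNReal.rpow_neg_one, ← ENNReal.rpow_mul,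
          ← ENNReal.rpow_add _ _ hm0 hmt]
        congr 1
        ring

/-- Optimization over dyadic scales in Hedberg's argument. -/
theorem exists_dyadic_weight_le {N : ℕ} (hN : 1 ≤ N) {β w κ : ℝ} (hβ : 0 < β)
    (hκ : 0 < κ) (hw : κ ≤ w) :
    ∃ n : ℕ, ((2 : ℝ) ^ n) ^ (-β) * w + ((2 : ℝ) ^ n) ^ ((N : ℝ) - β) * κ ≤
      2 ^ (1 + β) * (w ^ (1 - β / N) * κ ^ (β / N)) := by
  have hN0 : (0 : ℝ) < N := by exact_mod_cast hN
  have hw0 : 0 < w := hκ.trans_le hw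
  -- The two terms balance when `2 ^ (n N) = w / κ`. Taking the integer part of `n` costs a factor
  -- `2 ^ β`, and `κ ≤ w` makes `n` nonnegative.
  obtain ⟨n, hn1, hn2⟩ := exists_nat_pow_near (x := w / κ) (y := (2 : ℝ) ^ N)
    (by rwa [one_le_div hκ]) (one_lt_pow₀ (by norm_num) (by omega))
  refine ⟨n, ?_⟩
  set Y : ℝ := 2 ^ n with hY
  have hY0 : 0 < Y := by positivity
  have hYN : ((2 : ℝ) ^ N) ^ n = Y ^ (N : ℝ) := by
    rw [Real.rpow_natCast, hY, ← pow_mul, ← pow_mul, mul_comm]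
  rw [pow_succ, hYN] at hn2
  rw [hYN] at hn1
  rw [le_div_iff₀ hκ] at hn1
  have h1 : Y ^ ((N : ℝ) - β) * κ ≤ Y ^ (-β) * w := by
    have : Y ^ ((N : ℝ) - β) = Y ^ (-β) * Y ^ (N : ℝ) := by
      rw [← Real.rpow_add hY0]; congr 1; ring
    rw [this, mul_assoc]
    exact mul_le_mul_of_nonneg_left hn1 (by positivity)
  have h2 : (w / κ) ^ (β / N) ≤ 2 ^ β * Y ^ β := by
    calc (w / κ) ^ (β / N) ≤ (Y ^ (N : ℝ) * 2 ^ N) ^ (β / N) :=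
          Real.rpow_le_rpow (by positivity) hn2.le (by positivity)
      _ = _ := by
          rw [Real.mul_rpow (by positivity) (by positivity), ← Real.rpow_natCast 2 N,
            ← Real.rpow_mul (by positivity), ← Real.rpow_mul (by positivity),
            mul_div_cancel₀ _ hN0.ne', mul_comm]
  have h3 : Y ^ (-β) * w ≤ 2 ^ β * (w ^ (1 - β / N) * κ ^ (β / N)) := by
    rw [Real.div_rpow hw0.le hκ.le, div_le_iff₀ (by positivity)] at h2
    have h4 : w = w ^ (1 - β / N) * w ^ (β / N) := by
      rw [← Real.rpow_add hw0]; simp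
    have h5 : Y ^ (-β) * Y ^ β = 1 := by rw [← Real.rpow_add hY0]; simp
    calc Y ^ (-β) * w = Y ^ (-β) * w ^ (1 - β / N) * w ^ (β / N) := by
          conv_lhs => rw [h4]
          ring
      _ ≤ Y ^ (-β) * w ^ (1 - β / N) * (2 ^ β * Y ^ β * κ ^ (β / N)) := by gcongr
      _ = (Y ^ (-β) * Y ^ β) * (2 ^ β * (w ^ (1 - β / N) * κ ^ (β / N))) := by ring
      _ = _ := by rw [h5, one_mul]
  rw [Real.rpow_add two_pos, Real.rpow_one]
  linarith

/-- If `κ ≤ W` one chooses the optimal scale. If `W ≤ κ` that scale would exceed the size of the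
ball, and the scale-free bound `h0` already suffices. -/
theorem hedberg_pointwise {N : ℕ} (hN : 1 ≤ N) {β : ℝ} (hβ : 0 < β) (hβN : β < N)
    {F W κ θ : ℝ≥0∞} (hκ0 : κ ≠ 0) (hκt : κ ≠ ⊤)
    (h0 : F ≤ θ * W)
    (h : ∀ n : ℕ, F ≤ θ * (ENNReal.ofReal (((2 : ℝ) ^ n) ^ (-β)) * W +
      ENNReal.ofReal (((2 : ℝ) ^ n) ^ ((N : ℝ) - β)) * κ)) :
    F ≤ ENNReal.ofReal (2 ^ (1 + β)) * θ * (W ^ (1 - β / N) * κ ^ (β / N)) := by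
  have hN0 : (0 : ℝ) < N := by exact_mod_cast hN
  have hα : 0 < β / N := by positivity
  have hα1 : 0 < 1 - β / N := by rw [sub_pos, div_lt_one hN0]; exact hβN
  have hone : 1 ≤ ENNReal.ofReal ((2 : ℝ) ^ (1 + β)) := by
    rw [← ENNReal.ofReal_one]
    exact ENNReal.ofReal_le_ofReal (Real.one_le_rpow (by norm_num) (by linarith))
  rcases eq_or_ne W ⊤ with rfl | hWt
  · rcases eq_or_ne θ 0 with rfl | hθ
    · simpa using h0
    · rw [ENNReal.top_rpow_of_pos hα1, ENNReal.top_mul, ENNReal.mul_top]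
      · exact le_top
      · exact mul_ne_zero (by positivity) hθ
      · simp [hκ0, hκt]
  rcases le_total W κ with hle | hle
  · calc F ≤ θ * W := h0
      _ = θ * (W ^ (1 - β / N) * W ^ (β / N)) := by
          rw [← ENNReal.rpow_add_of_nonneg _ _ hα1.le hα.le]; simp
      _ ≤ 1 * θ * (W ^ (1 - β / N) * κ ^ (β / N)) := by rw [one_mul]; gcongr
      _ ≤ _ := by gcongr
  · have hκr : 0 < κ.toReal := ENNReal.toReal_pos hκ0 hκt
    obtain ⟨n, hn⟩ := exists_dyadic_weight_le hN hβ hκr (ENNReal.toReal_mono hWt hle)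
    refine (h n).trans ?_
    rw [mul_comm _ θ, mul_assoc]
    gcongr
    rw [← ENNReal.ofReal_toReal hWt, ← ENNReal.ofReal_toReal hκt,
      ENNReal.ofReal_rpow_of_nonneg (by positivity) hα1.le,
      ENNReal.ofReal_rpow_of_nonneg (by positivity) hα.le,
      ← ENNReal.ofReal_mul (by positivity), ← ENNReal.ofReal_mul (by positivity),
      ← ENNReal.ofReal_add (by positivity) (by positivity), ← ENNReal.ofReal_mul (by positivity),
      ← ENNReal.ofReal_mul (by positivity)]
    exact ENNReal.ofReal_le_ofReal hn

/-- Hedberg's argument: a scale-by-scale bound for `F` implies an integral bound. -/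
theorem hedberg {α : Type*} [MeasurableSpace α] {μ : Measure α} {N : ℕ} (hN : 1 ≤ N) {β : ℝ}
    (hβ : 0 < β) (hβN : β < N) {F W : α → ℝ≥0∞} {κ θ : ℝ≥0∞}
    (hκ : κ = (∫⁻ x, F x ^ ((N : ℝ) / (N - β)) ∂μ) ^ (((N : ℝ) - β) / N)) (hκt : κ ≠ ⊤)
    (h0 : ∀ᵐ x ∂μ, F x ≤ θ * W x)
    (h : ∀ᵐ x ∂μ, ∀ n : ℕ, F x ≤ θ * (ENNReal.ofReal (((2 : ℝ) ^ n) ^ (-β)) * W x +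
      ENNReal.ofReal (((2 : ℝ) ^ n) ^ ((N : ℝ) - β)) * κ)) (hW : AEMeasurable W μ) :
    κ ≤ (ENNReal.ofReal (2 ^ (1 + β)) * θ) ^ ((N : ℝ) / (N - β)) * ∫⁻ x, W x ∂μ := by
  rcases eq_or_ne κ 0 with h00 | hκ0
  · rw [h00]; exact zero_le
  have hN0 : (0 : ℝ) < N := by exact_mod_cast hN
  have hNβ : (0 : ℝ) < N - β := by linarith
  set C := (ENNReal.ofReal (2 ^ (1 + β)) * θ) ^ ((N : ℝ) / (N - β)) with hC
  have hpt : ∀ᵐ x ∂μ, F x ^ ((N : ℝ) / (N - β)) ≤ C * κ ^ (β / (N - β)) * W x := by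
    filter_upwards [h0, h] with x hx0 hx
    have := ENNReal.rpow_le_rpow (hedberg_pointwise hN hβ hβN hκ0 hκt hx0 hx)
      (show 0 ≤ (N : ℝ) / (N - β) by positivity)
    refine this.trans (le_of_eq ?_)
    rw [ENNReal.mul_rpow_of_nonneg _ _ (by positivity),
      ENNReal.mul_rpow_of_nonneg (W x ^ _) _ (by positivity), ← ENNReal.rpow_mul,
      ← ENNReal.rpow_mul, mul_assoc, mul_comm (W x ^ _)]
    congr 3
    · field_simp
    · have : (1 - β / N) * (N / (N - β)) = (1 : ℝ) := by field_simp
      rw [this, ENNReal.rpow_one]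
  have hint : ∫⁻ x, F x ^ ((N : ℝ) / (N - β)) ∂μ ≤ C * κ ^ (β / (N - β)) * ∫⁻ x, W x ∂μ := by
    rw [← lintegral_const_mul'' _ hW]
    exact lintegral_mono_ae hpt
  -- The integral of the pointwise bound contains `κ ^ (β / (N - β))` on both sides; it can be
  -- cancelled because `κ` is finite and nonzero, leaving one power of `κ`.
  have hκpow : ∫⁻ x, F x ^ ((N : ℝ) / (N - β)) ∂μ = κ ^ (β / (N - β)) * κ := by
    conv_rhs => enter [2]; rw [← ENNReal.rpow_one κ]
    rw [← ENNReal.rpow_add _ _ hκ0 hκt, hκ, ← ENNReal.rpow_mul]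
    have : ((N : ℝ) - β) / N * (β / (N - β) + 1) = 1 := by field_simp; ring
    rw [this, ENNReal.rpow_one]
  rw [hκpow, mul_comm C, mul_assoc] at hint
  exact (ENNReal.mul_le_mul_iff_right (by simp [hκ0, hκt]) (by simp [hκ0, hκt])).1 hint

/-! ### The critical Sobolev inequality on the unit ball. -/

theorem diffPow_le_mul_rieszKernel {N : ℕ} {p e ρ : ℝ} (hp : 0 < p) (he : 0 ≤ e)
    (u : Euc N → ℝ) {x y : Euc N} (h : ‖x - y‖ ≤ ρ) :
    diffPow p u x y ≤ ENNReal.ofReal (ρ ^ e) * (diffPow p u x y * rieszKernel e (x - y)) := by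
  rcases eq_or_ne x y with rfl | hne
  · simp [diffPow_self hp]
  have hpos : 0 < ‖x - y‖ := norm_pos_iff.2 (sub_ne_zero.2 hne)
  have : 1 ≤ ENNReal.ofReal (ρ ^ e) * rieszKernel e (x - y) := by
    unfold rieszKernel
    rw [← ENNReal.ofReal_mul (by have := hpos.trans_le h; positivity), ← ENNReal.ofReal_one]
    refine ENNReal.ofReal_le_ofReal ?_
    rw [Real.rpow_neg hpos.le, ← div_eq_mul_inv, one_le_div (by positivity)]
    exact Real.rpow_le_rpow hpos.le h he
  calc _ = diffPow p u x y * 1 := by rw [mul_one]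
    _ ≤ diffPow p u x y * (ENNReal.ofReal (ρ ^ e) * rieszKernel e (x - y)) := by gcongr
    _ = _ := by ring

theorem nearDiff_le_mul_rieszKernel {N : ℕ} {p e : ℝ} (hp : 0 < p) (he : 0 ≤ e)
    (u : Euc N → ℝ) (k : ℕ) (x y : Euc N) :
    nearDiff p u k x y ≤
      ENNReal.ofReal ((2 / 2 ^ k) ^ e) * (diffPow p u x y * rieszKernel e (x - y)) := by
  unfold nearDiff
  split_ifs with h
  · refine diffPow_le_mul_rieszKernel hp he u ?_
    rw [le_div_iff₀ (by positivity), mul_comm]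
    exact h.le
  · exact zero_le

/-- Averages of a function over a contracted ball, estimated by Hölder's inequality. -/
theorem lintegral_contract_le_rpow {N : ℕ} {β : ℝ} (hβ : 0 ≤ β) (hβN : β < N) (k : ℕ) {x : Euc N}
    (hx : x ∈ Metric.ball (0 : Euc N) 1) {F : Euc N → ℝ≥0∞} (hF : Measurable F) :
    ∫⁻ z in Metric.ball (0 : Euc N) 1, F (x + ((2 : ℝ) ^ k)⁻¹ • (z - x)) ≤
      volume (Metric.ball (0 : Euc N) 1) ^ (β / N) * (ENNReal.ofReal (((2 : ℝ) ^ k) ^ ((N : ℝ) - β)) *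
        (∫⁻ y in Metric.ball (0 : Euc N) 1, F y ^ ((N : ℝ) / (N - β))) ^ (((N : ℝ) - β) / N)) := by
  have hNβ : (0 : ℝ) < N - β := by linarith
  have hN0 : (0 : ℝ) < N := by linarith
  have h1 := lintegral_rpow_le_of_le (μ := volume.restrict (Metric.ball (0 : Euc N) 1))
    (f := fun z => F (x + ((2 : ℝ) ^ k)⁻¹ • (z - x))) (by fun_prop) one_pos
    (show 1 ≤ (N : ℝ) / (N - β) by rw [one_le_div hNβ]; linarith)
  simp only [ENNReal.rpow_one, Measure.restrict_apply_univ] at h1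
  refine h1.trans ?_
  rw [mul_comm, show 1 - 1 / ((N : ℝ) / (N - β)) = β / N by field_simp; ring,
    show 1 / ((N : ℝ) / (N - β)) = (N - β) / N by field_simp]
  gcongr
  have h2 := lintegral_ball_contract_le (k := k) hx (f := fun y => F y ^ ((N : ℝ) / (N - β)))
    (by fun_prop)
  refine (ENNReal.rpow_le_rpow h2 (show 0 ≤ ((N : ℝ) - β) / N by positivity)).trans ?_
  rw [ENNReal.mul_rpow_of_nonneg _ _ (by positivity),
    ENNReal.ofReal_rpow_of_nonneg (by positivity) (by positivity),
    ← Real.rpow_mul (by positivity), mul_div_cancel₀ _ hN0.ne']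
  gcongr
  split_ifs
  · exact le_rfl
  · exact zero_le

theorem lintegral_contract_diffPow_le {N : ℕ} {p : ℝ} {u : Euc N → ℝ} (hu : Measurable u) (k : ℕ)
    {x : Euc N} (hx : x ∈ Metric.ball (0 : Euc N) 1) :
    ∫⁻ z in Metric.ball (0 : Euc N) 1, diffPow p u x (x + ((2 : ℝ) ^ k)⁻¹ • (z - x)) ≤
      ENNReal.ofReal (((2 : ℝ) ^ k) ^ (N : ℝ)) *
        ∫⁻ y in Metric.ball (0 : Euc N) 1, nearDiff p u k x y :=
  lintegral_ball_contract_le (k := k) hx (f := fun y => diffPow p u x y) (by fun_prop)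

/-- Comparison of the value at a point of the ball with the average over a contracted ball. -/
theorem volume_mul_enorm_rpow_le {N : ℕ} {p β : ℝ} (hp : 1 ≤ p) (hβ : 0 ≤ β) (hβN : β < N)
    {u : Euc N → ℝ} (hu : Measurable u) (c : ℝ) (k : ℕ) {x : Euc N}
    (hx : x ∈ Metric.ball (0 : Euc N) 1) :
    volume (Metric.ball (0 : Euc N) 1) * ‖u x - c‖ₑ ^ p ≤ 2 ^ (p - 1) *
      (ENNReal.ofReal (((2 : ℝ) ^ k) ^ (N : ℝ)) *
        (∫⁻ y in Metric.ball (0 : Euc N) 1, nearDiff p u k x y) +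
      volume (Metric.ball (0 : Euc N) 1) ^ (β / N) * (ENNReal.ofReal (((2 : ℝ) ^ k) ^ ((N : ℝ) - β)) *
        (∫⁻ y in Metric.ball (0 : Euc N) 1, (‖u y - c‖ₑ ^ p) ^ ((N : ℝ) / (N - β))) ^
          (((N : ℝ) - β) / N))) := by
  calc volume (Metric.ball (0 : Euc N) 1) * ‖u x - c‖ₑ ^ p
      = ∫⁻ z in Metric.ball (0 : Euc N) 1, ‖u x - c‖ₑ ^ p := by
        rw [setLIntegral_const, mul_comm]
    _ ≤ ∫⁻ z in Metric.ball (0 : Euc N) 1, 2 ^ (p - 1) *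
          (diffPow p u x (x + ((2 : ℝ) ^ k)⁻¹ • (z - x)) +
            ‖u (x + ((2 : ℝ) ^ k)⁻¹ • (z - x)) - c‖ₑ ^ p) := by
        refine lintegral_mono fun z => ?_
        have := enorm_add_rpow_le hp (u x - u (x + ((2 : ℝ) ^ k)⁻¹ • (z - x)))
          (u (x + ((2 : ℝ) ^ k)⁻¹ • (z - x)) - c)
        simpa [diffPow] using this
    _ = 2 ^ (p - 1) * ((∫⁻ z in Metric.ball (0 : Euc N) 1,
          diffPow p u x (x + ((2 : ℝ) ^ k)⁻¹ • (z - x))) +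
          ∫⁻ z in Metric.ball (0 : Euc N) 1, ‖u (x + ((2 : ℝ) ^ k)⁻¹ • (z - x)) - c‖ₑ ^ p) := by
        rw [lintegral_const_mul, lintegral_add_left] <;> fun_prop
    _ ≤ _ := by
        gcongr
        · exact lintegral_contract_diffPow_le hu k hx
        · exact lintegral_contract_le_rpow hβ hβN k hx (F := fun y => ‖u y - c‖ₑ ^ p)
            (by fun_prop)

/-- Bounds powers of fixed quantities such as the volume of the ball uniformly in the exponent,
which depends on `s`, `p` or `q`. -/
theorem rpow_le_one_add {a : ℝ≥0∞} {t : ℝ} (h0 : 0 ≤ t) (h1 : t ≤ 1) : a ^ t ≤ 1 + a := by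
  rcases le_total a 1 with h | h
  · exact (ENNReal.rpow_le_one h h0).trans le_self_add
  · refine le_trans ?_ (le_add_self : a ≤ 1 + a)
    conv_rhs => rw [← ENNReal.rpow_one a]
    exact ENNReal.rpow_le_rpow_of_exponent_le h h1

theorem one_le_two_rpow {p : ℝ} (hp : 1 ≤ p) : (1 : ℝ≥0∞) ≤ 2 ^ (p - 1) := by
  simpa using ENNReal.rpow_le_rpow_of_exponent_le (x := 2) (by norm_num) (sub_nonneg.2 hp)

/-- The a priori finiteness without which Hedberg's argument could not cancel a power of `κ`. -/
theorem lintegral_ball_enorm_sub_rpow_ne_top {N : ℕ} {u : Euc N → ℝ} (hu : Continuous u)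
    {p q : ℝ} (hp : 0 ≤ p) (hq : 0 ≤ q) (c : ℝ) :
    ∫⁻ x in Metric.ball (0 : Euc N) 1, (‖u x - c‖ₑ ^ p) ^ q ≠ ⊤ := by
  obtain ⟨M, hM⟩ := (isCompact_closedBall (0 : Euc N) 1).exists_bound_of_continuousOn
    (f := fun x => u x - c) (by fun_prop)
  refine ((setLIntegral_mono' measurableSet_ball
    (g := fun _ => (ENNReal.ofReal M ^ p) ^ q) fun x hx => ?_).trans_lt ?_).ne
  · refine ENNReal.rpow_le_rpow (ENNReal.rpow_le_rpow ?_ hp) hq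
    rw [← ofReal_norm]
    exact ENNReal.ofReal_le_ofReal (hM x (Metric.ball_subset_closedBall hx))
  · rw [setLIntegral_const]
    exact ENNReal.mul_lt_top (lt_top_iff_ne_top.2 (ENNReal.rpow_ne_top_of_nonneg hq
      (ENNReal.rpow_ne_top_of_nonneg hp ENNReal.ofReal_ne_top))) measure_ball_lt_top

/-- The fractional Poincaré-Sobolev inequality on the unit ball at the critical exponent. -/
theorem sobolev_ball {N : ℕ} (hN : 1 ≤ N) {s p : ℝ} (hs : 0 < s) (hp : 1 ≤ p) (hsp : s * p < N) :
    ∃ C : ℝ≥0∞, C ≠ ⊤ ∧ ∀ u : Euc N → ℝ, Continuous u →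
      (∫⁻ x in Metric.ball (0 : Euc N) 1,
        (‖u x - ⨍ y in Metric.ball (0 : Euc N) 1, u y‖ₑ ^ p) ^ ((N : ℝ) / (N - s * p))) ^
          (((N : ℝ) - s * p) / N) ≤
        C * iterEnergy s p (Metric.ball 0 1) (Metric.ball 0 1) u := by
  set B := Metric.ball (0 : Euc N) 1 with hB
  set m := volume B with hm
  have hm0 : m ≠ 0 := (Metric.measure_ball_pos _ _ one_pos).ne'
  have hmt : m ≠ ⊤ := measure_ball_lt_top.ne
  have hβ : 0 < s * p := by positivity
  have hN0 : (0 : ℝ) < N := by linarith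
  have h2p : (2 : ℝ≥0∞) ^ (p - 1) ≠ ⊤ := ENNReal.rpow_ne_top_of_nonneg (by linarith) (by simp)
  set e : ℝ := (N : ℝ) + s * p with he
  -- The constants of the near part and of the average part are added, so that one `θ` serves for
  -- both terms and for the scale-free bound.
  set θ : ℝ≥0∞ := m⁻¹ * (2 ^ (p - 1) * (ENNReal.ofReal (2 ^ e) + m ^ (s * p / N))) with hθ
  have hθt : θ ≠ ⊤ := by
    refine ENNReal.mul_ne_top (ENNReal.inv_ne_top.2 hm0) (ENNReal.mul_ne_top h2p ?_)
    exact ENNReal.add_ne_top.2 ⟨ENNReal.ofReal_ne_top,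
      ENNReal.rpow_ne_top_of_nonneg (by positivity) hmt⟩
  refine ⟨(ENNReal.ofReal (2 ^ (1 + s * p)) * θ) ^ ((N : ℝ) / (N - s * p)), ?_, fun u hu => ?_⟩
  · refine ENNReal.rpow_ne_top_of_nonneg ?_ (ENNReal.mul_ne_top ENNReal.ofReal_ne_top hθt)
    exact div_nonneg hN0.le (by linarith)
  set c := ⨍ y in B, u y with hc
  set F : Euc N → ℝ≥0∞ := fun x => ‖u x - c‖ₑ ^ p with hF
  set W : Euc N → ℝ≥0∞ := fun x => ∫⁻ y in B, diffPow p u x y * rieszKernel e (x - y) with hW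
  have hum : Measurable u := hu.measurable
  have hFm : Measurable F := by fun_prop
  have hWm : Measurable W := Measurable.lintegral_prod_right'
    (f := fun z : Euc N × Euc N => diffPow p u z.1 z.2 * rieszKernel e (z.1 - z.2)) (by fun_prop)
  -- On near pairs the kernel is at least `(2 / 2 ^ k) ^ (-e)`, and `N - e = -(s p)` gives the decay
  -- in the scale.
  have hnear : ∀ k : ℕ, ∀ x, ENNReal.ofReal (((2 : ℝ) ^ k) ^ (N : ℝ)) *
      (∫⁻ y in B, nearDiff p u k x y) ≤
      ENNReal.ofReal (2 ^ e) * (ENNReal.ofReal (((2 : ℝ) ^ k) ^ (-(s * p))) * W x) := by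
    intro k x
    calc _ ≤ ENNReal.ofReal (((2 : ℝ) ^ k) ^ (N : ℝ)) *
          (ENNReal.ofReal ((2 / 2 ^ k) ^ e) * W x) := by
          gcongr
          rw [hW, ← lintegral_const_mul' _ _ ENNReal.ofReal_ne_top]
          exact lintegral_mono fun y => nearDiff_le_mul_rieszKernel (by linarith) (by positivity) u k x y
      _ = _ := by
          rw [← mul_assoc, ← mul_assoc, ← ENNReal.ofReal_mul (by positivity),
            ← ENNReal.ofReal_mul (by positivity)]
          congr 2
          rw [Real.div_rpow (by positivity) (by positivity), div_eq_mul_inv,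
            ← Real.rpow_neg (by positivity), mul_left_comm, ← Real.rpow_add (by positivity)]
          congr 2
          rw [he]; ring
  refine hedberg (μ := volume.restrict B) (F := F) (W := W) hN hβ hsp rfl ?_ ?_ ?_ hWm.aemeasurable
  · exact ENNReal.rpow_ne_top_of_nonneg (div_nonneg (by linarith) hN0.le)
      (lintegral_ball_enorm_sub_rpow_ne_top hu (by linarith) (div_nonneg hN0.le (by linarith)) c)
  · refine ae_restrict_of_forall_mem measurableSet_ball fun x hx => ?_
    calc F x ≤ m⁻¹ * ∫⁻ y in B, diffPow p u x y :=
          enorm_sub_average_rpow_le hp hu one_pos (u x)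
      _ ≤ m⁻¹ * (ENNReal.ofReal (2 ^ e) * W x) := by
          gcongr
          rw [hW, ← lintegral_const_mul' _ _ ENNReal.ofReal_ne_top]
          refine setLIntegral_mono' measurableSet_ball fun y hy => ?_
          refine diffPow_le_mul_rieszKernel (by linarith) (by positivity) u ?_
          have hx' := mem_ball_zero_iff.1 hx
          have hy' := mem_ball_zero_iff.1 hy
          exact (norm_sub_le x y).trans (by linarith)
      _ ≤ m⁻¹ * ((2 ^ (p - 1) * (ENNReal.ofReal (2 ^ e) + m ^ (s * p / N))) * W x) := by
          gcongr
          refine le_trans ?_ (mul_le_mul_left (one_le_two_rpow hp) _)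
          rw [one_mul]; exact le_self_add
      _ = _ := by rw [hθ]; ring
  · refine ae_restrict_of_forall_mem measurableSet_ball fun x hx k => ?_
    have h1 := volume_mul_enorm_rpow_le hp hβ.le hsp hum c k hx
    set κ := (∫⁻ y in B, F y ^ ((N : ℝ) / (N - s * p))) ^ (((N : ℝ) - s * p) / N) with hκ
    calc F x = m⁻¹ * (m * F x) := by rw [← mul_assoc, ENNReal.inv_mul_cancel hm0 hmt, one_mul]
      _ ≤ m⁻¹ * (2 ^ (p - 1) *
          (ENNReal.ofReal (2 ^ e) * (ENNReal.ofReal (((2 : ℝ) ^ k) ^ (-(s * p))) * W x) +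
            m ^ (s * p / N) * (ENNReal.ofReal (((2 : ℝ) ^ k) ^ ((N : ℝ) - s * p)) * κ))) := by
          refine mul_le_mul_right (h1.trans ?_) _
          exact mul_le_mul_right (add_le_add (hnear k x) le_rfl) _
      _ ≤ m⁻¹ * (2 ^ (p - 1) *
          ((ENNReal.ofReal (2 ^ e) + m ^ (s * p / N)) *
            (ENNReal.ofReal (((2 : ℝ) ^ k) ^ (-(s * p))) * W x) +
          (ENNReal.ofReal (2 ^ e) + m ^ (s * p / N)) *
            (ENNReal.ofReal (((2 : ℝ) ^ k) ^ ((N : ℝ) - s * p)) * κ))) := by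
          gcongr
          · exact le_self_add
          · exact le_add_self
      _ = _ := by rw [hθ]; ring

/-! ### Mass of the kernel, exterior oscillation and the gain `s`. -/

/-- Polar coordinates: the Jacobian `y ^ (N - 1)` turns `γ - N` into `γ - 1`. The set `S` of radii
covers both the far integral (`γ < 0`) and the one near the origin (`γ > 0`). -/
theorem lintegral_indicator_norm_rpow {N : ℕ} (hN : 1 ≤ N) (γ : ℝ) {S : Set ℝ}
    (hS : MeasurableSet S)
    (hint : IntegrableOn (fun y : ℝ => y ^ (γ - 1)) (Set.Ioi 0 ∩ S)) :
    ∫⁻ x : Euc N, ENNReal.ofReal (S.indicator (fun y : ℝ => y ^ (γ - N)) ‖x‖) =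
      ENNReal.ofReal (N * volume.real (Metric.ball (0 : Euc N) 1) *
        ∫ y in Set.Ioi 0 ∩ S, y ^ (γ - 1)) := by
  have : Nonempty (Fin N) := ⟨⟨0, by omega⟩⟩
  have hdim : Module.finrank ℝ (Euc N) = N := by simp
  have hcongr : Set.EqOn
      (fun y : ℝ => y ^ (Module.finrank ℝ (Euc N) - 1) • S.indicator (fun y : ℝ => y ^ (γ - N)) y)
      (S.indicator fun y => y ^ (γ - 1)) (Set.Ioi 0) := by
    intro y hy
    have hy0 : (0 : ℝ) < y := hy
    by_cases hyS : y ∈ S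
    · simp only [Set.indicator_of_mem hyS, smul_eq_mul, hdim]
      rw [← Real.rpow_natCast, ← Real.rpow_add hy0, Nat.cast_sub hN]
      congr 1; push_cast; ring
    · simp [Set.indicator_of_notMem hyS]
  have hI : Integrable (fun x : Euc N => S.indicator (fun y : ℝ => y ^ (γ - N)) ‖x‖) := by
    rw [integrable_fun_norm_addHaar volume (f := S.indicator (fun y : ℝ => y ^ (γ - N))),
      integrableOn_congr_fun hcongr measurableSet_Ioi, IntegrableOn, integrable_indicator_iff hS,
      IntegrableOn, Measure.restrict_restrict hS, Set.inter_comm]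
    exact hint
  rw [← ofReal_integral_eq_lintegral_ofReal hI
    (Eventually.of_forall fun x => ?_)]
  · rw [integral_fun_norm_addHaar volume (S.indicator (fun y : ℝ => y ^ (γ - N))),
      setIntegral_congr_fun measurableSet_Ioi hcongr, setIntegral_indicator hS, hdim]
    simp [mul_assoc]
  · exact Set.indicator_apply_nonneg fun _ => by positivity

theorem lintegral_rieszKernel_tail {N : ℕ} (hN : 1 ≤ N) {β a : ℝ} (hβ : 0 < β) (ha : 0 < a) :
    ∫⁻ y in {y : Euc N | a < ‖y‖}, rieszKernel ((N : ℝ) + β) y =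
      ENNReal.ofReal (N * volume.real (Metric.ball (0 : Euc N) 1) * (a ^ (-β) / β)) := by
  have hset : Set.Ioi (0 : ℝ) ∩ Set.Ioi a = Set.Ioi a :=
    Set.inter_eq_right.2 (Set.Ioi_subset_Ioi ha.le)
  have h := lintegral_indicator_norm_rpow hN (-β) (S := Set.Ioi a) measurableSet_Ioi
    (by rw [hset]; exact integrableOn_Ioi_rpow_of_lt (by linarith) ha)
  rw [hset, integral_Ioi_rpow_of_lt (by linarith) ha] at h
  rw [← lintegral_indicator (measurableSet_lt measurable_const measurable_norm)]
  have h2 : -a ^ (-β - 1 + 1) / (-β - 1 + 1) = a ^ (-β) / β := by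
    rw [sub_add_cancel, neg_div_neg_eq]
  rw [h2] at h
  rw [← h]
  refine lintegral_congr fun x => ?_
  by_cases hx : a < ‖x‖
  · rw [Set.indicator_of_mem (by exact hx), Set.indicator_of_mem (by exact hx), rieszKernel]
    congr 2; ring
  · rw [Set.indicator_of_notMem (by exact hx), Set.indicator_of_notMem (by exact hx)]
    simp

theorem lintegral_norm_rpow_closedBall {N : ℕ} (hN : 1 ≤ N) {δ a : ℝ} (hδ : 0 < δ) (ha : 0 < a) :
    ∫⁻ y in {y : Euc N | ‖y‖ ≤ a}, ENNReal.ofReal (‖y‖ ^ (δ - N)) =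
      ENNReal.ofReal (N * volume.real (Metric.ball (0 : Euc N) 1) * (a ^ δ / δ)) := by
  have hset : Set.Ioi (0 : ℝ) ∩ Set.Iic a = Set.Ioc 0 a := rfl
  have h := lintegral_indicator_norm_rpow hN δ (S := Set.Iic a) measurableSet_Iic
    (by
      rw [hset, ← intervalIntegrable_iff_integrableOn_Ioc_of_le ha.le]
      exact intervalIntegral.intervalIntegrable_rpow' (by linarith))
  rw [hset, ← intervalIntegral.integral_of_le ha.le, integral_rpow (Or.inl (by linarith)),
    sub_add_cancel, Real.zero_rpow hδ.ne', sub_zero] at h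
  rw [← lintegral_indicator (measurableSet_le measurable_norm measurable_const), ← h]
  refine lintegral_congr fun x => ?_
  by_cases hx : ‖x‖ ≤ a
  · rw [Set.indicator_of_mem (by exact hx), Set.indicator_of_mem (by exact hx)]
  · rw [Set.indicator_of_notMem (by exact hx), Set.indicator_of_notMem (by exact hx)]
    simp

theorem rieszKernel_le_mul_rieszKernel {N : ℕ} {e ρ : ℝ} (he : 0 ≤ e) (hρ : 0 ≤ ρ) {h k : Euc N}
    (hk : k ≠ 0) (hle : ‖k‖ ≤ ρ * ‖h‖) :
    rieszKernel e h ≤ ENNReal.ofReal (ρ ^ e) * rieszKernel e k := by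
  have hk0 : 0 < ‖k‖ := norm_pos_iff.2 hk
  have hh0 : 0 < ‖h‖ := by
    by_contra hcon
    have : ‖h‖ = 0 := le_antisymm (not_lt.1 hcon) (norm_nonneg _)
    rw [this, mul_zero] at hle; linarith
  unfold rieszKernel
  rw [← ENNReal.ofReal_mul (by positivity)]
  refine ENNReal.ofReal_le_ofReal ?_
  rw [Real.rpow_neg hk0.le, Real.rpow_neg hh0.le, ← div_eq_mul_inv, le_div_iff₀ (by positivity),
    inv_mul_le_iff₀ (by positivity), mul_comm, ← Real.mul_rpow hρ hh0.le]
  exact Real.rpow_le_rpow hk0.le hle he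

/-- The oscillation over the exterior of the ball controls the values in the ball. -/
theorem tail_mul_enorm_rpow_le {N : ℕ} (hN : 1 ≤ N) {s p : ℝ} (hs : 0 < s) (hp : 1 ≤ p)
    {u : Euc N → ℝ} (hu : Continuous u) {x : Euc N} (hx : x ∈ Metric.ball (0 : Euc N) 1) :
    ENNReal.ofReal (N * volume.real (Metric.ball (0 : Euc N) 1) * (2 ^ (-(s * p)) / (s * p))) *
        ‖u x - ⨍ y in Metric.ball (0 : Euc N) 1, u y‖ₑ ^ p ≤
      2 ^ (p - 1) * ENNReal.ofReal (2 ^ ((N : ℝ) + s * p)) *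
        ((∫⁻ y, diffPow p u x y * rieszKernel (N + s * p) (x - y)) +
          (volume (Metric.ball (0 : Euc N) 1))⁻¹ *
            iterEnergy s p (Metric.ball 0 1) Set.univ u) := by
  set B := Metric.ball (0 : Euc N) 1 with hB
  set m := volume B with hm
  set c := ⨍ y in B, u y with hc
  set e : ℝ := (N : ℝ) + s * p with he
  -- For `z` in the unit ball and `y ∈ Q` one has `‖z - y‖ ≤ 2 * ‖y‖`, so the kernel at `y` is
  -- bounded by the kernel at `z - y`, uniformly in `z`.
  set Q : Set (Euc N) := {y | 2 < ‖y‖} with hQ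
  have hQm : MeasurableSet Q := measurableSet_lt measurable_const measurable_norm
  have hum : Measurable u := hu.measurable
  have hm0 : m ≠ 0 := (Metric.measure_ball_pos _ _ one_pos).ne'
  have he0 : 0 ≤ e := by positivity
  have hker : ∀ z ∈ B, ∀ y ∈ Q, rieszKernel e y ≤ ENNReal.ofReal (2 ^ e) * rieszKernel e (z - y) := by
    intro z hz y hy
    have hz' : ‖z‖ < 1 := mem_ball_zero_iff.1 hz
    have hy' : 2 < ‖y‖ := hy
    refine rieszKernel_le_mul_rieszKernel he0 (by norm_num) ?_ ?_
    · intro h0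
      rw [sub_eq_zero.1 h0] at hz'; linarith
    · have := norm_sub_le z y; linarith
  have h1 : ENNReal.ofReal (N * volume.real B * (2 ^ (-(s * p)) / (s * p))) * ‖u x - c‖ₑ ^ p =
      ∫⁻ y in Q, ‖u x - c‖ₑ ^ p * rieszKernel e y := by
    rw [lintegral_const_mul _ (by fun_prop), mul_comm,
      lintegral_rieszKernel_tail hN (by positivity) two_pos]
  have h2 : ∀ y ∈ Q, ‖u x - c‖ₑ ^ p * rieszKernel e y ≤ 2 ^ (p - 1) *
      (ENNReal.ofReal (2 ^ e) * (diffPow p u x y * rieszKernel e (x - y)) +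
        m⁻¹ * (ENNReal.ofReal (2 ^ e) *
          ∫⁻ z in B, diffPow p u z y * rieszKernel e (z - y))) := by
    -- The exterior point `y` is the intermediate point between `u x` and the mean; `u y` minus the
    -- mean is then averaged over the ball.
    intro y hy
    have ha : ‖u x - c‖ₑ ^ p ≤ 2 ^ (p - 1) * (diffPow p u x y + ‖u y - c‖ₑ ^ p) := by
      simpa [diffPow] using enorm_add_rpow_le hp (u x - u y) (u y - c)
    have hb : ‖u y - c‖ₑ ^ p ≤ m⁻¹ * ∫⁻ z in B, diffPow p u z y := by
      refine (enorm_sub_average_rpow_le hp hu one_pos (u y)).trans (le_of_eq ?_)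
      congr 1
      exact lintegral_congr fun z => diffPow_comm p u y z
    calc _ ≤ (2 ^ (p - 1) * (diffPow p u x y + m⁻¹ * ∫⁻ z in B, diffPow p u z y)) *
          rieszKernel e y := by gcongr; exact ha.trans (by gcongr)
      _ = 2 ^ (p - 1) * (diffPow p u x y * rieszKernel e y +
          m⁻¹ * ∫⁻ z in B, diffPow p u z y * rieszKernel e y) := by
          rw [lintegral_mul_const _ (by fun_prop)]; ring
      _ ≤ _ := by
          refine mul_le_mul_right (add_le_add ?_ (mul_le_mul_right ?_ _)) _
          · calc _ ≤ diffPow p u x y * (ENNReal.ofReal (2 ^ e) * rieszKernel e (x - y)) := by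
                  gcongr; exact hker x hx y hy
              _ = _ := by ring
          · rw [← lintegral_const_mul' _ _ ENNReal.ofReal_ne_top]
            refine setLIntegral_mono' measurableSet_ball fun z hz => ?_
            calc _ ≤ diffPow p u z y * (ENNReal.ofReal (2 ^ e) * rieszKernel e (z - y)) := by
                  gcongr; exact hker z hz y hy
              _ = _ := by ring
  have hmeas : Measurable fun y => ∫⁻ z in B, diffPow p u z y * rieszKernel e (z - y) :=
    Measurable.lintegral_prod_right' (f := fun w : Euc N × Euc N =>
      diffPow p u w.2 w.1 * rieszKernel e (w.2 - w.1)) (by fun_prop)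
  have hsw : ∫⁻ y in Q, ∫⁻ z in B, diffPow p u z y * rieszKernel e (z - y) ≤
      iterEnergy s p B Set.univ u := by
    rw [lintegral_lintegral_swap (Measurable.aemeasurable
      (by unfold Function.uncurry; fun_prop))]
    unfold iterEnergy
    refine lintegral_mono fun z => ?_
    exact lintegral_mono_set (Set.subset_univ _)
  rw [h1]
  calc _ ≤ ∫⁻ y in Q, 2 ^ (p - 1) *
      (ENNReal.ofReal (2 ^ e) * (diffPow p u x y * rieszKernel e (x - y)) +
        m⁻¹ * (ENNReal.ofReal (2 ^ e) *
          ∫⁻ z in B, diffPow p u z y * rieszKernel e (z - y))) := setLIntegral_mono' hQm h2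
    _ = 2 ^ (p - 1) * (ENNReal.ofReal (2 ^ e) *
        (∫⁻ y in Q, diffPow p u x y * rieszKernel e (x - y)) +
        m⁻¹ * (ENNReal.ofReal (2 ^ e) * ∫⁻ y in Q, ∫⁻ z in B, diffPow p u z y * rieszKernel e (z - y))) := by
        rw [lintegral_const_mul, lintegral_add_left, lintegral_const_mul, lintegral_const_mul,
          lintegral_const_mul] <;> fun_prop
    _ ≤ 2 ^ (p - 1) * (ENNReal.ofReal (2 ^ e) *
        (∫⁻ y, diffPow p u x y * rieszKernel e (x - y)) +
        m⁻¹ * (ENNReal.ofReal (2 ^ e) * iterEnergy s p B Set.univ u)) := by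
        gcongr
        exact Measure.restrict_le_self
    _ = _ := by ring

theorem sum_range_two_pow_rpow_le {N : ℕ} (hN : 1 ≤ N) (n : ℕ) :
    ∑ k ∈ Finset.range (n + 1), ((2 : ℝ) ^ k) ^ (N : ℝ) ≤ 2 * ((2 : ℝ) ^ n) ^ (N : ℝ) := by
  induction n with
  | zero => norm_num
  | succ n ih =>
    rw [Finset.sum_range_succ]
    have h2 : ((2 : ℝ) ^ (n + 1)) ^ (N : ℝ) = ((2 : ℝ) ^ n) ^ (N : ℝ) * 2 ^ (N : ℝ) := by
      rw [pow_succ, Real.mul_rpow (by positivity) (by positivity)]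
    have h3 : (2 : ℝ) ≤ 2 ^ (N : ℝ) := by
      simpa using Real.rpow_le_rpow_of_exponent_le (x := 2) (by norm_num)
        (show (1 : ℝ) ≤ N by exact_mod_cast hN)
    have h4 : 0 < ((2 : ℝ) ^ n) ^ (N : ℝ) := by positivity
    rw [h2] at *
    nlinarith

theorem tail_mass_lower_bound {N : ℕ} (hN : 1 ≤ N) {s p : ℝ} (hs : 0 < s) (hs1 : s < 1)
    (hp : 1 ≤ p) : (p * 2 ^ p * s)⁻¹ ≤ N * (2 ^ (-(s * p)) / (s * p)) := by
  have hN1 : (1 : ℝ) ≤ N := by exact_mod_cast hN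
  have : (2 ^ p : ℝ)⁻¹ ≤ 2 ^ (-(s * p)) := by
    rw [← Real.rpow_neg (by norm_num)]
    exact Real.rpow_le_rpow_of_exponent_le (by norm_num) (by nlinarith)
  calc (p * 2 ^ p * s)⁻¹ = 1 * ((2 ^ p : ℝ)⁻¹ / (s * p)) := by field_simp
    _ ≤ _ := by gcongr

/-- The total mass of the dyadic weights together with the exterior mass. -/
theorem mass_lower_bound {N : ℕ} (hN : 1 ≤ N) {s p : ℝ} (hs : 0 < s) (hs1 : s < 1) (hp : 1 ≤ p)
    (n : ℕ) :
    (p * 2 ^ p * s)⁻¹ * ((2 : ℝ) ^ n) ^ (s * p) ≤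
      N * (2 ^ (-(s * p)) / (s * p)) + ∑ k ∈ Finset.range (n + 1), ((2 : ℝ) ^ k) ^ (s * p) := by
  set x : ℝ := 2 ^ (s * p) with hx
  have hx1 : 1 < x := Real.one_lt_rpow (by norm_num) (by positivity)
  have hpow : ∀ k : ℕ, ((2 : ℝ) ^ k) ^ (s * p) = x ^ k := by
    intro k
    rw [hx, ← Real.rpow_natCast_mul (by norm_num), ← Real.rpow_mul_natCast (by norm_num), mul_comm]
  simp_rw [hpow]
  rw [geom_sum_eq hx1.ne']
  -- Bernoulli's inequality for the exponent `s ≤ 1`. The geometric sum is thus at least `(x ^ (n +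
  -- 1) - 1) / (s * 2 ^ p)`, and the exterior mass, also of order `1 / s`, absorbs the `-1`.
  have hxs : x - 1 ≤ s * 2 ^ p := by
    have := rpow_one_add_le_one_add_mul_self (s := (2 : ℝ) ^ p - 1) (p := s)
      (by have : (0 : ℝ) < 2 ^ p := by positivity
          linarith) hs.le hs1.le
    rw [add_sub_cancel, ← Real.rpow_mul (by norm_num), mul_comm p s] at this
    nlinarith
  have hP : (0 : ℝ) < 2 ^ p := by positivity
  have h1 := tail_mass_lower_bound hN hs hs1 hp
  have hxn : 1 ≤ x ^ (n + 1) := one_le_pow₀ hx1.le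
  have h2 : (x ^ (n + 1) - 1) * (s * 2 ^ p)⁻¹ ≤ (x ^ (n + 1) - 1) / (x - 1) := by
    rw [div_eq_mul_inv]
    exact mul_le_mul_of_nonneg_left (inv_anti₀ (by linarith) hxs) (by linarith)
  have h3 : (s * p * 2 ^ p)⁻¹ ≤ (s * 2 ^ p)⁻¹ := by
    refine inv_anti₀ (by positivity) ?_
    nlinarith [mul_pos hs hP]
  have h4 : (p * 2 ^ p * s)⁻¹ = (s * p * 2 ^ p)⁻¹ := by congr 1; ring
  rw [h4] at h1 ⊢
  have h5 : x ^ n ≤ x ^ (n + 1) := pow_le_pow_right₀ hx1.le (by omega)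
  have h6 : 0 < (s * p * 2 ^ p)⁻¹ := by positivity
  nlinarith

/-- All scales up to `n` are summed with weights `2 ^ (k s p)` instead of using one scale. The near
parts add up to the full kernel and so cost only a constant, while the average parts form a
geometric sum dominated by `2 ^ (n N)`. -/
theorem sum_dyadic_mul_enorm_rpow_le {N : ℕ} (hN : 1 ≤ N) {s p : ℝ} (hs : 0 < s) (hp : 1 ≤ p)
    (hsp : s * p < N) {u : Euc N → ℝ} (hu : Measurable u) (c : ℝ) (n : ℕ) {x : Euc N}
    (hx : x ∈ Metric.ball (0 : Euc N) 1) :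
    volume (Metric.ball (0 : Euc N) 1) *
        ENNReal.ofReal (∑ k ∈ Finset.range (n + 1), ((2 : ℝ) ^ k) ^ (s * p)) * ‖u x - c‖ₑ ^ p ≤
      2 ^ (p - 1) *
      (ENNReal.ofReal (2 * 2 ^ ((N : ℝ) + s * p)) *
        (∫⁻ y, diffPow p u x y * rieszKernel (N + s * p) (x - y)) +
      volume (Metric.ball (0 : Euc N) 1) ^ (s * p / N) *
        (ENNReal.ofReal (2 * ((2 : ℝ) ^ n) ^ (N : ℝ)) *
        (∫⁻ y in Metric.ball (0 : Euc N) 1, (‖u y - c‖ₑ ^ p) ^ ((N : ℝ) / (N - s * p))) ^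
          (((N : ℝ) - s * p) / N))) := by
  set B := Metric.ball (0 : Euc N) 1 with hB
  set m := volume B with hm
  set e : ℝ := (N : ℝ) + s * p with he
  set κ := (∫⁻ y in B, (‖u y - c‖ₑ ^ p) ^ ((N : ℝ) / (N - s * p))) ^
          (((N : ℝ) - s * p) / N) with hκ
  have he1 : 1 ≤ e := by
    have : (1 : ℝ) ≤ N := by exact_mod_cast hN
    rw [he]; nlinarith [mul_pos hs (by linarith : 0 < p)]
  have hterm : ∀ k : ℕ, ENNReal.ofReal (((2 : ℝ) ^ k) ^ (s * p)) * (m * ‖u x - c‖ₑ ^ p) ≤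
      2 ^ (p - 1) * ((∫⁻ y in B, ENNReal.ofReal (((2 : ℝ) ^ k) ^ e) * nearDiff p u k x y) +
        m ^ (s * p / N) * (ENNReal.ofReal (((2 : ℝ) ^ k) ^ (N : ℝ)) * κ)) := by
    intro k
    have h1 := volume_mul_enorm_rpow_le hp (by positivity : 0 ≤ s * p) hsp hu c k hx
    refine (mul_le_mul_right h1 _).trans (le_of_eq ?_)
    rw [lintegral_const_mul' _ _ ENNReal.ofReal_ne_top]
    have ha : ENNReal.ofReal (((2 : ℝ) ^ k) ^ e) = ENNReal.ofReal (((2 : ℝ) ^ k) ^ (s * p)) *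
        ENNReal.ofReal (((2 : ℝ) ^ k) ^ (N : ℝ)) := by
      rw [← ENNReal.ofReal_mul (by positivity), ← Real.rpow_add (by positivity), he, add_comm]
    have hb : ENNReal.ofReal (((2 : ℝ) ^ k) ^ (N : ℝ)) = ENNReal.ofReal (((2 : ℝ) ^ k) ^ (s * p)) *
        ENNReal.ofReal (((2 : ℝ) ^ k) ^ ((N : ℝ) - s * p)) := by
      rw [← ENNReal.ofReal_mul (by positivity), ← Real.rpow_add (by positivity)]
      congr 2; ring
    rw [ha]
    conv_rhs => enter [2, 2, 2, 1]; rw [hb]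
    ring
  calc _ = ∑ k ∈ Finset.range (n + 1),
        ENNReal.ofReal (((2 : ℝ) ^ k) ^ (s * p)) * (m * ‖u x - c‖ₑ ^ p) := by
        rw [ENNReal.ofReal_sum_of_nonneg (fun _ _ => by positivity), ← Finset.sum_mul]
        ring
    _ ≤ ∑ k ∈ Finset.range (n + 1),
        2 ^ (p - 1) * ((∫⁻ y in B, ENNReal.ofReal (((2 : ℝ) ^ k) ^ e) * nearDiff p u k x y) +
        m ^ (s * p / N) * (ENNReal.ofReal (((2 : ℝ) ^ k) ^ (N : ℝ)) * κ)) :=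
        Finset.sum_le_sum fun k _ => hterm k
    _ = 2 ^ (p - 1) * ((∫⁻ y in B, ∑ k ∈ Finset.range (n + 1),
          ENNReal.ofReal (((2 : ℝ) ^ k) ^ e) * nearDiff p u k x y) +
        m ^ (s * p / N) * (ENNReal.ofReal (∑ k ∈ Finset.range (n + 1), ((2 : ℝ) ^ k) ^ (N : ℝ)) *
          κ)) := by
        rw [← Finset.mul_sum, Finset.sum_add_distrib, ← Finset.mul_sum, ← Finset.sum_mul,
          ENNReal.ofReal_sum_of_nonneg (fun _ _ => by positivity), lintegral_finsetSum]
        intro k _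
        fun_prop
    _ ≤ _ := by
        gcongr
        · rw [← lintegral_const_mul' _ _ ENNReal.ofReal_ne_top]
          refine (lintegral_mono fun y => ?_).trans (setLIntegral_le_lintegral _ _)
          exact (ENNReal.sum_le_tsum _).trans (tsum_nearDiff_le (by linarith) he1 u x y)
        · exact sum_range_two_pow_rpow_le hN n

/-- The fractional Poincaré-Sobolev inequality on the unit ball at the critical exponent, with
the energy over `ball × univ` and a constant proportional to a power of `s`. -/
theorem sobolev_ball_univ {N : ℕ} (hN : 1 ≤ N) {p : ℝ} (hp : 1 ≤ p) :
    ∃ A : ℝ≥0∞, A ≠ ⊤ ∧ ∀ s : ℝ, 0 < s → s < 1 → s * p < N → ∀ u : Euc N → ℝ, Continuous u →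
      (∫⁻ x in Metric.ball (0 : Euc N) 1,
        (‖u x - ⨍ y in Metric.ball (0 : Euc N) 1, u y‖ₑ ^ p) ^ ((N : ℝ) / (N - s * p))) ^
          (((N : ℝ) - s * p) / N) ≤
        (A * ENNReal.ofReal s) ^ ((N : ℝ) / (N - s * p)) *
          iterEnergy s p (Metric.ball 0 1) Set.univ u := by
  set B := Metric.ball (0 : Euc N) 1 with hB
  set m := volume B with hm
  have hm0 : m ≠ 0 := (Metric.measure_ball_pos _ _ one_pos).ne'
  have hmt : m ≠ ⊤ := measure_ball_lt_top.ne
  have h2p : (2 : ℝ≥0∞) ^ (p - 1) ≠ ⊤ := ENNReal.rpow_ne_top_of_nonneg (by linarith) (by simp)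
  set K : ℝ≥0∞ := 2 ^ (p - 1) * (ENNReal.ofReal (3 * 2 ^ ((N : ℝ) + p)) + 2 * (1 + m)) with hK
  have hKt : K ≠ ⊤ := by
    refine ENNReal.mul_ne_top h2p (ENNReal.add_ne_top.2 ⟨ENNReal.ofReal_ne_top, ?_⟩)
    exact ENNReal.mul_ne_top (by simp) (by simp [hmt])
  refine ⟨2 * ENNReal.ofReal (2 ^ (1 + p)) * (m⁻¹ * ENNReal.ofReal (p * 2 ^ p) * K), ?_,
    fun s hs hs1 hsp u hu => ?_⟩
  · exact ENNReal.mul_ne_top (ENNReal.mul_ne_top (by simp) ENNReal.ofReal_ne_top)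
      (ENNReal.mul_ne_top (ENNReal.mul_ne_top (ENNReal.inv_ne_top.2 hm0) ENNReal.ofReal_ne_top)
        hKt)
  have hN0 : (0 : ℝ) < N := by exact_mod_cast hN
  have hp0 : 0 < p := by linarith
  have hβ : 0 < s * p := by positivity
  have hNβ : 0 < (N : ℝ) - s * p := by linarith
  have hum : Measurable u := hu.measurable
  set c := ⨍ y in B, u y with hc
  set F : Euc N → ℝ≥0∞ := fun x => ‖u x - c‖ₑ ^ p with hF
  set E := iterEnergy s p B Set.univ u with hE
  set W' : Euc N → ℝ≥0∞ := fun x => ∫⁻ y, diffPow p u x y * rieszKernel (N + s * p) (x - y)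
    with hW'
  have hWm : Measurable W' := Measurable.lintegral_prod_right'
    (f := fun z : Euc N × Euc N => diffPow p u z.1 z.2 * rieszKernel (N + s * p) (z.1 - z.2))
    (by fun_prop)
  -- The exterior estimate bounds `F` by the energy density at `x` plus the mean energy; integrating
  -- `W` over the ball gives `2 * E`.
  set W : Euc N → ℝ≥0∞ := fun x => W' x + m⁻¹ * E with hW
  set κ := (∫⁻ x in B, F x ^ ((N : ℝ) / (N - s * p))) ^ (((N : ℝ) - s * p) / N) with hκ
  -- The reciprocal of the mass lower bound; it carries the factor `s`.
  set θ : ℝ≥0∞ := m⁻¹ * ENNReal.ofReal (p * 2 ^ p * s) * K with hθ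
  have hintW : ∫⁻ x in B, W x = 2 * E := by
    rw [hW, lintegral_add_right _ measurable_const, setLIntegral_const, mul_right_comm,
      ENNReal.inv_mul_cancel hm0 hmt, one_mul, two_mul]
    congr 1
    rw [hE, iterEnergy]
    simp [hW']
  have hcancel : ENNReal.ofReal (p * 2 ^ p * s) * ENNReal.ofReal (p * 2 ^ p * s)⁻¹ = 1 := by
    rw [← ENNReal.ofReal_mul (by positivity), mul_inv_cancel₀ (by positivity), ENNReal.ofReal_one]
  have he : ENNReal.ofReal (2 ^ ((N : ℝ) + s * p)) ≤ ENNReal.ofReal (2 ^ ((N : ℝ) + p)) := by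
    refine ENNReal.ofReal_le_ofReal (Real.rpow_le_rpow_of_exponent_le (by norm_num) ?_)
    nlinarith
  have htail : ∀ x ∈ B, m * ENNReal.ofReal (N * (2 ^ (-(s * p)) / (s * p))) * F x ≤
      2 ^ (p - 1) * ENNReal.ofReal (2 ^ ((N : ℝ) + p)) * W x := by
    intro x hx
    have h := tail_mul_enorm_rpow_le hN hs hp hu hx
    have hmass : ENNReal.ofReal (N * volume.real B * (2 ^ (-(s * p)) / (s * p))) =
        m * ENNReal.ofReal (N * (2 ^ (-(s * p)) / (s * p))) := by
      rw [hm, ← ofReal_measureReal (μ := volume) (s := B), ← ENNReal.ofReal_mul (by positivity)]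
      congr 1; ring
    rw [hmass] at h
    refine h.trans ?_
    exact mul_le_mul_left (mul_le_mul_right he _) _
  have hmpow : m ^ (s * p / N) ≤ 1 + m :=
    rpow_le_one_add (by positivity) (by rw [div_le_one hN0]; exact hsp.le)
  have hκt : κ ≠ ⊤ := ENNReal.rpow_ne_top_of_nonneg (by positivity)
      (lintegral_ball_enorm_sub_rpow_ne_top hu hp0.le (by positivity) c)
  have h0 : ∀ x ∈ B, F x ≤ θ * W x := by
    intro x hx
    calc F x = (m⁻¹ * m) *
          (ENNReal.ofReal (p * 2 ^ p * s) * ENNReal.ofReal (p * 2 ^ p * s)⁻¹) * F x := by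
          rw [hcancel, ENNReal.inv_mul_cancel hm0 hmt]; simp
      _ = m⁻¹ * ENNReal.ofReal (p * 2 ^ p * s) *
          (m * ENNReal.ofReal (p * 2 ^ p * s)⁻¹ * F x) := by ring
      _ ≤ m⁻¹ * ENNReal.ofReal (p * 2 ^ p * s) *
          (2 ^ (p - 1) * ENNReal.ofReal (2 ^ ((N : ℝ) + p)) * W x) := by
          refine mul_le_mul_right (le_trans ?_ (htail x hx)) _
          gcongr
          exact tail_mass_lower_bound hN hs hs1 hp
      _ ≤ m⁻¹ * ENNReal.ofReal (p * 2 ^ p * s) * (K * W x) := by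
          refine mul_le_mul_right (mul_le_mul_left (mul_le_mul_right ?_ _) _) _
          refine le_trans (ENNReal.ofReal_le_ofReal ?_) le_self_add
          have : (0 : ℝ) < 2 ^ ((N : ℝ) + p) := by positivity
          linarith
      _ = _ := by rw [hθ]; ring
  have hn : ∀ x ∈ B, ∀ n : ℕ, F x ≤ θ * (ENNReal.ofReal (((2 : ℝ) ^ n) ^ (-(s * p))) * W x +
      ENNReal.ofReal (((2 : ℝ) ^ n) ^ ((N : ℝ) - s * p)) * κ) := by
    intro x hx n
    have hsum := sum_dyadic_mul_enorm_rpow_le hN hs hp hsp hum c n hx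
    set Y : ℝ := 2 ^ n with hY
    have hY0 : 0 < Y := by positivity
    have hYY : ENNReal.ofReal (Y ^ (-(s * p))) * ENNReal.ofReal (Y ^ (s * p)) = 1 := by
      rw [← ENNReal.ofReal_mul (by positivity), ← Real.rpow_add hY0]; simp
    have hYN : ENNReal.ofReal (Y ^ ((N : ℝ) - s * p)) =
        ENNReal.ofReal (Y ^ (-(s * p))) * ENNReal.ofReal (Y ^ (N : ℝ)) := by
      rw [← ENNReal.ofReal_mul (by positivity), ← Real.rpow_add hY0]
      congr 2; ring
    have hmass : m * (ENNReal.ofReal (p * 2 ^ p * s)⁻¹ * ENNReal.ofReal (Y ^ (s * p))) * F x ≤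
        K * (W x + ENNReal.ofReal (Y ^ (N : ℝ)) * κ) := by
      calc _ ≤ m * (ENNReal.ofReal (N * (2 ^ (-(s * p)) / (s * p))) +
            ENNReal.ofReal (∑ k ∈ Finset.range (n + 1), ((2 : ℝ) ^ k) ^ (s * p))) * F x := by
            rw [← ENNReal.ofReal_mul (by positivity),
              ← ENNReal.ofReal_add (by positivity) (by positivity)]
            gcongr
            exact mass_lower_bound hN hs hs1 hp n
        _ = m * ENNReal.ofReal (N * (2 ^ (-(s * p)) / (s * p))) * F x +
            m * ENNReal.ofReal (∑ k ∈ Finset.range (n + 1), ((2 : ℝ) ^ k) ^ (s * p)) * F x := by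
            ring
        _ ≤ 2 ^ (p - 1) * ENNReal.ofReal (2 ^ ((N : ℝ) + p)) * W x +
            2 ^ (p - 1) * (ENNReal.ofReal (2 * 2 ^ ((N : ℝ) + p)) * W x +
              (1 + m) * (ENNReal.ofReal (2 * Y ^ (N : ℝ)) * κ)) := by
            refine add_le_add (htail x hx) (hsum.trans ?_)
            refine mul_le_mul_right (add_le_add (mul_le_mul' ?_ le_self_add)
              (mul_le_mul_left hmpow _)) _
            rw [ENNReal.ofReal_mul two_pos.le, ENNReal.ofReal_mul two_pos.le]
            exact mul_le_mul_right he _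
        _ = 2 ^ (p - 1) * (ENNReal.ofReal (3 * 2 ^ ((N : ℝ) + p)) * W x +
              (2 * (1 + m)) * (ENNReal.ofReal (Y ^ (N : ℝ)) * κ)) := by
            rw [ENNReal.ofReal_mul two_pos.le, ENNReal.ofReal_mul two_pos.le,
              ENNReal.ofReal_mul (by norm_num : (0 : ℝ) ≤ 3), ENNReal.ofReal_ofNat,
              ENNReal.ofReal_ofNat]
            ring
        _ ≤ 2 ^ (p - 1) * ((ENNReal.ofReal (3 * 2 ^ ((N : ℝ) + p)) + 2 * (1 + m)) * W x +
              (ENNReal.ofReal (3 * 2 ^ ((N : ℝ) + p)) + 2 * (1 + m)) *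
                (ENNReal.ofReal (Y ^ (N : ℝ)) * κ)) := by
            refine mul_le_mul_right (add_le_add (mul_le_mul_left le_self_add _)
              (mul_le_mul_left le_add_self _)) _
        _ = _ := by rw [hK]; ring
    calc F x = (m⁻¹ * m) *
          (ENNReal.ofReal (p * 2 ^ p * s) * ENNReal.ofReal (p * 2 ^ p * s)⁻¹) *
          (ENNReal.ofReal (Y ^ (-(s * p))) * ENNReal.ofReal (Y ^ (s * p))) * F x := by
          rw [hcancel, hYY, ENNReal.inv_mul_cancel hm0 hmt]; simp
      _ = m⁻¹ * ENNReal.ofReal (p * 2 ^ p * s) * ENNReal.ofReal (Y ^ (-(s * p))) *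
          (m * (ENNReal.ofReal (p * 2 ^ p * s)⁻¹ * ENNReal.ofReal (Y ^ (s * p))) * F x) := by ring
      _ ≤ m⁻¹ * ENNReal.ofReal (p * 2 ^ p * s) * ENNReal.ofReal (Y ^ (-(s * p))) *
          (K * (W x + ENNReal.ofReal (Y ^ (N : ℝ)) * κ)) := mul_le_mul_right hmass _
      _ = _ := by rw [hYN, hθ]; ring
  have hfin := hedberg (μ := volume.restrict B) (F := F) (W := W) hN hβ hsp hκ hκt
    (ae_restrict_of_forall_mem measurableSet_ball h0)
    (ae_restrict_of_forall_mem measurableSet_ball hn) (hWm.add_const _).aemeasurable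
  refine hfin.trans ?_
  rw [hintW, ← mul_assoc]
  refine mul_le_mul_left ?_ _
  -- Since this exponent is at least 1, the factor 2 from the integral of `W` can be moved inside
  -- the power.
  have hexp : 1 ≤ (N : ℝ) / (N - s * p) := by rw [one_le_div hNβ]; linarith
  have h2 : (2 : ℝ≥0∞) ≤ 2 ^ ((N : ℝ) / (N - s * p)) := by
    simpa using ENNReal.rpow_le_rpow_of_exponent_le (x := 2) (by norm_num) hexp
  calc _ ≤ (ENNReal.ofReal (2 ^ (1 + s * p)) * θ) ^ ((N : ℝ) / (N - s * p)) *
        2 ^ ((N : ℝ) / (N - s * p)) := mul_le_mul_right h2 _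
    _ = (ENNReal.ofReal (2 ^ (1 + s * p)) * θ * 2) ^ ((N : ℝ) / (N - s * p)) :=
        (ENNReal.mul_rpow_of_nonneg _ _ (by positivity)).symm
    _ ≤ (ENNReal.ofReal (2 ^ (1 + p)) * θ * 2) ^ ((N : ℝ) / (N - s * p)) := by
        gcongr
        · norm_num
        · nlinarith
    _ = _ := by
        rw [hθ, ENNReal.ofReal_mul (show 0 ≤ p * 2 ^ p by positivity)]
        congr 1
        ring

/-! ### Morrey's inequality by telescoping averages. -/

/-- The average of `u` over the unit ball contracted by `2 ^ (-k)` towards `x`. -/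
def contractAverage {N : ℕ} (u : Euc N → ℝ) (x : Euc N) (k : ℕ) : ℝ :=
  ⨍ z in Metric.ball (0 : Euc N) 1, u (x + ((2 : ℝ) ^ k)⁻¹ • (z - x))

theorem tendsto_contractAverage {N : ℕ} {u : Euc N → ℝ} (hu : Continuous u) {x : Euc N}
    (hx : x ∈ Metric.ball (0 : Euc N) 1) :
    Tendsto (contractAverage u x) atTop (𝓝 (u x)) := by
  have hm0 : volume (Metric.ball (0 : Euc N) 1) ≠ 0 := (Metric.measure_ball_pos _ _ one_pos).ne'
  have hmt : volume (Metric.ball (0 : Euc N) 1) ≠ ⊤ := measure_ball_lt_top.ne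
  rw [Metric.tendsto_atTop]
  intro ε hε
  obtain ⟨δ, hδ, hδu⟩ := Metric.continuousAt_iff.1 hu.continuousAt (ε / 2) (half_pos hε)
  obtain ⟨n₀, hn₀⟩ := exists_pow_lt_of_lt_one (show 0 < δ / 2 by positivity)
    (show (2 : ℝ)⁻¹ < 1 by norm_num)
  refine ⟨n₀, fun n hn => ?_⟩
  have hsmall : ∀ z ∈ Metric.ball (0 : Euc N) 1,
      ‖u x - u (x + ((2 : ℝ) ^ n)⁻¹ • (z - x))‖ₑ ≤ ENNReal.ofReal (ε / 2) := by
    intro z hz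
    rw [← ofReal_norm]
    refine ENNReal.ofReal_le_ofReal ?_
    have hd : dist (x + ((2 : ℝ) ^ n)⁻¹ • (z - x)) x < δ := by
      rw [dist_eq_norm, add_sub_cancel_left, norm_smul, Real.norm_of_nonneg (by positivity)]
      have h1 : ((2 : ℝ) ^ n)⁻¹ < δ / 2 := by
        rw [← inv_pow]
        exact (pow_le_pow_of_le_one (by norm_num) (by norm_num) hn).trans_lt hn₀
      have h2 : ‖z - x‖ < 2 := by
        have hz' := mem_ball_zero_iff.1 hz
        have hx' := mem_ball_zero_iff.1 hx
        exact (norm_sub_le z x).trans_lt (by linarith)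
      have h3 : (0 : ℝ) < ((2 : ℝ) ^ n)⁻¹ := by positivity
      nlinarith [norm_nonneg (z - x)]
    have := (hδu hd).le
    rwa [dist_comm, dist_eq_norm] at this
  have h := enorm_sub_average_rpow_le le_rfl
    (u := fun z => u (x + ((2 : ℝ) ^ n)⁻¹ • (z - x))) (by fun_prop) one_pos (u x)
  simp only [ENNReal.rpow_one] at h
  have h2 : ‖u x - contractAverage u x n‖ₑ ≤ ENNReal.ofReal (ε / 2) := by
    refine h.trans ((mul_le_mul_right (setLIntegral_mono' measurableSet_ball hsmall) _).trans ?_)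
    rw [setLIntegral_const, mul_left_comm, ENNReal.inv_mul_cancel hm0 hmt, mul_one]
  rw [← ofReal_norm, ENNReal.ofReal_le_ofReal_iff (by positivity)] at h2
  rw [dist_comm, dist_eq_norm]
  linarith

/-- Jensen is applied twice, to averages at scales `k` and `k + 1`. With `Y = 2 ^ k` the Jacobians
give `Y ^ (2 N)`, and the points compared are within `4 / Y`, so the kernel contributes `Y ^ (-(N +
s p))`: altogether `Y ^ (N - s p)`. -/
theorem contractAverage_sub_succ_le {N : ℕ} {s p : ℝ} (hs : 0 < s) (hp : 1 ≤ p) {u : Euc N → ℝ}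
    (hu : Continuous u) {x : Euc N} (hx : x ∈ Metric.ball (0 : Euc N) 1) (k : ℕ) :
    ‖contractAverage u x k - contractAverage u x (k + 1)‖ₑ ^ p ≤
      ENNReal.ofReal (((2 : ℝ) ^ k) ^ ((N : ℝ) - s * p)) *
        ((volume (Metric.ball (0 : Euc N) 1))⁻¹ * (volume (Metric.ball (0 : Euc N) 1))⁻¹ *
          ENNReal.ofReal (2 ^ (N : ℝ) * 4 ^ ((N : ℝ) + s * p)) *
          iterEnergy s p (Metric.ball 0 1) (Metric.ball 0 1) u) := by
  set B := Metric.ball (0 : Euc N) 1 with hB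
  set m := volume B with hm
  set e : ℝ := (N : ℝ) + s * p with he
  have hum : Measurable u := hu.measurable
  have hm0 : m ≠ 0 := (Metric.measure_ball_pos _ _ one_pos).ne'
  have hmi : m⁻¹ ≠ ⊤ := ENNReal.inv_ne_top.2 hm0
  have he0 : 0 ≤ e := by have : 0 < s * p := by positivity
                         positivity
  set Y : ℝ := 2 ^ k with hY
  have hY0 : 0 < Y := by positivity
  set G : Euc N → ℝ≥0∞ := fun y' => ∫⁻ y in B, if Y * ‖x - y‖ < 2 then diffPow p u y y' else 0
    with hG
  have hGm : Measurable G := by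
    refine Measurable.lintegral_prod_right' (f := fun w : Euc N × Euc N =>
      if Y * ‖x - w.2‖ < 2 then diffPow p u w.2 w.1 else 0) ?_
    exact Measurable.ite (measurableSet_lt (by fun_prop) measurable_const) (by fun_prop)
      measurable_const
  have h1 : ‖contractAverage u x k - contractAverage u x (k + 1)‖ₑ ^ p ≤
      m⁻¹ * ∫⁻ w in B, m⁻¹ * ∫⁻ z in B, diffPow p u (x + Y⁻¹ • (z - x))
        (x + ((2 : ℝ) ^ (k + 1))⁻¹ • (w - x)) := by
    refine (enorm_sub_average_rpow_le hp
      (u := fun z => u (x + ((2 : ℝ) ^ (k + 1))⁻¹ • (z - x))) (by fun_prop) one_pos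
      (contractAverage u x k)).trans ?_
    refine mul_le_mul_right (lintegral_mono fun w => ?_) _
    rw [← enorm_neg, neg_sub]
    refine (enorm_sub_average_rpow_le hp
      (u := fun z => u (x + Y⁻¹ • (z - x))) (by fun_prop) one_pos _).trans (le_of_eq ?_)
    congr 1
    refine lintegral_congr fun z => ?_
    rw [diffPow_comm]; rfl
  have h2 : ∀ y', ∫⁻ z in B, diffPow p u (x + Y⁻¹ • (z - x)) y' ≤
      ENNReal.ofReal (Y ^ (N : ℝ)) * G y' := fun y' =>
    lintegral_ball_contract_le (k := k) hx (f := fun y => diffPow p u y y') (by fun_prop)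
  have h3 : ∫⁻ w in B, G (x + ((2 : ℝ) ^ (k + 1))⁻¹ • (w - x)) ≤
      ENNReal.ofReal (((2 : ℝ) ^ (k + 1)) ^ (N : ℝ)) *
        (ENNReal.ofReal ((4 / Y) ^ e) * iterEnergy s p B B u) := by
    refine (lintegral_ball_contract_le (k := k + 1) hx hGm).trans (mul_le_mul_right ?_ _)
    unfold iterEnergy
    rw [← lintegral_const_mul' _ _ ENNReal.ofReal_ne_top]
    refine lintegral_mono fun y' => ?_
    split_ifs with hy'
    · rw [hG, ← lintegral_const_mul' _ _ ENNReal.ofReal_ne_top]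
      refine lintegral_mono fun y => ?_
      dsimp only
      split_ifs with hy
      · rw [diffPow_comm, rieszKernel_sub_comm]
        rw [rieszKernel_sub_comm]
        refine diffPow_le_mul_rieszKernel (by linarith) he0 u ?_
        rw [pow_succ] at hy'
        rw [le_div_iff₀ hY0, mul_comm]
        have htri : ‖y' - y‖ ≤ ‖x - y'‖ + ‖x - y‖ := by
          rw [← norm_neg (x - y'), neg_sub]
          calc _ = ‖(y' - x) + (x - y)‖ := by congr 1; abel
            _ ≤ _ := norm_add_le _ _
        have hy'' : Y * ‖x - y'‖ < 2 := by nlinarith [norm_nonneg (x - y'), mul_nonneg hY0.le (norm_nonneg (x - y'))]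
        nlinarith
      · exact zero_le
    · exact zero_le
  calc _ ≤ m⁻¹ * ∫⁻ w in B, m⁻¹ * (ENNReal.ofReal (Y ^ (N : ℝ)) *
        G (x + ((2 : ℝ) ^ (k + 1))⁻¹ • (w - x))) := by
        refine h1.trans (mul_le_mul_right (lintegral_mono fun w => mul_le_mul_right (h2 _) _) _)
    _ = m⁻¹ * (m⁻¹ * (ENNReal.ofReal (Y ^ (N : ℝ)) *
        ∫⁻ w in B, G (x + ((2 : ℝ) ^ (k + 1))⁻¹ • (w - x)))) := by
        rw [lintegral_const_mul' _ _ hmi, lintegral_const_mul' _ _ ENNReal.ofReal_ne_top]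
    _ ≤ m⁻¹ * (m⁻¹ * (ENNReal.ofReal (Y ^ (N : ℝ)) *
        (ENNReal.ofReal (((2 : ℝ) ^ (k + 1)) ^ (N : ℝ)) *
        (ENNReal.ofReal ((4 / Y) ^ e) * iterEnergy s p B B u)))) := by gcongr
    _ = m⁻¹ * m⁻¹ * (ENNReal.ofReal (Y ^ (N : ℝ)) * ENNReal.ofReal (((2 : ℝ) ^ (k + 1)) ^ (N : ℝ)) *
        ENNReal.ofReal ((4 / Y) ^ e)) * iterEnergy s p B B u := by ring
    _ = m⁻¹ * m⁻¹ * (ENNReal.ofReal (Y ^ ((N : ℝ) - s * p)) *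
          ENNReal.ofReal (2 ^ (N : ℝ) * 4 ^ e)) * iterEnergy s p B B u := by
        rw [← ENNReal.ofReal_mul (by positivity), ← ENNReal.ofReal_mul (by positivity),
          ← ENNReal.ofReal_mul (by positivity)]
        congr 3
        have : Y ^ ((N : ℝ) - s * p) = Y ^ (N : ℝ) * Y ^ (N : ℝ) * (Y ^ e)⁻¹ := by
          rw [← Real.rpow_neg hY0.le, ← Real.rpow_add hY0, ← Real.rpow_add hY0]
          congr 1; rw [he]; ring
        rw [this, pow_succ, Real.mul_rpow hY0.le two_pos.le, Real.div_rpow (by norm_num) hY0.le]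
        ring
    _ = _ := by ring

/-- Morrey's inequality for the fractional energy on the unit ball. -/
theorem morrey_ball {N : ℕ} {s p : ℝ} (hs : 0 < s) (hp : 1 ≤ p) (hsp : (N : ℝ) < s * p) :
    ∃ C : ℝ≥0∞, C ≠ ⊤ ∧ ∀ u : Euc N → ℝ, Continuous u → ∀ x ∈ Metric.ball (0 : Euc N) 1,
      ‖u x - ⨍ y in Metric.ball (0 : Euc N) 1, u y‖ₑ ^ p ≤
        C * iterEnergy s p (Metric.ball 0 1) (Metric.ball 0 1) u := by
  set B := Metric.ball (0 : Euc N) 1 with hB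
  set m := volume B with hm
  have hm0 : m ≠ 0 := (Metric.measure_ball_pos _ _ one_pos).ne'
  have hp0 : 0 < p := by linarith
  set A : ℝ≥0∞ := m⁻¹ * m⁻¹ * ENNReal.ofReal (2 ^ (N : ℝ) * 4 ^ ((N : ℝ) + s * p)) with hA
  have hAt : A ≠ ⊤ := ENNReal.mul_ne_top (ENNReal.mul_ne_top (ENNReal.inv_ne_top.2 hm0)
    (ENNReal.inv_ne_top.2 hm0)) ENNReal.ofReal_ne_top
  -- The ratio of successive increments is below 1 exactly because `s p > N`; the telescoping series
  -- is geometric.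
  set ρ : ℝ≥0∞ := ENNReal.ofReal (2 ^ (((N : ℝ) - s * p) / p)) with hρ
  have hρ1 : ρ < 1 := by
    rw [hρ, ← ENNReal.ofReal_one]
    refine (ENNReal.ofReal_lt_ofReal_iff one_pos).2 ?_
    exact Real.rpow_lt_one_of_one_lt_of_neg (by norm_num) (div_neg_of_neg_of_pos (by linarith) hp0)
  refine ⟨A * ((1 - ρ)⁻¹) ^ p, ENNReal.mul_ne_top hAt (ENNReal.rpow_ne_top_of_nonneg hp0.le
    (ENNReal.inv_ne_top.2 (tsub_pos_of_lt hρ1).ne')), fun u hu x hx => ?_⟩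
  set E := iterEnergy s p B B u with hE
  have hstep : ∀ k : ℕ, ‖contractAverage u x k - contractAverage u x (k + 1)‖ₑ ≤
      (A * E) ^ (1 / p) * ρ ^ k := by
    intro k
    have h := ENNReal.rpow_le_rpow (contractAverage_sub_succ_le hs hp hu hx k)
      (show 0 ≤ 1 / p by positivity)
    rw [← ENNReal.rpow_mul, mul_one_div_cancel hp0.ne', ENNReal.rpow_one,
      ENNReal.mul_rpow_of_nonneg _ _ (by positivity), mul_comm,
      ENNReal.ofReal_rpow_of_nonneg (by positivity) (by positivity)] at h
    refine h.trans (mul_le_mul_right (le_of_eq ?_) _)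
    rw [hρ, ← ENNReal.ofReal_pow (by positivity), ← Real.rpow_mul (by positivity),
      ← Real.rpow_natCast_mul (by norm_num), ← Real.rpow_mul_natCast (by norm_num)]
    congr 2; ring
  have hsum : ∀ n : ℕ, ‖contractAverage u x n - contractAverage u x 0‖ₑ ≤
      (A * E) ^ (1 / p) * (1 - ρ)⁻¹ := by
    intro n
    have h1 : ‖contractAverage u x n - contractAverage u x 0‖ₑ ≤
        ∑ k ∈ Finset.range n, (A * E) ^ (1 / p) * ρ ^ k := by
      rw [← Finset.sum_range_sub]
      refine (enorm_sum_le _ _).trans (Finset.sum_le_sum fun k _ => ?_)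
      rw [← enorm_neg, neg_sub]
      exact hstep k
    refine h1.trans ?_
    rw [← Finset.mul_sum, ← ENNReal.tsum_geometric]
    exact mul_le_mul_right (ENNReal.sum_le_tsum _) _
  have hlim : ‖u x - contractAverage u x 0‖ₑ ≤ (A * E) ^ (1 / p) * (1 - ρ)⁻¹ :=
    le_of_tendsto' ((continuous_enorm.tendsto _).comp
      ((tendsto_contractAverage hu hx).sub_const _)) hsum
  have h0 : contractAverage u x 0 = ⨍ y in B, u y := by simp [contractAverage, hB]
  rw [h0] at hlim
  refine (ENNReal.rpow_le_rpow hlim hp0.le).trans (le_of_eq ?_)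
  rw [ENNReal.mul_rpow_of_nonneg _ _ hp0.le, ← ENNReal.rpow_mul, one_div_mul_cancel hp0.ne',
    ENNReal.rpow_one]
  ring

/-! ### Poincaré-Sobolev inequalities with the gains `1 - s` and `s`. -/

/-- From the critical exponent to smaller exponents on the unit ball. -/
theorem eLpNorm_ball_rpow_le {N : ℕ} {σ p : ℝ} {q : ℝ≥0∞} (hσ : 0 ≤ σ) (hp : 1 ≤ p)
    (hσN : σ * p < N) (hpq : ENNReal.ofReal p ≤ q)
    (hq : q ≤ ENNReal.ofReal ((N : ℝ) * p / ((N : ℝ) - σ * p))) {f : Euc N → ℝ}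
    (hf : Continuous f) :
    eLpNorm f q (volume.restrict (Metric.ball (0 : Euc N) 1)) ^ p ≤
      (1 + volume (Metric.ball (0 : Euc N) 1)) ^ p *
      (∫⁻ x in Metric.ball (0 : Euc N) 1, (‖f x‖ₑ ^ p) ^ ((N : ℝ) / (N - σ * p))) ^
          (((N : ℝ) - σ * p) / N) := by
  have hp0 : 0 < p := by linarith
  have hNσ : 0 < (N : ℝ) - σ * p := by linarith
  have hN0 : (0 : ℝ) < N := by nlinarith [mul_nonneg hσ hp0.le]
  set r : ℝ := (N : ℝ) * p / ((N : ℝ) - σ * p) with hr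
  have hr0 : 0 < r := by positivity
  set m := volume (Metric.ball (0 : Euc N) 1) with hm
  have hqt : q ≠ ⊤ := ne_top_of_le_ne_top ENNReal.ofReal_ne_top hq
  have hqr : q.toReal ≤ r := by
    simpa [ENNReal.toReal_ofReal hr0.le] using ENNReal.toReal_mono ENNReal.ofReal_ne_top hq
  have hq1 : 1 ≤ q.toReal := by
    refine hp.trans ?_
    simpa [ENNReal.toReal_ofReal hp0.le] using ENNReal.toReal_mono hqt hpq
  have h1 := eLpNorm_le_eLpNorm_mul_rpow_measure_univ hq
    (μ := volume.restrict (Metric.ball (0 : Euc N) 1)) (f := f) hf.aestronglyMeasurable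
  rw [Measure.restrict_apply_univ, ENNReal.toReal_ofReal hr0.le] at h1
  have hmpow : m ^ (1 / q.toReal - 1 / r) ≤ 1 + m := by
    have ha : 0 ≤ 1 / q.toReal - 1 / r := sub_nonneg.2 (one_div_le_one_div_of_le (by linarith) hqr)
    have hb : 1 / q.toReal - 1 / r ≤ 1 := by
      have : 1 / q.toReal ≤ 1 := by rw [div_le_one (by linarith)]; exact hq1
      have : 0 < 1 / r := by positivity
      linarith
    exact rpow_le_one_add ha hb
  refine (ENNReal.rpow_le_rpow (h1.trans (mul_le_mul_right hmpow _)) hp0.le).trans ?_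
  rw [ENNReal.mul_rpow_of_nonneg _ _ hp0.le, mul_comm,
    eLpNorm_eq_lintegral_rpow_enorm_toReal (by simpa using hr0) ENNReal.ofReal_ne_top,
    ENNReal.toReal_ofReal hr0.le, ← ENNReal.rpow_mul]
  refine mul_le_mul_right (le_of_eq ?_) _
  congr 1
  · refine lintegral_congr fun x => ?_
    rw [← ENNReal.rpow_mul]
    congr 1
    rw [hr]; field_simp
  · rw [hr]; field_simp

/-- For `s p ≥ N` there is no critical exponent at order `s`, but `N p / (N - σ p)` tends to
infinity as `σ p` increases to `N`, so a finite `q` is below it for some `σ ≤ s`. -/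
theorem exists_lower_order {N : ℕ} (hN : 1 ≤ N) {s p : ℝ} (hs : 0 < s) (hp : 1 ≤ p)
    {q : ℝ≥0∞} (hq : IsSubcritical N p s q) (hqt : q ≠ ⊤) :
    ∃ σ, 0 < σ ∧ σ ≤ s ∧ σ * p < N ∧ q ≤ ENNReal.ofReal ((N : ℝ) * p / ((N : ℝ) - σ * p)) := by
  have hp0 : 0 < p := by linarith
  have hN0 : (0 : ℝ) < N := by exact_mod_cast hN
  rcases lt_or_ge (s * p) N with h | h
  · exact ⟨s, hs, le_rfl, h, hq.2.1 h⟩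
  have hq0 : 0 < q.toReal := by
    refine hp0.trans_le ?_
    simpa [ENNReal.toReal_ofReal hp0.le] using ENNReal.toReal_mono hqt hq.1
  -- `δ` stands for `N - σ p`. The bound `N / 2` keeps `σ` positive; the bound `N p / q` makes the
  -- critical exponent `N p / δ` at least `q`.
  set δ : ℝ := min ((N : ℝ) / 2) ((N : ℝ) * p / q.toReal) with hδ
  have hδ0 : 0 < δ := lt_min (by positivity) (by positivity)
  have hδ1 : δ ≤ (N : ℝ) / 2 := min_le_left _ _
  have hδ2 : δ ≤ (N : ℝ) * p / q.toReal := min_le_right _ _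
  refine ⟨((N : ℝ) - δ) / p, div_pos (by linarith) hp0, ?_, ?_, ?_⟩
  · rw [div_le_iff₀ hp0]; linarith
  · rw [div_mul_cancel₀ _ hp0.ne']; linarith
  · rw [div_mul_cancel₀ _ hp0.ne', sub_sub_cancel, ENNReal.le_ofReal_iff_toReal_le hqt (by positivity),
      le_div_iff₀ hδ0]
    rw [le_div_iff₀ hq0] at hδ2
    linarith

/-- Poincaré-Sobolev inequality on the unit ball, with the factor `1 - s`. -/
theorem exists_poincare_sobolev_one_sub {N : ℕ} (hN : 1 ≤ N) {s₀ p : ℝ} (hs₀ : 0 < s₀)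
    (hs₀1 : s₀ < 1) (hp : 1 ≤ p) {q : ℝ≥0∞} (hq : IsSubcritical N p s₀ q) :
    ∃ C : ℝ≥0∞, C ≠ ⊤ ∧ ∀ s : ℝ, s₀ ≤ s → s < 1 → ∀ u : Euc N → ℝ, Continuous u →
      eLpNorm (fun x => u x - ⨍ y in Metric.ball (0 : Euc N) 1, u y) q
        (volume.restrict (Metric.ball (0 : Euc N) 1)) ^ p ≤
      C * ENNReal.ofReal (1 - s) * iterEnergy s p (Metric.ball 0 1) (Metric.ball 0 1) u := by
  have hp0 : 0 < p := by linarith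
  have hmt : volume (Metric.ball (0 : Euc N) 1) ≠ ⊤ := measure_ball_lt_top.ne
  -- It suffices to have the inequality at one fixed order `σ ≤ s₀`, by Morrey if `q = ∞` and by
  -- Sobolev otherwise; comparison of orders then supplies `1 - s` for all `s ≥ s₀`.
  obtain ⟨σ, hσ0, hσs, A, hA, h⟩ : ∃ σ : ℝ, 0 < σ ∧ σ ≤ s₀ ∧ ∃ A : ℝ≥0∞, A ≠ ⊤ ∧
      ∀ u : Euc N → ℝ, Continuous u →
      eLpNorm (fun x => u x - ⨍ y in Metric.ball (0 : Euc N) 1, u y) q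
        (volume.restrict (Metric.ball (0 : Euc N) 1)) ^ p ≤
      A * iterEnergy σ p (Metric.ball 0 1) (Metric.ball 0 1) u := by
    rcases eq_or_ne q ⊤ with rfl | hqt
    · have hsp : (N : ℝ) < s₀ * p := by
        rcases lt_trichotomy (s₀ * p) N with h | h | h
        · exact absurd (hq.2.1 h) (by simp)
        · exact absurd (hq.2.2 h) (by simp)
        · exact h
      obtain ⟨A, hA, h⟩ := morrey_ball hs₀ hp hsp
      refine ⟨s₀, hs₀, le_rfl, A, hA, fun u hu => ?_⟩
      have hb : eLpNorm (fun x => u x - ⨍ y in Metric.ball (0 : Euc N) 1, u y) ⊤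
          (volume.restrict (Metric.ball (0 : Euc N) 1)) ≤
          (A * iterEnergy s₀ p (Metric.ball 0 1) (Metric.ball 0 1) u) ^ (1 / p) := by
        rw [eLpNorm_exponent_top]
        refine essSup_le_of_ae_le _ (ae_restrict_of_forall_mem measurableSet_ball fun x hx => ?_)
        rw [one_div, ENNReal.le_rpow_inv_iff hp0]
        exact h u hu x hx
      refine (ENNReal.rpow_le_rpow hb hp0.le).trans (le_of_eq ?_)
      rw [← ENNReal.rpow_mul, one_div_mul_cancel hp0.ne', ENNReal.rpow_one]
    · obtain ⟨σ, hσ0, hσs, hσN, hσq⟩ := exists_lower_order hN hs₀ hp hq hqt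
      obtain ⟨A, hA, h⟩ := sobolev_ball hN hσ0 hp hσN
      refine ⟨σ, hσ0, hσs, (1 + volume (Metric.ball (0 : Euc N) 1)) ^ p * A,
        ENNReal.mul_ne_top (ENNReal.rpow_ne_top_of_nonneg hp0.le (by simp [hmt])) hA,
        fun u hu => ?_⟩
      rw [mul_assoc]
      exact (eLpNorm_ball_rpow_le hσ0.le hp hσN hq.1 hσq (by fun_prop)).trans
        (mul_le_mul_right (h u hu) _)
  obtain ⟨C, hC, hcomp⟩ := exists_iterEnergy_le_one_sub_mul hN hσ0.le (hσs.trans_lt hs₀1) hp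
  refine ⟨A * ENNReal.ofReal C, ENNReal.mul_ne_top hA ENNReal.ofReal_ne_top,
    fun s hs hs1 u hu => (h u hu).trans ?_⟩
  rw [mul_assoc A, mul_assoc A, ← ENNReal.ofReal_mul hC.le]
  exact mul_le_mul_right (hcomp s (hσs.trans hs) hs1 u hu.measurable) _

/-- Poincaré-Sobolev inequality on the unit ball, with the factor `s`, uniformly in the
admissible exponents. -/
theorem exists_poincare_sobolev_small {N : ℕ} (hN : 1 ≤ N) {p : ℝ} (hp : 1 ≤ p) :
    ∃ C : ℝ≥0∞, C ≠ ⊤ ∧ ∀ s : ℝ, 0 < s → s < 1 → s * p ≤ N / 2 → ∀ q : ℝ≥0∞,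
      IsSubcritical N p s q → ∀ u : Euc N → ℝ, Continuous u →
      eLpNorm (fun x => u x - ⨍ y in Metric.ball (0 : Euc N) 1, u y) q
        (volume.restrict (Metric.ball (0 : Euc N) 1)) ^ p ≤
      C * ENNReal.ofReal s * iterEnergy s p (Metric.ball 0 1) Set.univ u := by
  have hp0 : 0 < p := by linarith
  have hN0 : (0 : ℝ) < N := by exact_mod_cast hN
  have hmt : volume (Metric.ball (0 : Euc N) 1) ≠ ⊤ := measure_ball_lt_top.ne
  obtain ⟨A, hA, h⟩ := sobolev_ball_univ hN hp
  refine ⟨(1 + volume (Metric.ball (0 : Euc N) 1)) ^ p * (1 + A) ^ (2 : ℝ),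
    ENNReal.mul_ne_top (ENNReal.rpow_ne_top_of_nonneg hp0.le (by simp [hmt]))
      (ENNReal.rpow_ne_top_of_nonneg (by norm_num) (by simp [hA])),
    fun s hs hs1 hsp q hq u hu => ?_⟩
  have hspN : s * p < N := by linarith
  refine (eLpNorm_ball_rpow_le hs.le hp hspN hq.1 (hq.2.1 hspN) (by fun_prop)).trans ?_
  rw [mul_assoc, mul_assoc]
  refine mul_le_mul_right ((h s hs hs1 hspN u hu).trans ?_) _
  rw [← mul_assoc]
  refine mul_le_mul_left ?_ _
  have hNs : 0 < (N : ℝ) - s * p := by linarith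
  -- The exponent lies in `[1, 2]`: at least 1 turns the power of `s` into at most `s`, and at most
  -- 2 keeps the power of the constant bounded.
  have hν1 : 1 ≤ (N : ℝ) / (N - s * p) := by
    rw [one_le_div hNs]; nlinarith
  have hν2 : (N : ℝ) / (N - s * p) ≤ 2 := by
    rw [div_le_iff₀ hNs]; linarith
  rw [ENNReal.mul_rpow_of_nonneg _ _ (by linarith)]
  refine mul_le_mul' ?_ ?_
  · exact (ENNReal.rpow_le_rpow le_add_self (by linarith)).trans
      (ENNReal.rpow_le_rpow_of_exponent_le le_self_add hν2)
  · conv_rhs => rw [← ENNReal.rpow_one (ENNReal.ofReal s)]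
    exact ENNReal.rpow_le_rpow_of_exponent_ge (by simpa using hs1.le) hν1

/-! ### Scaling to arbitrary balls. -/

theorem map_smul_add_restrict_ball {N : ℕ} {R : ℝ} (hR : 0 < R) (x₀ : Euc N) :
    Measure.map (fun x => R • x + x₀) (volume.restrict (Metric.ball (0 : Euc N) 1)) =
      ENNReal.ofReal ((R ^ N)⁻¹) • volume.restrict (Metric.ball x₀ R) := by
  have hpre : (fun x : Euc N => R • x + x₀) ⁻¹' (Metric.ball x₀ R) = Metric.ball 0 1 := by
    ext x
    simp only [Set.mem_preimage, mem_ball_iff_norm, add_sub_cancel_right, norm_smul,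
      Real.norm_of_nonneg hR.le, sub_zero]
    constructor <;> intro h <;> nlinarith
  rw [← hpre, ← Measure.restrict_map (by fun_prop) measurableSet_ball]
  have : Measure.map (fun x : Euc N => R • x + x₀) volume = ENNReal.ofReal ((R ^ N)⁻¹) • volume := by
    ext t ht
    rw [Measure.map_apply (by fun_prop) ht, ← lintegral_indicator_one
      (ht.preimage (by fun_prop)), Measure.smul_apply, smul_eq_mul, ← lintegral_indicator_one ht,
      ← lintegral_comp_smul_add hR x₀ (measurable_one.indicator ht)]
    rfl
  rw [this, Measure.restrict_smul]

theorem rieszKernel_smul {N : ℕ} {R : ℝ} (hR : 0 < R) (e : ℝ) (h : Euc N) :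
    rieszKernel e h = ENNReal.ofReal (R ^ e) * rieszKernel e (R • h) := by
  unfold rieszKernel
  rw [← ENNReal.ofReal_mul (by positivity), norm_smul, Real.norm_of_nonneg hR.le,
    Real.mul_rpow hR.le (norm_nonneg _), ← mul_assoc, ← Real.rpow_add hR]
  simp

theorem iterEnergy_comp_smul_add {N : ℕ} {s p R : ℝ} (hR : 0 < R) (x₀ : Euc N) {u : Euc N → ℝ}
    (hu : Measurable u) :
    iterEnergy s p (Metric.ball 0 1) Set.univ (fun x => u (R • x + x₀)) =
      ENNReal.ofReal (R ^ (s * p - N)) * iterEnergy s p (Metric.ball x₀ R) Set.univ u := by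
  unfold iterEnergy
  set e : ℝ := (N : ℝ) + s * p with he
  set G : Euc N → ℝ≥0∞ := fun x => ∫⁻ y, diffPow p u x y * rieszKernel e (x - y) with hG
  have hGm : Measurable G := Measurable.lintegral_prod_right'
    (f := fun z : Euc N × Euc N => diffPow p u z.1 z.2 * rieszKernel e (z.1 - z.2)) (by fun_prop)
  have hinner : ∀ x : Euc N, ∫⁻ y in Set.univ, diffPow p (fun z => u (R • z + x₀)) x y *
      rieszKernel e (x - y) =
      ENNReal.ofReal (R ^ e) * ENNReal.ofReal ((R ^ N)⁻¹) * G (R • x + x₀) := by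
    intro x
    rw [Measure.restrict_univ, mul_assoc, hG,
      ← lintegral_comp_smul_add hR x₀ (f := fun y => diffPow p u (R • x + x₀) y *
        rieszKernel e (R • x + x₀ - y)) (by fun_prop), ← lintegral_const_mul' _ _ ENNReal.ofReal_ne_top]
    refine lintegral_congr fun y => ?_
    rw [rieszKernel_smul hR e (x - y), smul_sub, add_sub_add_right_eq_sub, mul_left_comm]
    rfl
  simp_rw [hinner]
  rw [lintegral_const_mul' _ _ (ENNReal.mul_ne_top ENNReal.ofReal_ne_top ENNReal.ofReal_ne_top)]
  have hmap : ∫⁻ x in Metric.ball (0 : Euc N) 1, G (R • x + x₀) =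
      ENNReal.ofReal ((R ^ N)⁻¹) * ∫⁻ x in Metric.ball x₀ R, G x := by
    rw [← lintegral_map (f := G) (g := fun x => R • x + x₀) hGm (by fun_prop),
      map_smul_add_restrict_ball hR, lintegral_smul_measure, smul_eq_mul]
  rw [hmap, ← mul_assoc, ← ENNReal.ofReal_mul (by positivity), ← ENNReal.ofReal_mul (by positivity)]
  congr 2
  · rw [← Real.rpow_natCast, ← Real.rpow_neg hR.le, ← Real.rpow_add hR, ← Real.rpow_add hR]
    congr 1; rw [he]; ring
  · simp [hG]

theorem eLpNorm_ball_eq_scale {N : ℕ} {R : ℝ} (hR : 0 < R) (x₀ : Euc N) (q : ℝ≥0∞)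
    {f : Euc N → ℝ} (hf : Continuous f) :
    eLpNorm f q (volume.restrict (Metric.ball x₀ R)) =
      ENNReal.ofReal (R ^ dimDiv N q) *
        eLpNorm (fun x => f (R • x + x₀)) q (volume.restrict (Metric.ball (0 : Euc N) 1)) := by
  have h1 : eLpNorm (fun x => f (R • x + x₀)) q (volume.restrict (Metric.ball (0 : Euc N) 1)) =
      eLpNorm f q (Measure.map (fun x => R • x + x₀)
        (volume.restrict (Metric.ball (0 : Euc N) 1))) :=
    (eLpNorm_map_measure hf.aestronglyMeasurable (by fun_prop)).symm
  rw [h1, map_smul_add_restrict_ball hR, eLpNorm_smul_measure_of_ne_zero, smul_eq_mul, ← mul_assoc,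
    ENNReal.ofReal_rpow_of_nonneg (by positivity) (by positivity),
    ← ENNReal.ofReal_mul (by positivity)]
  · have : R ^ dimDiv N q * ((R ^ N)⁻¹) ^ (1 / q).toReal = 1 := by
      rw [dimDiv, one_div, ← Real.rpow_natCast, ← Real.rpow_neg hR.le, ← Real.rpow_mul hR.le,
        ← Real.rpow_add hR]
      simp
    rw [this]; simp
  · simpa using pow_pos hR N

/-- The Poincaré-Sobolev inequality on a ball, transported by scaling from the unit ball. -/
theorem poincare_sobolev_scale {N : ℕ} {s p : ℝ} (hp : 1 ≤ p) {q : ℝ≥0∞} {D : ℝ≥0∞}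
    (h : ∀ u : Euc N → ℝ, Continuous u →
      eLpNorm (fun x => u x - ⨍ y in Metric.ball (0 : Euc N) 1, u y) q
        (volume.restrict (Metric.ball (0 : Euc N) 1)) ^ p ≤
      D * iterEnergy s p (Metric.ball 0 1) Set.univ u)
    {R : ℝ} (hR : 0 < R) (x₀ : Euc N) {u : Euc N → ℝ} (hu : Continuous u) :
    eLpNorm (fun x => u x - ⨍ y in Metric.ball (0 : Euc N) 1, u (R • y + x₀)) q
        (volume.restrict (Metric.ball x₀ R)) ^ p ≤
      D * ENNReal.ofReal (R ^ (p * dimDiv N q + (s * p - N))) *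
        iterEnergy s p (Metric.ball x₀ R) Set.univ u := by
  have hp0 : 0 < p := by linarith
  rw [eLpNorm_ball_eq_scale hR x₀ q (by fun_prop), ENNReal.mul_rpow_of_nonneg _ _ hp0.le,
    ENNReal.ofReal_rpow_of_nonneg (by positivity) hp0.le, ← Real.rpow_mul hR.le]
  refine (mul_le_mul_right (h (fun x => u (R • x + x₀)) (by fun_prop)) _).trans (le_of_eq ?_)
  rw [iterEnergy_comp_smul_add hR x₀ hu.measurable, Real.rpow_add hR,
    ENNReal.ofReal_mul (by positivity), mul_comm (dimDiv N q) p]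
  ring

/-! ### Cut-off functions and their energy. -/

/-- The function is unchanged by projecting its argument to `[0, 1]`, so the Lipschitz bound on that
interval is global. Later `1 ≤ L` gives `L ^ (s p) ≤ L ^ p`. -/
theorem exists_lipschitz_smoothTransition :
    ∃ L : ℝ, 1 ≤ L ∧ ∀ a b : ℝ,
      |Real.smoothTransition a - Real.smoothTransition b| ≤ L * |a - b| := by
  obtain ⟨K, hK⟩ := (Real.smoothTransition.contDiff (n := 1)).contDiffOn
    (s := Set.Icc (0 : ℝ) 1) |>.exists_lipschitzOnWith (by simp) (convex_Icc 0 1) isCompact_Icc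
  refine ⟨max 1 K, le_max_left _ _, fun a b => ?_⟩
  rw [← Real.smoothTransition.projIcc (x := a), ← Real.smoothTransition.projIcc (x := b)]
  have h := hK.dist_le_mul _ (Set.projIcc (0 : ℝ) 1 zero_le_one a).2 _
    (Set.projIcc (0 : ℝ) 1 zero_le_one b).2
  rw [Real.dist_eq, Real.dist_eq] at h
  refine h.trans (mul_le_mul (le_max_right _ _) ?_ (abs_nonneg _) (by positivity))
  exact Set.abs_projIcc_sub_projIcc zero_le_one

/-- A cut-off function between two concentric balls with a Lipschitz bound. -/
theorem exists_cutoff : ∃ L : ℝ, 1 ≤ L ∧ ∀ (N : ℕ) (x₀ : Euc N) (r R : ℝ), 0 < r → r < R →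
    ∃ η : Euc N → ℝ, IsTestFunction (Metric.ball x₀ R) η ∧ (∀ x, 0 ≤ η x) ∧ (∀ x, η x ≤ 1) ∧
      (∀ x ∈ Metric.closedBall x₀ r, η x = 1) ∧
      ∀ x y, |η x - η y| ≤ L / (R - r) * ‖x - y‖ := by
  obtain ⟨L, hL1, hL⟩ := exists_lipschitz_smoothTransition
  refine ⟨2 * L, by linarith, fun N x₀ r R hr hrR => ?_⟩
  set ρ : ℝ := (r + R) / 2 with hρ
  have hρr : 0 < ρ - r := by rw [hρ]; linarith
  set η : Euc N → ℝ := fun x => Real.smoothTransition ((ρ - ‖x - x₀‖) / (ρ - r)) with hη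
  have hone : ∀ x ∈ Metric.closedBall x₀ r, η x = 1 := by
    intro x hx
    rw [mem_closedBall_iff_norm] at hx
    refine Real.smoothTransition.one_of_one_le ?_
    rw [one_le_div hρr]; linarith
  have hsupp : Function.support η ⊆ Metric.closedBall x₀ ρ := by
    intro x hx
    by_contra hcon
    rw [mem_closedBall_iff_norm, not_le] at hcon
    exact hx (Real.smoothTransition.zero_of_nonpos
      (div_nonpos_of_nonpos_of_nonneg (by linarith) hρr.le))
  have htsupp : tsupport η ⊆ Metric.closedBall x₀ ρ :=
    closure_minimal hsupp Metric.isClosed_closedBall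
  refine ⟨η, ⟨?_, ?_, ?_⟩, fun x => Real.smoothTransition.nonneg _,
    fun x => Real.smoothTransition.le_one _, hone, fun x y => ?_⟩
  · rw [contDiff_iff_contDiffAt]
    intro x
    -- The norm is not smooth at the centre, but `η` is constant near it.
    by_cases hx : x = x₀
    · have : η =ᶠ[𝓝 x] fun _ => 1 := by
        filter_upwards [Metric.closedBall_mem_nhds x hr] with y hy
        exact hone y (by rwa [hx] at hy)
      exact contDiffAt_const.congr_of_eventuallyEq this
    · have h1 : ContDiffAt ℝ ∞ (fun y : Euc N => ‖y - x₀‖) x :=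
        (contDiffAt_id.sub contDiffAt_const).norm ℝ (sub_ne_zero.2 hx)
      exact Real.smoothTransition.contDiffAt.comp x ((contDiffAt_const.sub h1).div_const _)
  · exact (isCompact_closedBall x₀ ρ).of_isClosed_subset (isClosed_tsupport η) htsupp
  · exact htsupp.trans (Metric.closedBall_subset_ball (by rw [hρ]; linarith))
  · refine (hL _ _).trans ?_
    rw [← sub_div, sub_sub_sub_cancel_left, abs_div, abs_of_pos hρr]
    have h2 : ρ - r = (R - r) / 2 := by rw [hρ]; ring
    have h3 : |‖y - x₀‖ - ‖x - x₀‖| ≤ ‖x - y‖ := by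
      rw [abs_sub_comm]
      refine (abs_norm_sub_norm_le _ _).trans (le_of_eq ?_)
      congr 1; abel
    have hRr : 0 < R - r := by linarith
    calc L * (|‖y - x₀‖ - ‖x - x₀‖| / (ρ - r)) ≤ L * (‖x - y‖ / (ρ - r)) := by
          gcongr
      _ = _ := by rw [h2]; field_simp

/-- The increments of `η` are at most `L * ‖h‖` and at most 1; the integral is split at `‖h‖ = 1 /
L`, where the bounds agree. The near part is of order `1 / (1 - s)` and the far part of order `1 /
s`. -/
theorem lintegral_diffPow_cutoff_le {N : ℕ} (hN : 1 ≤ N) {s p L : ℝ} (hs : 0 < s) (hs1 : s < 1)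
    (hp : 1 ≤ p) (hL : 0 < L) {η : Euc N → ℝ} (h0 : ∀ x, 0 ≤ η x) (h1 : ∀ x, η x ≤ 1)
    (hLip : ∀ x y, |η x - η y| ≤ L * ‖x - y‖) (x : Euc N) :
    ∫⁻ y, diffPow p η x y * rieszKernel (N + s * p) (x - y) ≤
      ENNReal.ofReal (N * volume.real (Metric.ball (0 : Euc N) 1) * (L ^ (s * p) / (s * (1 - s)))) := by
  have hp0 : 0 < p := by linarith
  have hδ : 0 < p - s * p := by nlinarith
  have hβ : 0 < s * p := by positivity
  set m := volume.real (Metric.ball (0 : Euc N) 1) with hm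
  set f : Euc N → ℝ≥0∞ := {h : Euc N | ‖h‖ ≤ L⁻¹}.indicator
    (fun h => ENNReal.ofReal (L ^ p) * ENNReal.ofReal (‖h‖ ^ ((p - s * p) - N))) with hf
  set g : Euc N → ℝ≥0∞ := {h : Euc N | L⁻¹ < ‖h‖}.indicator (rieszKernel (N + s * p)) with hg
  have hset1 : MeasurableSet {h : Euc N | ‖h‖ ≤ L⁻¹} :=
    measurableSet_le measurable_norm measurable_const
  have hset2 : MeasurableSet {h : Euc N | L⁻¹ < ‖h‖} :=
    measurableSet_lt measurable_const measurable_norm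
  have hfm : Measurable f := Measurable.indicator (by fun_prop) hset1
  have hpt : ∀ y, diffPow p η x y * rieszKernel (N + s * p) (x - y) ≤ f (x - y) + g (x - y) := by
    intro y
    rcases eq_or_ne x y with rfl | hxy
    · simp [diffPow_self hp0]
    have hpos : 0 < ‖x - y‖ := norm_pos_iff.2 (sub_ne_zero.2 hxy)
    by_cases hle : ‖x - y‖ ≤ L⁻¹
    · refine le_trans ?_ le_self_add
      rw [hf, Set.indicator_of_mem (by exact hle)]
      have hd : diffPow p η x y ≤ ENNReal.ofReal ((L * ‖x - y‖) ^ p) := by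
        unfold diffPow
        rw [← ofReal_norm, ENNReal.ofReal_rpow_of_nonneg (norm_nonneg _) hp0.le]
        exact ENNReal.ofReal_le_ofReal (Real.rpow_le_rpow (norm_nonneg _) (hLip x y) hp0.le)
      refine (mul_le_mul_left hd _).trans (le_of_eq ?_)
      unfold rieszKernel
      rw [← ENNReal.ofReal_mul (by positivity), ← ENNReal.ofReal_mul (by positivity),
        Real.mul_rpow hL.le hpos.le, mul_assoc, ← Real.rpow_add hpos]
      congr 3; ring
    · refine le_trans ?_ le_add_self
      rw [hg, Set.indicator_of_mem (by exact not_le.1 hle)]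
      have hd : diffPow p η x y ≤ 1 := by
        unfold diffPow
        refine ENNReal.rpow_le_one ?_ hp0.le
        rw [← ofReal_norm, ← ENNReal.ofReal_one]
        refine ENNReal.ofReal_le_ofReal ?_
        rw [Real.norm_eq_abs, abs_le]
        constructor <;> linarith [h0 x, h0 y, h1 x, h1 y]
      simpa using mul_le_mul_left hd (rieszKernel (N + s * p) (x - y))
  calc _ ≤ ∫⁻ y, (f (x - y) + g (x - y)) := lintegral_mono hpt
    _ = (∫⁻ h, f h) + ∫⁻ h, g h := by
        rw [lintegral_add_left (by fun_prop), lintegral_sub_left_eq_self, lintegral_sub_left_eq_self]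
    _ = ENNReal.ofReal (L ^ p) * ENNReal.ofReal (N * m * ((L⁻¹) ^ (p - s * p) / (p - s * p))) +
        ENNReal.ofReal (N * m * ((L⁻¹) ^ (-(s * p)) / (s * p))) := by
        rw [hf, hg, lintegral_indicator hset1, lintegral_indicator hset2,
          lintegral_const_mul _ (by fun_prop), lintegral_norm_rpow_closedBall hN hδ (by positivity),
          lintegral_rieszKernel_tail hN hβ (by positivity)]
    _ ≤ _ := by
        rw [← ENNReal.ofReal_mul (by positivity), ← ENNReal.ofReal_add (by positivity) (by positivity)]
        refine ENNReal.ofReal_le_ofReal ?_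
        have e1 : (L⁻¹) ^ (p - s * p) = (L ^ p)⁻¹ * L ^ (s * p) := by
          rw [Real.inv_rpow hL.le, ← Real.rpow_neg hL.le, ← Real.rpow_neg hL.le,
            ← Real.rpow_add hL]
          congr 1; ring
        have e2 : (L⁻¹) ^ (-(s * p)) = L ^ (s * p) := by
          rw [Real.inv_rpow hL.le, Real.rpow_neg hL.le, inv_inv]
        rw [e1, e2]
        have hLp : 0 < L ^ p := by positivity
        have h1s : 0 < 1 - s := by linarith
        have e3 : L ^ p * (N * m * ((L ^ p)⁻¹ * L ^ (s * p) / (p - s * p))) +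
            N * m * (L ^ (s * p) / (s * p)) = N * m * (L ^ (s * p) / (s * (1 - s))) * (1 / p) := by
          have : p - s * p = p * (1 - s) := by ring
          rw [this]
          field_simp
          ring
        rw [e3]
        refine mul_le_of_le_one_right (by positivity) ?_
        rw [div_le_one hp0]; exact hp

/-- A pair contributes only if one of its points lies in `B`, and the integrand is symmetric. -/
theorem iterEnergy_univ_le_of_support {N : ℕ} {s p : ℝ} (hp : 0 < p) {B : Set (Euc N)}
    (hB : MeasurableSet B) {w : Euc N → ℝ} (hw : Measurable w) (hsupp : ∀ x ∉ B, w x = 0) :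
    iterEnergy s p Set.univ Set.univ w ≤ 2 * iterEnergy s p B Set.univ w := by
  set k : Euc N → Euc N → ℝ≥0∞ := fun x y => diffPow p w x y * rieszKernel (N + s * p) (x - y)
    with hk
  have hkm : Measurable (Function.uncurry k) := by unfold Function.uncurry; fun_prop
  have hpt : ∀ x y, k x y ≤ B.indicator (fun x => k x y) x + B.indicator (fun y => k x y) y := by
    intro x y
    by_cases hx : x ∈ B
    · rw [Set.indicator_of_mem hx]; exact le_self_add
    by_cases hy : y ∈ B
    · rw [Set.indicator_of_mem hy]; exact le_add_self
    · simp [hk, diffPow, hsupp x hx, hsupp y hy, hp]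
  have hA : ∫⁻ x, ∫⁻ y, B.indicator (fun x => k x y) x = iterEnergy s p B Set.univ w := by
    unfold iterEnergy
    rw [← lintegral_indicator hB]
    refine lintegral_congr fun x => ?_
    by_cases hx : x ∈ B
    · simp [Set.indicator_of_mem hx, hk]
    · simp [Set.indicator_of_notMem hx]
  have hkB : Measurable (Function.uncurry fun x y => B.indicator (fun x => k x y) x) := by
    have : (Function.uncurry fun x y => B.indicator (fun x => k x y) x) =
        (Prod.fst ⁻¹' B).indicator (Function.uncurry k) := by
      ext ⟨x, y⟩
      by_cases hx : x ∈ B <;> simp [Function.uncurry, hx]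
    rw [this]
    exact hkm.indicator (measurable_fst hB)
  have hsymm : ∫⁻ x, ∫⁻ y, B.indicator (fun y => k x y) y =
      ∫⁻ x, ∫⁻ y, B.indicator (fun x => k x y) x := by
    rw [lintegral_lintegral_swap hkB.aemeasurable]
    refine lintegral_congr fun x => lintegral_congr fun y => ?_
    by_cases hy : y ∈ B
    · simp only [Set.indicator_of_mem hy, hk]
      rw [diffPow_comm, rieszKernel_sub_comm]
    · simp [Set.indicator_of_notMem hy]
  calc iterEnergy s p Set.univ Set.univ w = ∫⁻ x, ∫⁻ y, k x y := by simp [iterEnergy, hk]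
    _ ≤ ∫⁻ x, ∫⁻ y, (B.indicator (fun x => k x y) x + B.indicator (fun y => k x y) y) :=
        lintegral_mono fun x => lintegral_mono fun y => hpt x y
    _ = (∫⁻ x, ∫⁻ y, B.indicator (fun x => k x y) x) + ∫⁻ x, ∫⁻ y, B.indicator (fun y => k x y) y := by
        have hm : Measurable fun x => ∫⁻ y, B.indicator (fun x => k x y) x :=
          Measurable.lintegral_prod_right' hkB
        rw [← lintegral_add_left hm]
        refine lintegral_congr fun x => ?_
        rw [lintegral_add_left]
        exact hkB.comp (by fun_prop : Measurable fun y => (x, y))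
    _ = _ := by rw [hsymm, hA, two_mul]

/-- In the product rule the factor `u - c` is evaluated at `x`, the variable confined to `B`, so the
difference of `η` can be integrated in `y` over the whole space first. -/
theorem iterEnergy_cutoff_mul_le {N : ℕ} {s p : ℝ} (hp : 1 ≤ p) (B : Set (Euc N)) {T : ℝ≥0∞}
    {η u : Euc N → ℝ} (hη : Measurable η) (hu : Measurable u) (c : ℝ) (h0 : ∀ x, 0 ≤ η x)
    (h1 : ∀ x, η x ≤ 1)
    (hT : ∀ x, ∫⁻ y, diffPow p η x y * rieszKernel (N + s * p) (x - y) ≤ T) :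
    iterEnergy s p B Set.univ (fun x => η x * (u x - c)) ≤
      2 ^ (p - 1) * (iterEnergy s p B Set.univ u + T * ∫⁻ x in B, ‖u x - c‖ₑ ^ p) := by
  have hp0 : 0 ≤ p := by linarith
  have hpt : ∀ x y, diffPow p (fun x => η x * (u x - c)) x y ≤
      2 ^ (p - 1) * (diffPow p u x y + ‖u x - c‖ₑ ^ p * diffPow p η x y) := by
    intro x y
    have heq : η x * (u x - c) - η y * (u y - c) =
        η y * (u x - u y) + (u x - c) * (η x - η y) := by ring
    unfold diffPow
    rw [heq]
    refine (enorm_add_rpow_le hp _ _).trans ?_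
    gcongr
    · rw [enorm_mul]
      refine mul_le_of_le_one_left zero_le ?_
      rw [← ofReal_norm, ← ENNReal.ofReal_one]
      refine ENNReal.ofReal_le_ofReal ?_
      rw [Real.norm_of_nonneg (h0 y)]; exact h1 y
    · rw [enorm_mul, ENNReal.mul_rpow_of_nonneg _ _ hp0]
  unfold iterEnergy
  have h2p : (2 : ℝ≥0∞) ^ (p - 1) ≠ ⊤ := ENNReal.rpow_ne_top_of_nonneg (by linarith) (by simp)
  calc _ ≤ ∫⁻ x in B, 2 ^ (p - 1) *
        ((∫⁻ y in Set.univ, diffPow p u x y * rieszKernel (N + s * p) (x - y)) +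
          ‖u x - c‖ₑ ^ p * T) := by
        refine lintegral_mono fun x => ?_
        calc _ ≤ ∫⁻ y in Set.univ, 2 ^ (p - 1) * (diffPow p u x y * rieszKernel (N + s * p) (x - y) +
              ‖u x - c‖ₑ ^ p * (diffPow p η x y * rieszKernel (N + s * p) (x - y))) := by
              refine lintegral_mono fun y => ?_
              refine (mul_le_mul_left (hpt x y) _).trans (le_of_eq ?_)
              ring
          _ = 2 ^ (p - 1) * ((∫⁻ y in Set.univ, diffPow p u x y * rieszKernel (N + s * p) (x - y)) +
              ‖u x - c‖ₑ ^ p *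
                ∫⁻ y in Set.univ, diffPow p η x y * rieszKernel (N + s * p) (x - y)) := by
              rw [lintegral_const_mul' _ _ h2p, lintegral_add_left (by fun_prop),
                lintegral_const_mul _ (by fun_prop)]
          _ ≤ _ := by
              rw [Measure.restrict_univ]
              exact mul_le_mul_right (add_le_add le_rfl (mul_le_mul_right (hT x) _)) _
    _ = _ := by
        rw [lintegral_const_mul' _ _ h2p, lintegral_add_right _ (by fun_prop),
          lintegral_mul_const _ (by fun_prop), mul_comm T]

theorem iterEnergy_const_mul {N : ℕ} {s p : ℝ} (hp : 0 ≤ p) (A B : Set (Euc N)) (a : ℝ)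
    (w : Euc N → ℝ) :
    iterEnergy s p A B (fun x => a * w x) = ‖a‖ₑ ^ p * iterEnergy s p A B w := by
  have hat : ‖a‖ₑ ^ p ≠ ⊤ := ENNReal.rpow_ne_top_of_nonneg hp enorm_ne_top
  unfold iterEnergy
  rw [← lintegral_const_mul' _ _ hat]
  refine lintegral_congr fun x => ?_
  rw [← lintegral_const_mul' _ _ hat]
  refine lintegral_congr fun y => ?_
  unfold diffPow
  rw [← mul_sub, enorm_mul, ENNReal.mul_rpow_of_nonneg _ _ hp, mul_assoc]

/-! ### Competitors for the capacity. -/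

theorem fractionalCapacity_le {N : ℕ} {s p : ℝ} (hp : 0 ≤ p) {S E : Set (Euc N)}
    {φ : Euc N → ℝ} (hφ : IsTestFunction E φ) (h1 : ∀ x ∈ S, 1 ≤ φ x) :
    fractionalCapacity s p S E ≤ iterEnergy s p Set.univ Set.univ φ := by
  unfold fractionalCapacity
  unfold iterEnergy
  rw [← gagliardoEnergy_eq hp _ _ hφ.1.continuous.measurable]
  exact iInf₂_le_of_le φ hφ (iInf_le _ h1)

/-- For `c ≠ 0` the function `η (1 - u / c)` is smooth, supported in `E` and equal to 1 on `S`,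
because `u` vanishes there; homogeneity of the energy removes the factor `1 / c`. -/
theorem enorm_rpow_mul_fractionalCapacity_le {N : ℕ} {s p : ℝ} (hp : 1 ≤ p) {S E : Set (Euc N)}
    {η u : Euc N → ℝ} (hη : IsTestFunction E η) (h1 : ∀ x ∈ S, η x = 1)
    (hu : ContDiff ℝ ∞ u) (hu0 : ∀ x ∈ S, u x = 0) (c : ℝ) :
    ‖c‖ₑ ^ p * fractionalCapacity s p S E ≤
      iterEnergy s p Set.univ Set.univ (fun x => η x * (u x - c)) := by
  have hp0 : 0 < p := by linarith
  rcases eq_or_ne c 0 with rfl | hc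
  · simp [hp0]
  have hφ : IsTestFunction E (fun x => -c⁻¹ * (η x * (u x - c))) := by
    refine ⟨contDiff_const.mul (hη.1.mul (hu.sub contDiff_const)), ?_, ?_⟩
    · exact (hη.2.1.mul_right (f' := fun x => u x - c)).mul_left (f := fun _ => -c⁻¹)
    · refine Set.Subset.trans ?_ hη.2.2
      refine closure_mono fun x hx => ?_
      simp only [Function.mem_support] at hx ⊢
      intro h0
      exact hx (by simp [h0])
  have hle := fractionalCapacity_le (s := s) hp0.le hφ (S := S) (fun x hx => by
    rw [h1 x hx, hu0 x hx, one_mul, zero_sub, neg_mul_neg, inv_mul_cancel₀ hc])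
  rw [iterEnergy_const_mul hp0.le] at hle
  refine (mul_le_mul_right hle _).trans (le_of_eq ?_)
  rw [← mul_assoc, ← ENNReal.mul_rpow_of_nonneg _ _ hp0.le, ← enorm_mul]
  have : c * -c⁻¹ = -1 := by field_simp
  rw [this]
  simp

theorem dimDiv_nonneg (N : ℕ) (q : ℝ≥0∞) : 0 ≤ dimDiv N q := by
  unfold dimDiv; positivity

theorem mul_dimDiv_le {N : ℕ} {p : ℝ} (hp : 0 < p) {q : ℝ≥0∞} (hq : ENNReal.ofReal p ≤ q) :
    p * dimDiv N q ≤ N := by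
  have h1 : (q⁻¹).toReal ≤ p⁻¹ := by
    have h2 : q⁻¹ ≤ (ENNReal.ofReal p)⁻¹ := ENNReal.inv_le_inv.2 hq
    rw [← ENNReal.ofReal_inv_of_pos hp] at h2
    have h3 := ENNReal.toReal_mono ENNReal.ofReal_ne_top h2
    rwa [ENNReal.toReal_ofReal (by positivity)] at h3
  unfold dimDiv
  calc p * (N * (q⁻¹).toReal) ≤ p * (N * p⁻¹) := by gcongr
    _ = N := by field_simp

theorem mul_dimDiv_ofReal {N : ℕ} {p : ℝ} (hp : 0 < p) :
    p * dimDiv N (ENNReal.ofReal p) = N := by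
  rw [dimDiv, ← ENNReal.ofReal_inv_of_pos hp, ENNReal.toReal_ofReal (by positivity)]
  field_simp

theorem volume_ball_rpow_le {N : ℕ} {r : ℝ} (hr : 0 < r) (x₀ : Euc N) {q : ℝ≥0∞} (hq : 1 ≤ q) :
    volume (Metric.ball x₀ r) ^ (1 / q.toReal) ≤
      ENNReal.ofReal (r ^ dimDiv N q) * (1 + volume (Metric.ball (0 : Euc N) 1)) := by
  have hexp : 1 / q.toReal = (q⁻¹).toReal := by rw [ENNReal.toReal_inv, one_div]
  rw [hexp, Measure.addHaar_ball_of_pos _ _ hr, ENNReal.mul_rpow_of_nonneg _ _ ENNReal.toReal_nonneg,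
    ENNReal.ofReal_rpow_of_nonneg (by positivity) ENNReal.toReal_nonneg]
  refine mul_le_mul' (le_of_eq ?_) (rpow_le_one_add ENNReal.toReal_nonneg ?_)
  · rw [dimDiv, finrank_euclideanSpace_fin, ← Real.rpow_natCast_mul hr.le]
  · have : q⁻¹ ≤ 1 := ENNReal.inv_le_one.2 hq
    simpa using ENNReal.toReal_mono ENNReal.one_ne_top this

/-! ### The Maz'ya-Poincaré inequality for comparable radii. -/

/-- The Maz'ya-Poincaré inequality on concentric balls, deduced from the Poincaré-Sobolev
inequality with gain `g`. -/
theorem exists_capacity_poincare {N : ℕ} (hN : 1 ≤ N) {p : ℝ} (hp : 1 ≤ p) {C : ℝ≥0∞} (hC : C ≠ ⊤)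
    {A : ℝ} (hA : 0 ≤ A) :
    ∃ K : ℝ≥0∞, K ≠ ⊤ ∧ ∀ (s g : ℝ) (q : ℝ≥0∞), 0 < s → s < 1 → 0 < g →
      1 / (s * (1 - s)) ≤ A / g → ENNReal.ofReal p ≤ q →
      (∀ q' ∈ ({q, ENNReal.ofReal p} : Set ℝ≥0∞), ∀ u : Euc N → ℝ, Continuous u →
        eLpNorm (fun x => u x - ⨍ y in Metric.ball (0 : Euc N) 1, u y) q'
          (volume.restrict (Metric.ball (0 : Euc N) 1)) ^ p ≤
        C * ENNReal.ofReal g * iterEnergy s p (Metric.ball 0 1) Set.univ u) →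
      ∀ (x₀ : Euc N) (r R : ℝ), 0 < r → r < R → R ≤ 2 * r → ∀ S ⊆ Metric.closedBall x₀ r,
      ∀ u : Euc N → ℝ, ContDiff ℝ ∞ u → (∀ x ∈ S, u x = 0) →
        fractionalCapacity s p S (Metric.ball x₀ R) ^ (1 / p) *
          eLpNorm u q (volume.restrict (Metric.ball x₀ r)) ≤
        K * ENNReal.ofReal ((R / (R - r)) ^ s * r ^ dimDiv N q) *
          iterEnergy s p (Metric.ball x₀ R) Set.univ u ^ (1 / p) := by
  obtain ⟨L₀, hL₀, hcut⟩ := exists_cutoff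
  have hp0 : 0 < p := by linarith
  set m := volume (Metric.ball (0 : Euc N) 1) with hm
  have hmt : m ≠ ⊤ := measure_ball_lt_top.ne
  set τ : ℝ := N * volume.real (Metric.ball (0 : Euc N) 1) * (L₀ ^ p * A) with hτ
  have hτ0 : 0 ≤ τ := by positivity
  have h2p : (2 : ℝ≥0∞) ^ (p - 1) ≠ ⊤ := ENNReal.rpow_ne_top_of_nonneg (by linarith) (by simp)
  set K₁ : ℝ≥0∞ := 2 * m * (ENNReal.ofReal τ * C) * ENNReal.ofReal (2 ^ (N : ℝ)) with hK₁
  set K₂ : ℝ≥0∞ := 2 * 2 ^ (p - 1) * (1 + ENNReal.ofReal τ * C) * (1 + m) ^ p with hK₂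
  have hτC : ENNReal.ofReal τ * C ≠ ⊤ := ENNReal.mul_ne_top ENNReal.ofReal_ne_top hC
  have hK₁t : K₁ ≠ ⊤ := ENNReal.mul_ne_top (ENNReal.mul_ne_top (ENNReal.mul_ne_top (by simp) hmt)
    hτC) ENNReal.ofReal_ne_top
  have hK₂t : K₂ ≠ ⊤ := ENNReal.mul_ne_top (ENNReal.mul_ne_top (ENNReal.mul_ne_top (by simp) h2p)
    (ENNReal.add_ne_top.2 ⟨ENNReal.one_ne_top, hτC⟩))
    (ENNReal.rpow_ne_top_of_nonneg hp0.le (ENNReal.add_ne_top.2 ⟨ENNReal.one_ne_top, hmt⟩))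
  refine ⟨(1 + K₁) + (1 + K₂), by simp [hK₁t, hK₂t], ?_⟩
  intro s g q hs hs1 hg hgA hpq hPS x₀ r R hr hrR hR2 S hS u hu hu0
  have hR : 0 < R := hr.trans hrR
  have hRr : 0 < R - r := by linarith
  have hsp : 0 < s * p := by positivity
  have huc : Continuous u := hu.continuous
  have hum : Measurable u := huc.measurable
  have h1q : 1 ≤ q := (by simpa using ENNReal.ofReal_le_ofReal hp : (1 : ℝ≥0∞) ≤ ENNReal.ofReal p).trans hpq
  set d := dimDiv N q with hd
  have hd0 : 0 ≤ d := dimDiv_nonneg N q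
  set ξ : ℝ := R / (R - r) with hξ
  have hξ1 : 1 ≤ ξ := by rw [hξ, one_le_div hRr]; linarith
  obtain ⟨η, hη, hη0, hη1, hηS, hηL⟩ := hcut N x₀ r R hr hrR
  have hηm : Measurable η := hη.1.continuous.measurable
  set B := Metric.ball x₀ R with hB
  set E := iterEnergy s p B Set.univ u with hE
  set c := ⨍ y in Metric.ball (0 : Euc N) 1, u (R • y + x₀) with hc
  set cap := fractionalCapacity s p S B with hcap
  set T : ℝ≥0∞ := ENNReal.ofReal (τ * ((R - r) ^ (-(s * p)) * g⁻¹)) with hT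
  have hΘ : ∀ x, ∫⁻ y, diffPow p η x y * rieszKernel (N + s * p) (x - y) ≤ T := by
    intro x
    refine (lintegral_diffPow_cutoff_le hN hs hs1 hp (div_pos (by linarith) hRr) hη0 hη1 hηL x).trans
      (ENNReal.ofReal_le_ofReal ?_)
    have h1 : (L₀ / (R - r)) ^ (s * p) ≤ L₀ ^ p * (R - r) ^ (-(s * p)) := by
      rw [Real.div_rpow (by linarith) hRr.le, Real.rpow_neg hRr.le, div_eq_mul_inv]
      gcongr
      nlinarith
    have h1s : 0 < 1 - s := by linarith
    calc N * volume.real (Metric.ball (0 : Euc N) 1) * ((L₀ / (R - r)) ^ (s * p) / (s * (1 - s)))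
        = N * volume.real (Metric.ball (0 : Euc N) 1) *
          ((L₀ / (R - r)) ^ (s * p) * (1 / (s * (1 - s)))) := by ring
      _ ≤ N * volume.real (Metric.ball (0 : Euc N) 1) *
          ((L₀ ^ p * (R - r) ^ (-(s * p))) * (A / g)) := by gcongr
      _ = _ := by rw [hτ]; ring
  -- The key cancellation: the blow-up `1 / g` of the cut-off energy meets the Poincaré-Sobolev gain
  -- `g`, leaving only `(R / (R - r)) ^ (s p)`.
  have hTg : T * (ENNReal.ofReal g * ENNReal.ofReal (R ^ (s * p))) =
      ENNReal.ofReal τ * ENNReal.ofReal (ξ ^ (s * p)) := by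
    rw [hT, ← ENNReal.ofReal_mul hg.le, ← ENNReal.ofReal_mul (by positivity),
      ← ENNReal.ofReal_mul hτ0]
    congr 1
    rw [hξ, Real.div_rpow hR.le hRr.le, Real.rpow_neg hRr.le]
    field_simp
  have hcapB : cap ≤ 2 * (T * (ENNReal.ofReal (R ^ (N : ℝ)) * m)) := by
    refine (fractionalCapacity_le hp0.le hη (fun x hx => (hηS x (hS hx)).ge)).trans ?_
    refine (iterEnergy_univ_le_of_support hp0 measurableSet_ball hηm (B := B) fun x hx => ?_).trans ?_
    · exact image_eq_zero_of_notMem_tsupport fun h => hx (hη.2.2 h)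
    · refine mul_le_mul_right ?_ _
      unfold iterEnergy
      refine (lintegral_mono fun x => (le_of_eq (by rw [Measure.restrict_univ])).trans (hΘ x)).trans ?_
      rw [setLIntegral_const, hB, Measure.addHaar_ball_of_pos _ _ hR, finrank_euclideanSpace_fin,
        Real.rpow_natCast]
  have hSq := poincare_sobolev_scale hp (hPS q (by simp)) hR x₀ huc
  -- The exponent `p` is needed besides `q` for the term `∫ |u - c| ^ p` of the product rule.
  have hSp := poincare_sobolev_scale hp (hPS (ENNReal.ofReal p) (by simp)) hR x₀ huc
  rw [mul_dimDiv_ofReal hp0, add_sub_cancel,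
    eLpNorm_eq_lintegral_rpow_enorm_toReal (by simpa using hp0) ENNReal.ofReal_ne_top,
    ENNReal.toReal_ofReal hp0.le, ← ENNReal.rpow_mul, one_div_mul_cancel hp0.ne',
    ENNReal.rpow_one] at hSp
  set v : Euc N → ℝ := fun x => u x - c with hv
  set Ψ : ℝ≥0∞ := ENNReal.ofReal (ξ ^ s * r ^ d) with hΨ
  have hΨp : Ψ ^ p = ENNReal.ofReal (ξ ^ (s * p) * r ^ (p * d)) := by
    rw [hΨ, ENNReal.ofReal_rpow_of_nonneg (by positivity) hp0.le,
      Real.mul_rpow (by positivity) (by positivity), ← Real.rpow_mul (by linarith),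
      ← Real.rpow_mul hr.le, mul_comm d p]
  have hroot : ∀ {a : ℝ≥0∞} {k : ℝ≥0∞}, a ^ p ≤ k * Ψ ^ p * E → a ≤ (1 + k) * Ψ * E ^ (1 / p) := by
    intro a k h
    have h1 := ENNReal.rpow_le_rpow h (show 0 ≤ 1 / p by positivity)
    rw [← ENNReal.rpow_mul, mul_one_div_cancel hp0.ne', ENNReal.rpow_one,
      ENNReal.mul_rpow_of_nonneg _ _ (by positivity), ENNReal.mul_rpow_of_nonneg _ _ (by positivity),
      ← ENNReal.rpow_mul, mul_one_div_cancel hp0.ne', ENNReal.rpow_one] at h1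
    refine h1.trans (mul_le_mul_left (mul_le_mul_left ?_ _) _)
    exact rpow_le_one_add (by positivity) (by rw [div_le_one hp0]; exact hp)
  -- Oscillating part: the capacity is at most the energy of the cut-off, and `u - c` obeys
  -- Poincaré-Sobolev on `B_R`.
  have hX : cap ^ (1 / p) * eLpNorm v q (volume.restrict (Metric.ball x₀ r)) ≤
      (1 + K₁) * Ψ * E ^ (1 / p) := by
    refine hroot ?_
    rw [ENNReal.mul_rpow_of_nonneg _ _ hp0.le, ← ENNReal.rpow_mul, one_div_mul_cancel hp0.ne',
      ENNReal.rpow_one]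
    have hmono : eLpNorm v q (volume.restrict (Metric.ball x₀ r)) ≤
        eLpNorm v q (volume.restrict B) :=
      eLpNorm_mono_measure _ (Measure.restrict_mono (Metric.ball_subset_ball hrR.le) le_rfl)
    -- Here `R ≤ 2 r` enters; `p d ≤ N` makes the constant independent of `q`.
    have hRd : R ^ (p * d) ≤ 2 ^ (N : ℝ) * r ^ (p * d) := by
      calc R ^ (p * d) ≤ (2 * r) ^ (p * d) :=
            Real.rpow_le_rpow hR.le hR2 (by positivity)
        _ = 2 ^ (p * d) * r ^ (p * d) := Real.mul_rpow (by norm_num) hr.le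
        _ ≤ _ := by
            gcongr
            · norm_num
            · exact mul_dimDiv_le hp0 hpq
    have hRsplit : ENNReal.ofReal (R ^ (N : ℝ)) * ENNReal.ofReal (R ^ (p * d + (s * p - N))) =
        ENNReal.ofReal (R ^ (s * p)) * ENNReal.ofReal (R ^ (p * d)) := by
      rw [← ENNReal.ofReal_mul (by positivity), ← ENNReal.ofReal_mul (by positivity),
        ← Real.rpow_add hR, ← Real.rpow_add hR]
      congr 2; ring
    calc cap * eLpNorm v q (volume.restrict (Metric.ball x₀ r)) ^ p
        ≤ (2 * (T * (ENNReal.ofReal (R ^ (N : ℝ)) * m))) *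
          (C * ENNReal.ofReal g * ENNReal.ofReal (R ^ (p * d + (s * p - N))) * E) := by
          exact mul_le_mul' hcapB ((ENNReal.rpow_le_rpow hmono hp0.le).trans hSq)
      _ = 2 * m * C * E * T * ENNReal.ofReal g *
          (ENNReal.ofReal (R ^ (N : ℝ)) * ENNReal.ofReal (R ^ (p * d + (s * p - N)))) := by ring
      _ = 2 * m * C * E * (T * (ENNReal.ofReal g * ENNReal.ofReal (R ^ (s * p)))) *
          ENNReal.ofReal (R ^ (p * d)) := by rw [hRsplit]; ring
      _ ≤ 2 * m * C * E * (ENNReal.ofReal τ * ENNReal.ofReal (ξ ^ (s * p))) *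
          ENNReal.ofReal (2 ^ (N : ℝ) * r ^ (p * d)) := by
          rw [hTg]
          exact mul_le_mul_right (ENNReal.ofReal_le_ofReal hRd) _
      _ = K₁ * Ψ ^ p * E := by
          rw [hΨp, hK₁, ENNReal.ofReal_mul (by positivity : (0 : ℝ) ≤ 2 ^ (N : ℝ)),
            ENNReal.ofReal_mul (by positivity : (0 : ℝ) ≤ ξ ^ (s * p))]
          ring
  -- Constant part: the competitor built from `η` and `u` bounds `|c| ^ p * cap` by the energy of
  -- `u`.
  have hZ : cap ^ (1 / p) * eLpNorm (fun _ : Euc N => c) q (volume.restrict (Metric.ball x₀ r)) ≤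
      (1 + K₂) * Ψ * E ^ (1 / p) := by
    refine hroot ?_
    have hconst : eLpNorm (fun _ : Euc N => c) q (volume.restrict (Metric.ball x₀ r)) ≤
        ‖c‖ₑ * (ENNReal.ofReal (r ^ d) * (1 + m)) := by
      rw [eLpNorm_const _ (by intro h; simp [h] at h1q)
        (by simpa using (Metric.measure_ball_pos volume x₀ hr).ne'), Measure.restrict_apply_univ]
      exact mul_le_mul_right (volume_ball_rpow_le hr x₀ h1q) _
    have hcapc : ‖c‖ₑ ^ p * cap ≤ 2 * (2 ^ (p - 1) * (E + T * ∫⁻ x in B, ‖u x - c‖ₑ ^ p)) := by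
      refine (enorm_rpow_mul_fractionalCapacity_le hp hη (fun x hx => hηS x (hS hx)) hu hu0 c).trans ?_
      refine (iterEnergy_univ_le_of_support hp0 measurableSet_ball (B := B) (by fun_prop)
        fun x hx => ?_).trans ?_
      · rw [image_eq_zero_of_notMem_tsupport fun h => hx (hη.2.2 h), zero_mul]
      · exact mul_le_mul_right (iterEnergy_cutoff_mul_le hp B hηm hum c hη0 hη1 hΘ) _
    have hone : (1 : ℝ≥0∞) ≤ ENNReal.ofReal (ξ ^ (s * p)) := by
      rw [← ENNReal.ofReal_one]
      exact ENNReal.ofReal_le_ofReal (Real.one_le_rpow hξ1 hsp.le)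
    rw [ENNReal.mul_rpow_of_nonneg _ _ hp0.le, ← ENNReal.rpow_mul, one_div_mul_cancel hp0.ne',
      ENNReal.rpow_one]
    calc cap * eLpNorm (fun _ : Euc N => c) q (volume.restrict (Metric.ball x₀ r)) ^ p
        ≤ cap * (‖c‖ₑ * (ENNReal.ofReal (r ^ d) * (1 + m))) ^ p := by gcongr
      _ = (‖c‖ₑ ^ p * cap) * (ENNReal.ofReal (r ^ (p * d)) * (1 + m) ^ p) := by
          rw [ENNReal.mul_rpow_of_nonneg _ _ hp0.le, ENNReal.mul_rpow_of_nonneg _ _ hp0.le,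
            ENNReal.ofReal_rpow_of_nonneg (by positivity) hp0.le, ← Real.rpow_mul hr.le,
            mul_comm d p]
          ring
      _ ≤ (2 * (2 ^ (p - 1) * (E + T * (C * ENNReal.ofReal g * ENNReal.ofReal (R ^ (s * p)) * E)))) *
          (ENNReal.ofReal (r ^ (p * d)) * (1 + m) ^ p) := by
          refine mul_le_mul_left (hcapc.trans ?_) _
          gcongr
      _ = (2 * (2 ^ (p - 1) * (1 * E +
          (T * (ENNReal.ofReal g * ENNReal.ofReal (R ^ (s * p)))) * C * E))) *
          (ENNReal.ofReal (r ^ (p * d)) * (1 + m) ^ p) := by ring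
      _ ≤ (2 * (2 ^ (p - 1) * (ENNReal.ofReal (ξ ^ (s * p)) * E +
          (ENNReal.ofReal τ * ENNReal.ofReal (ξ ^ (s * p))) * C * E))) *
          (ENNReal.ofReal (r ^ (p * d)) * (1 + m) ^ p) := by
          rw [hTg]
          gcongr
      _ = K₂ * Ψ ^ p * E := by
          rw [hΨp, hK₂, ENNReal.ofReal_mul (by positivity : (0 : ℝ) ≤ ξ ^ (s * p))]
          ring
  have hsplit : eLpNorm u q (volume.restrict (Metric.ball x₀ r)) ≤
      eLpNorm v q (volume.restrict (Metric.ball x₀ r)) +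
        eLpNorm (fun _ : Euc N => c) q (volume.restrict (Metric.ball x₀ r)) := by
    have huv : u = v + fun _ => c := by ext x; simp [hv]
    conv_lhs => rw [huv]
    exact eLpNorm_add_le (by fun_prop : Continuous v).aestronglyMeasurable
      aestronglyMeasurable_const h1q
  calc _ ≤ cap ^ (1 / p) * (eLpNorm v q (volume.restrict (Metric.ball x₀ r)) +
        eLpNorm (fun _ : Euc N => c) q (volume.restrict (Metric.ball x₀ r))) :=
        mul_le_mul_right hsplit _
    _ ≤ (1 + K₁) * Ψ * E ^ (1 / p) + (1 + K₂) * Ψ * E ^ (1 / p) := by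
        rw [mul_add]; exact add_le_add hX hZ
    _ = _ := by ring

/-- The Maz'ya-Poincaré inequality with constant `k`, for balls of comparable radii. -/
def MazyaPoincare (N : ℕ) (p s : ℝ) (q : ℝ≥0∞) (k : ℝ) : Prop :=
  ∀ (x₀ : Euc N) (r R : ℝ), 0 < r → r < R → R ≤ 2 * r → ∀ S ⊆ Metric.closedBall x₀ r,
    ∀ u : Euc N → ℝ, ContDiff ℝ ∞ u → (∀ x ∈ S, u x = 0) →
      ENNReal.ofReal k * (fractionalCapacity s p S (Metric.ball x₀ R) ^ (1 / p) *
        eLpNorm u q (volume.restrict (Metric.ball x₀ r))) ≤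
      ENNReal.ofReal ((R / (R - r)) ^ s * r ^ dimDiv N q) *
        gagliardoEnergy s p (Metric.ball x₀ R) Set.univ u ^ (1 / p)

theorem exists_mazyaPoincare {N : ℕ} (hN : 1 ≤ N) {p : ℝ} (hp : 1 ≤ p) {C : ℝ≥0∞} (hC : C ≠ ⊤)
    {A : ℝ} (hA : 0 ≤ A) :
    ∃ k : ℝ, 0 < k ∧ k ≤ 1 ∧ ∀ (s g : ℝ) (q : ℝ≥0∞), 0 < s → s < 1 → 0 < g →
      1 / (s * (1 - s)) ≤ A / g → ENNReal.ofReal p ≤ q →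
      (∀ q' ∈ ({q, ENNReal.ofReal p} : Set ℝ≥0∞), ∀ u : Euc N → ℝ, Continuous u →
        eLpNorm (fun x => u x - ⨍ y in Metric.ball (0 : Euc N) 1, u y) q'
          (volume.restrict (Metric.ball (0 : Euc N) 1)) ^ p ≤
        C * ENNReal.ofReal g * iterEnergy s p (Metric.ball 0 1) Set.univ u) →
      MazyaPoincare N p s q k := by
  obtain ⟨K, hK, h⟩ := exists_capacity_poincare hN hp hC hA
  have hK0 : 0 ≤ K.toReal := ENNReal.toReal_nonneg
  refine ⟨(K.toReal + 1)⁻¹, by positivity, inv_le_one_of_one_le₀ (by linarith), ?_⟩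
  intro s g q hs hs1 hg hgA hpq hPS x₀ r R hr hrR hR2 S hS u hu hu0
  rw [gagliardoEnergy_eq (by linarith) _ _ hu.continuous.measurable]
  have hle : ENNReal.ofReal (K.toReal + 1)⁻¹ * K ≤ 1 := by
    rw [← ENNReal.ofReal_toReal hK, ← ENNReal.ofReal_mul (by positivity), ← ENNReal.ofReal_one]
    refine ENNReal.ofReal_le_ofReal ?_
    rw [ENNReal.toReal_ofReal hK0, inv_mul_le_iff₀ (by positivity)]
    linarith
  refine (mul_le_mul_right (h s g q hs hs1 hg hgA hpq hPS x₀ r R hr hrR hR2 S hS u hu hu0) _).trans ?_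
  rw [mul_assoc, ← mul_assoc]
  exact (mul_le_mul_left hle _).trans (le_of_eq (one_mul _))

theorem isSubcritical_ofReal {N : ℕ} {p s : ℝ} (hs : 0 < s) (hp : 1 ≤ p) :
    IsSubcritical N p s (ENNReal.ofReal p) := by
  refine ⟨le_rfl, fun h => ENNReal.ofReal_le_ofReal ?_, fun _ => ENNReal.ofReal_lt_top⟩
  have : 0 < s * p := by positivity
  rw [le_div_iff₀ (by linarith)]
  nlinarith

/-- For a fixed exponent the constant is bounded below as the order of differentiability
increases to one. -/
theorem exists_mazyaPoincare_of_le {N : ℕ} (hN : 1 ≤ N) {p s₀ : ℝ} (hp : 1 ≤ p) (hs₀ : 0 < s₀)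
    (hs₀1 : s₀ < 1) {q : ℝ≥0∞} (hq : IsSubcritical N p s₀ q) :
    ∃ k : ℝ, 0 < k ∧ k ≤ 1 ∧ ∀ s : ℝ, s₀ ≤ s → s < 1 → MazyaPoincare N p s q k := by
  obtain ⟨C₁, hC₁, h₁⟩ := exists_poincare_sobolev_one_sub hN hs₀ hs₀1 hp hq
  obtain ⟨C₂, hC₂, h₂⟩ := exists_poincare_sobolev_one_sub hN hs₀ hs₀1 hp
    (isSubcritical_ofReal hs₀ hp)
  obtain ⟨k, hk0, hk1, h⟩ := exists_mazyaPoincare hN hp (ENNReal.add_ne_top.2 ⟨hC₁, hC₂⟩)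
    (A := s₀⁻¹) (by positivity)
  refine ⟨k, hk0, hk1, fun s hs hs1 => h s (1 - s) q (hs₀.trans_le hs) hs1 (by linarith) ?_ hq.1 ?_⟩
  · have h1s : 0 < 1 - s := by linarith
    rw [one_div, mul_inv, div_eq_mul_inv]
    gcongr
  · have hmono : ∀ u : Euc N → ℝ, iterEnergy s p (Metric.ball 0 1) (Metric.ball 0 1) u ≤
        iterEnergy s p (Metric.ball 0 1) Set.univ u := fun u =>
      lintegral_mono fun x => lintegral_mono_set (Set.subset_univ _)
    rintro q' (rfl | rfl) u hu
    · exact (h₁ s hs hs1 u hu).trans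
        (mul_le_mul' (mul_le_mul_left le_self_add _) (hmono u))
    · exact (h₂ s hs hs1 u hu).trans
        (mul_le_mul' (mul_le_mul_left le_add_self _) (hmono u))

/-- The constant is bounded below for small orders of differentiability, uniformly in the
admissible exponents. -/
theorem exists_mazyaPoincare_small {N : ℕ} (hN : 1 ≤ N) {p : ℝ} (hp : 1 ≤ p) :
    ∃ k : ℝ, 0 < k ∧ k ≤ 1 ∧ ∃ σ : ℝ, 0 < σ ∧ ∀ (s : ℝ) (q : ℝ≥0∞), 0 < s → s < σ →
      IsSubcritical N p s q → MazyaPoincare N p s q k := by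
  have hp0 : 0 < p := by linarith
  have hN0 : (0 : ℝ) < N := by exact_mod_cast hN
  obtain ⟨C, hC, hS⟩ := exists_poincare_sobolev_small hN hp
  obtain ⟨k, hk0, hk1, h⟩ := exists_mazyaPoincare hN hp hC (A := 2) (by norm_num)
  refine ⟨k, hk0, hk1, min (1 / 2) (N / 2 / p), lt_min (by norm_num) (by positivity),
    fun s q hs hsσ hq => ?_⟩
  have hs2 : s < 1 / 2 := hsσ.trans_le (min_le_left _ _)
  have hsp : s * p ≤ N / 2 := by
    rw [← le_div_iff₀ hp0]; exact (hsσ.trans_le (min_le_right _ _)).le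
  refine h s s q hs (by linarith) hs ?_ hq.1 ?_
  · rw [div_le_div_iff₀ (by nlinarith) hs]
    nlinarith
  · rintro q' (rfl | rfl) u hu
    · exact hS s hs (by linarith) hsp _ hq u hu
    · exact hS s hs (by linarith) hsp _ (isSubcritical_ofReal hs hp) u hu

/-! ### The constant `M`. -/

/-- The supremum of the constants not exceeding one in the Maz'ya-Poincaré inequality. -/
def mazyaConst (N : ℕ) (p s : ℝ) (q : ℝ≥0∞) : ℝ :=
  sSup {k : ℝ | k ≤ 1 ∧ MazyaPoincare N p s q k}

theorem mazyaConst_le_one {N : ℕ} {p s : ℝ} {q : ℝ≥0∞} : mazyaConst N p s q ≤ 1 :=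
  Real.sSup_le (fun _ hk => hk.1) zero_le_one

/-- Transfers each uniform lower bound, for small `s` or for `s` near 1, to one canonical number.
The cap at 1 makes the supremum finite and gives the upper bounds. -/
theorem le_mazyaConst {N : ℕ} {p s k : ℝ} {q : ℝ≥0∞} (hk1 : k ≤ 1) (hk : MazyaPoincare N p s q k) :
    k ≤ mazyaConst N p s q :=
  le_csSup ⟨1, fun _ h => h.1⟩ ⟨hk1, hk⟩

theorem mazyaConst_pos {N : ℕ} (hN : 1 ≤ N) {p s : ℝ} (hp : 1 ≤ p) (hs : 0 < s) (hs1 : s < 1)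
    {q : ℝ≥0∞} (hq : IsSubcritical N p s q) : 0 < mazyaConst N p s q := by
  obtain ⟨k, hk0, hk1, h⟩ := exists_mazyaPoincare_of_le hN hp hs hs1 hq
  exact hk0.trans_le (le_mazyaConst hk1 (h s le_rfl hs1))

/-- Half of the supremum lies below some valid constant, so attainment need not be shown. -/
theorem mazyaPoincare_half {N : ℕ} (hN : 1 ≤ N) {p s : ℝ} (hp : 1 ≤ p) (hs : 0 < s) (hs1 : s < 1)
    {q : ℝ≥0∞} (hq : IsSubcritical N p s q) :
    MazyaPoincare N p s q (mazyaConst N p s q / 2) := by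
  have hpos := mazyaConst_pos hN hp hs hs1 hq
  obtain ⟨k₀, _, hk₀1, h₀⟩ := exists_mazyaPoincare_of_le hN hp hs hs1 hq
  obtain ⟨k, hk, hlt⟩ := exists_lt_of_lt_csSup
    (s := {k : ℝ | k ≤ 1 ∧ MazyaPoincare N p s q k}) ⟨k₀, hk₀1, h₀ s le_rfl hs1⟩
    (half_lt_self hpos)
  intro x₀ r R hr hrR hR2 S hS u hu hu0
  exact (mul_le_mul_left (ENNReal.ofReal_le_ofReal hlt.le) _).trans
    (hk.2 x₀ r R hr hrR hR2 S hS u hu hu0)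

/-- The constant in the Maz'ya-Poincaré inequality on concentric balls with ratio of radii `t`. -/
def mazyaFactor (N : ℕ) (p s : ℝ) (q : ℝ≥0∞) (t : ℝ) : ℝ :=
  mazyaConst N p s q / 4 * (1 - √(N : ℝ) / t) ^ s * t ^ (-dimDiv N q)

theorem fractionalCapacity_anti {N : ℕ} {s p : ℝ} {S E E' : Set (Euc N)} (h : E' ⊆ E) :
    fractionalCapacity s p S E ≤ fractionalCapacity s p S E' :=
  le_iInf₂ fun φ hφ => le_iInf fun h1 =>
    iInf₂_le_of_le φ ⟨hφ.1, hφ.2.1, hφ.2.2.trans h⟩ (iInf_le _ h1)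

/-- The inequality for comparable radii needs only `R > r` and loses `((R - r) / R) ^ s`. Since `√N
≥ 1`, the factor `1 - √N r / R` is smaller than `1 - r / R`, and the factor in `R / r` is at most 1,
so both only weaken it. -/
theorem mazyaFactor_inequality {N : ℕ} (hN : 1 ≤ N) {p s : ℝ} (hp : 1 ≤ p) (hs : 0 < s)
    (hs1 : s < 1) {q : ℝ≥0∞} (hq : IsSubcritical N p s q) (x₀ : Euc N) {r R : ℝ} (hr : 0 < r)
    (hR : √(N : ℝ) * r < R) {S : Set (Euc N)} (hS : S ⊆ Metric.closedBall x₀ r) {u : Euc N → ℝ}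
    (hu : ContDiff ℝ ∞ u) (hu0 : ∀ x ∈ S, u x = 0) :
    ENNReal.ofReal (mazyaFactor N p s q (R / r) / r ^ dimDiv N q) *
        fractionalCapacity s p S (Metric.ball x₀ R) ^ (1 / p) *
        eLpNorm u q (volume.restrict (Metric.ball x₀ r)) ≤
      gagliardoEnergy s p (Metric.ball x₀ R) Set.univ u ^ (1 / p) := by
  have hp0 : 0 < p := by linarith
  have hsq1 : 1 ≤ √(N : ℝ) := by
    rw [Real.one_le_sqrt]; exact_mod_cast hN
  have hrR : r < R := lt_of_le_of_lt (by nlinarith) hR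
  have hR0 : 0 < R := hr.trans hrR
  set k := mazyaConst N p s q with hk
  have hk0 : 0 < k := mazyaConst_pos hN hp hs hs1 hq
  set d := dimDiv N q with hd
  have hd0 : 0 ≤ d := dimDiv_nonneg N q
  -- Shrinking the outer ball increases the capacity and decreases the energy on the right.
  set R' := min R (2 * r) with hR'
  have hrR' : r < R' := lt_min hrR (by linarith)
  have hR'0 : 0 < R' := hr.trans hrR'
  have hRr' : 0 < R' - r := by linarith
  have hsub : Metric.ball x₀ R' ⊆ Metric.ball x₀ R := Metric.ball_subset_ball (min_le_left _ _)
  have hbase := mazyaPoincare_half hN hp hs hs1 hq x₀ r R' hr hrR' (min_le_right _ _) S hS u hu hu0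
  set ξ : ℝ := R' / (R' - r) with hξ
  have hξ0 : 0 < ξ := by positivity
  have ht0 : 0 < R / r := by positivity
  have ht1 : 1 ≤ R / r := by rw [one_le_div hr]; exact hrR.le
  have hfrac0 : 0 ≤ 1 - √(N : ℝ) / (R / r) := by
    rw [sub_nonneg, div_le_one ht0, le_div_iff₀ hr]; exact hR.le
  -- The factor 2 serves the case `R ≥ 2 r`, where `ξ = 2` and `(1 / 2) ^ s ≥ 1 / 2`; it is paid for
  -- by the 4 in `mazyaFactor` against the 2 in `mazyaPoincare_half`.
  have hξbound : (1 - √(N : ℝ) / (R / r)) ^ s ≤ 2 * (ξ ^ s)⁻¹ := by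
    rw [← Real.inv_rpow hξ0.le]
    rcases le_total R (2 * r) with hcase | hcase
    · have hRR : R' = R := min_eq_left hcase
      have h1 : 1 - √(N : ℝ) / (R / r) ≤ ξ⁻¹ := by
        rw [hξ, hRR, inv_div, sub_div, div_self hR0.ne', sub_le_sub_iff_left, div_div_eq_mul_div]
        gcongr
        nlinarith
      have h2 := Real.rpow_le_rpow hfrac0 h1 hs.le
      have h3 : 0 < (ξ⁻¹) ^ s := by positivity
      linarith
    · have hRR : R' = 2 * r := min_eq_right hcase
      have hξ2 : ξ⁻¹ = 1 / 2 := by rw [hξ, hRR]; field_simp; ring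
      have h1 : (1 - √(N : ℝ) / (R / r)) ^ s ≤ 1 :=
        Real.rpow_le_one hfrac0 (by have : 0 ≤ √(N : ℝ) / (R / r) := by positivity
                                    linarith) hs.le
      have h2 : (1 / 2 : ℝ) ≤ (ξ⁻¹) ^ s := by
        rw [hξ2]
        conv_lhs => rw [← Real.rpow_one (1 / 2 : ℝ)]
        exact Real.rpow_le_rpow_of_exponent_ge (by norm_num) (by norm_num) hs1.le
      linarith
  have hM : mazyaFactor N p s q (R / r) / r ^ d ≤ (ξ ^ s * r ^ d)⁻¹ * (k / 2) := by
    have h1 : (R / r) ^ (-d) ≤ 1 := Real.rpow_le_one_of_one_le_of_nonpos ht1 (by linarith)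
    have h2 : mazyaFactor N p s q (R / r) ≤ (ξ ^ s)⁻¹ * (k / 2) := by
      unfold mazyaFactor
      rw [← hk, ← hd]
      calc k / 4 * (1 - √(N : ℝ) / (R / r)) ^ s * (R / r) ^ (-d)
          ≤ k / 4 * (1 - √(N : ℝ) / (R / r)) ^ s * 1 := by gcongr
        _ ≤ k / 4 * (2 * (ξ ^ s)⁻¹) * 1 := by gcongr
        _ = _ := by ring
    rw [div_eq_mul_inv, mul_inv, mul_right_comm]
    gcongr
  have hcancel : ENNReal.ofReal (ξ ^ s * r ^ d)⁻¹ * ENNReal.ofReal (ξ ^ s * r ^ d) = 1 := by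
    rw [← ENNReal.ofReal_mul (by positivity), inv_mul_cancel₀ (by positivity), ENNReal.ofReal_one]
  calc _ ≤ ENNReal.ofReal ((ξ ^ s * r ^ d)⁻¹ * (k / 2)) *
        fractionalCapacity s p S (Metric.ball x₀ R') ^ (1 / p) *
        eLpNorm u q (volume.restrict (Metric.ball x₀ r)) := by
        gcongr
        exact fractionalCapacity_anti hsub
    _ = ENNReal.ofReal (ξ ^ s * r ^ d)⁻¹ * (ENNReal.ofReal (k / 2) *
        (fractionalCapacity s p S (Metric.ball x₀ R') ^ (1 / p) *
        eLpNorm u q (volume.restrict (Metric.ball x₀ r)))) := by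
        rw [ENNReal.ofReal_mul (by positivity)]; ring
    _ ≤ ENNReal.ofReal (ξ ^ s * r ^ d)⁻¹ * (ENNReal.ofReal (ξ ^ s * r ^ d) *
        gagliardoEnergy s p (Metric.ball x₀ R') Set.univ u ^ (1 / p)) :=
        mul_le_mul_right hbase _
    _ = gagliardoEnergy s p (Metric.ball x₀ R') Set.univ u ^ (1 / p) := by
        rw [← mul_assoc, hcancel, one_mul]
    _ ≤ _ := by
        refine ENNReal.rpow_le_rpow ?_ (by positivity)
        exact lintegral_mono_set (Set.prod_mono hsub le_rfl)

theorem one_sub_sqrt_div_mem {N : ℕ} {t : ℝ} (ht : √(N : ℝ) < t) :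
    0 < 1 - √(N : ℝ) / t ∧ 1 - √(N : ℝ) / t ≤ 1 := by
  have h0 := Real.sqrt_nonneg (N : ℝ)
  have ht0 : 0 < t := h0.trans_lt ht
  constructor
  · rw [sub_pos, div_lt_one ht0]; exact ht
  · have : 0 ≤ √(N : ℝ) / t := by positivity
    linarith

theorem mazyaFactor_le_one {N : ℕ} (hN : 1 ≤ N) {p s t : ℝ} (hp : 1 ≤ p) (hs : 0 < s) (hs1 : s < 1)
    {q : ℝ≥0∞} (hq : IsSubcritical N p s q) (ht : √(N : ℝ) < t) :
    0 < mazyaFactor N p s q t ∧ mazyaFactor N p s q t ≤ 1 := by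
  obtain ⟨h0, h1⟩ := one_sub_sqrt_div_mem ht
  have ht1 : 1 ≤ t := (by rw [Real.one_le_sqrt]; exact_mod_cast hN : 1 ≤ √(N : ℝ)).trans ht.le
  have hk := mazyaConst_pos hN hp hs hs1 hq
  have hk1 := mazyaConst_le_one (N := N) (p := p) (s := s) (q := q)
  have ht0 : 0 < t := by linarith
  have ha : (1 - √(N : ℝ) / t) ^ s ≤ 1 := Real.rpow_le_one h0.le h1 hs.le
  have hb : t ^ (-dimDiv N q) ≤ 1 :=
    Real.rpow_le_one_of_one_le_of_nonpos ht1 (by linarith [dimDiv_nonneg N q])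
  unfold mazyaFactor
  refine ⟨by positivity, ?_⟩
  calc mazyaConst N p s q / 4 * (1 - √(N : ℝ) / t) ^ s * t ^ (-dimDiv N q)
      ≤ 1 / 4 * 1 * 1 := by gcongr
    _ ≤ 1 := by norm_num

/-- The lower bound is free of `s` and `q`: a number in `(0, 1]` is at most its `s`-th power, and `N
/ q ≤ N`. -/
theorem le_mazyaFactor {N : ℕ} (hN : 1 ≤ N) {p s t k : ℝ} (hp : 1 ≤ p) (hs1 : s < 1)
    {q : ℝ≥0∞} (hq : ENNReal.ofReal p ≤ q) (ht : √(N : ℝ) < t) (hk0 : 0 ≤ k) (hk1 : k ≤ 1)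
    (hk : MazyaPoincare N p s q k) :
    k / 4 * (1 - √(N : ℝ) / t) * t ^ (-(N : ℝ)) ≤ mazyaFactor N p s q t := by
  obtain ⟨h0, h1⟩ := one_sub_sqrt_div_mem ht
  have ht1 : 1 ≤ t := (by rw [Real.one_le_sqrt]; exact_mod_cast hN : 1 ≤ √(N : ℝ)).trans ht.le
  have ht0 : 0 < t := by linarith
  have hd : dimDiv N q ≤ N := by
    have := mul_dimDiv_le (N := N) (by linarith : 0 < p) hq
    nlinarith [dimDiv_nonneg N q]
  have ha : 1 - √(N : ℝ) / t ≤ (1 - √(N : ℝ) / t) ^ s := by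
    conv_lhs => rw [← Real.rpow_one (1 - √(N : ℝ) / t)]
    exact Real.rpow_le_rpow_of_exponent_ge h0 h1 hs1.le
  have hb : t ^ (-(N : ℝ)) ≤ t ^ (-dimDiv N q) :=
    Real.rpow_le_rpow_of_exponent_le ht1 (by linarith)
  have hc := le_mazyaConst hk1 hk
  have hc0 : 0 ≤ mazyaConst N p s q := hk0.trans hc
  unfold mazyaFactor
  gcongr

/-! ### Asymptotics of the constant. -/

theorem isTheta_one_of_bounds {α : Type*} {l : Filter α} {f : α → ℝ} {a : ℝ} (ha : 0 < a)
    (h : ∀ᶠ x in l, a ≤ f x ∧ f x ≤ 1) : f =Θ[l] fun _ => (1 : ℝ) := by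
  constructor
  · refine IsBigO.of_bound 1 ?_
    filter_upwards [h] with x hx
    rw [Real.norm_of_nonneg (ha.le.trans hx.1)]
    simpa using hx.2
  · refine IsBigO.of_bound a⁻¹ ?_
    filter_upwards [h] with x hx
    rw [Real.norm_of_nonneg (ha.le.trans hx.1), norm_one, ← div_eq_inv_mul, one_le_div ha]
    exact hx.1

theorem tendsto_mazyaFactor_sqrt {N : ℕ} (hN : 1 ≤ N) {p s : ℝ} (q : ℝ≥0∞) :
    Tendsto (fun t : ℝ => mazyaFactor N p s q t / (t - √(N : ℝ)) ^ s) (𝓝[>] √(N : ℝ))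
      (𝓝 (mazyaConst N p s q / 4 * (√(N : ℝ)) ^ (-s) * (√(N : ℝ)) ^ (-dimDiv N q))) := by
  have hsq : 0 < √(N : ℝ) := Real.sqrt_pos.2 (by exact_mod_cast hN)
  have hlim : Tendsto (fun t : ℝ => mazyaConst N p s q / 4 * t ^ (-s) * t ^ (-dimDiv N q))
      (𝓝[>] √(N : ℝ))
      (𝓝 (mazyaConst N p s q / 4 * (√(N : ℝ)) ^ (-s) * (√(N : ℝ)) ^ (-dimDiv N q))) := by
    refine Tendsto.mono_left ?_ nhdsWithin_le_nhds
    exact ((Real.continuousAt_rpow_const _ _ (Or.inl hsq.ne')).tendsto.const_mul _).mul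
      (Real.continuousAt_rpow_const _ _ (Or.inl hsq.ne')).tendsto
  refine hlim.congr' ?_
  filter_upwards [self_mem_nhdsWithin] with t ht
  have ht' : √(N : ℝ) < t := ht
  have ht0 : 0 < t := hsq.trans ht'
  have h1 : 0 < t - √(N : ℝ) := by linarith
  have h2 : 1 - √(N : ℝ) / t = (t - √(N : ℝ)) / t := by field_simp
  unfold mazyaFactor
  rw [h2, Real.div_rpow h1.le ht0.le, Real.rpow_neg ht0.le s]
  field_simp

theorem tendsto_mazyaFactor_atTop {N : ℕ} {p s : ℝ} (q : ℝ≥0∞) :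
    Tendsto (fun t : ℝ => t ^ dimDiv N q * mazyaFactor N p s q t) atTop
      (𝓝 (mazyaConst N p s q / 4)) := by
  have hlim : Tendsto (fun t : ℝ => mazyaConst N p s q / 4 * (1 - √(N : ℝ) / t) ^ s) atTop
      (𝓝 (mazyaConst N p s q / 4 * (1 - 0) ^ s)) := by
    refine Tendsto.const_mul _ ?_
    refine (Real.continuousAt_rpow_const (1 - 0) s (Or.inl (by norm_num))).tendsto.comp ?_
    exact tendsto_const_nhds.sub (tendsto_const_nhds.div_atTop tendsto_id)
  rw [sub_zero, Real.one_rpow, mul_one] at hlim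
  refine hlim.congr' ?_
  filter_upwards [eventually_gt_atTop 0] with t ht
  unfold mazyaFactor
  rw [Real.rpow_neg ht.le]
  have : 0 < t ^ dimDiv N q := by positivity
  field_simp

end

/-! ### The theorem. -/

theorem lemma4p7 (N : ℕ) (hN : 1 ≤ N) (p : ℝ) (hp : 1 ≤ p) :
    ∃ M : ℝ → ℝ≥0∞ → ℝ → ℝ,
      -- positivity of the constant `M s q (R / r)`
      (∀ (s : ℝ) (q : ℝ≥0∞) (t : ℝ), 0 < s → s < 1 → IsSubcritical N p s q →
        √(N : ℝ) < t → 0 < M s q t) ∧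
      -- the inequality
      (∀ (s : ℝ) (q : ℝ≥0∞), 0 < s → s < 1 → IsSubcritical N p s q →
        ∀ (x₀ : EuclideanSpace ℝ (Fin N)) (r R : ℝ), 0 < r → √(N : ℝ) * r < R →
        ∀ S : Set (EuclideanSpace ℝ (Fin N)), IsCompact S → S ⊆ Metric.closedBall x₀ r →
        ∀ u : EuclideanSpace ℝ (Fin N) → ℝ, IsTestFunction Set.univ u → (∀ x ∈ S, u x = 0) →
          ENNReal.ofReal (M s q (R / r) / r ^ dimDiv N q) *
              (fractionalCapacity s p S (Metric.ball x₀ R)) ^ (1 / p) *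
              eLpNorm u q (volume.restrict (Metric.ball x₀ r)) ≤
            (gagliardoEnergy s p (Metric.ball x₀ R) Set.univ u) ^ (1 / p)) ∧
      -- `M ~ 1` as `s ↘ 0` (the constraint on `q` forces `q → p`), uniformly in admissible `q`
      (∀ t : ℝ, √(N : ℝ) < t →
        (fun z : ℝ × ℝ≥0∞ => M z.1 z.2 t)
          =Θ[𝓝[{z : ℝ × ℝ≥0∞ | 0 < z.1 ∧ z.1 < 1 ∧ IsSubcritical N p z.1 z.2}]
              ((0 : ℝ), ENNReal.ofReal p)]
          (fun _ => (1 : ℝ))) ∧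
      -- `M ~ 1` as `s ↗ 1`, for each `q` that is admissible for `s` close to `1`
      (∀ (q : ℝ≥0∞) (t : ℝ), √(N : ℝ) < t →
        (fun s : ℝ => M s q t)
          =Θ[𝓝[{s : ℝ | 0 < s ∧ s < 1 ∧ IsSubcritical N p s q}] (1 : ℝ)]
          (fun _ => (1 : ℝ))) ∧
      -- behaviour as `R / r → √N` and as `R / r → ∞`
      (∀ (s : ℝ) (q : ℝ≥0∞), 0 < s → s < 1 → IsSubcritical N p s q →
        (∃ L : ℝ, 0 < L ∧
          Tendsto (fun t : ℝ => M s q t / (t - √(N : ℝ)) ^ s) (𝓝[>] √(N : ℝ)) (𝓝 L)) ∧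
        (∃ L : ℝ, 0 < L ∧
          Tendsto (fun t : ℝ => t ^ dimDiv N q * M s q t) atTop (𝓝 L))) := by
  have hpos : ∀ (s : ℝ) (q : ℝ≥0∞) (t : ℝ), 0 < s → s < 1 → IsSubcritical N p s q →
      √(N : ℝ) < t → 0 < mazyaFactor N p s q t := fun s q t hs hs1 hq ht =>
    (mazyaFactor_le_one hN hp hs hs1 hq ht).1
  have hlow : ∀ (k t : ℝ), 0 < k → √(N : ℝ) < t →
      0 < k / 4 * (1 - √(N : ℝ) / t) * t ^ (-(N : ℝ)) := by
    intro k t hk ht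
    have ht0 : 0 < t := (Real.sqrt_nonneg _).trans_lt ht
    have := (one_sub_sqrt_div_mem ht).1
    positivity
  refine ⟨mazyaFactor N p, hpos, ?_, ?_, ?_, ?_⟩
  · intro s q hs hs1 hq x₀ r R hr hR S _ hS u hu hu0
    exact mazyaFactor_inequality hN hp hs hs1 hq x₀ hr hR hS hu.1 hu0
  · intro t ht
    obtain ⟨k, hk0, hk1, σ, hσ, h⟩ := exists_mazyaPoincare_small hN hp
    refine isTheta_one_of_bounds (hlow k t hk0 ht) ?_
    have hsmall : ∀ᶠ z : ℝ × ℝ≥0∞ in 𝓝 ((0 : ℝ), ENNReal.ofReal p), z.1 < σ :=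
      continuous_fst.continuousAt.eventually_lt continuousAt_const hσ
    filter_upwards [self_mem_nhdsWithin, nhdsWithin_le_nhds hsmall] with z hz hzσ
    exact ⟨le_mazyaFactor hN hp hz.2.1 hz.2.2.1 ht hk0.le hk1 (h z.1 z.2 hz.1 hzσ hz.2.2),
      (mazyaFactor_le_one hN hp hz.1 hz.2.1 hz.2.2 ht).2⟩
  · intro q t ht
    -- One admissible `s₀ < 1` gives a bound valid for all `s ≥ s₀`. If there is none, the filter is
    -- carried by the empty set and the claim is vacuous.
    by_cases hex : ∃ s₀ : ℝ, 0 < s₀ ∧ s₀ < 1 ∧ IsSubcritical N p s₀ q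
    · obtain ⟨s₀, hs₀, hs₀1, hq⟩ := hex
      obtain ⟨k, hk0, hk1, h⟩ := exists_mazyaPoincare_of_le hN hp hs₀ hs₀1 hq
      refine isTheta_one_of_bounds (hlow k t hk0 ht) ?_
      filter_upwards [self_mem_nhdsWithin, nhdsWithin_le_nhds (Ioi_mem_nhds hs₀1)] with s hs hs'
      exact ⟨le_mazyaFactor hN hp hs.2.1 hs.2.2.1 ht hk0.le hk1 (h s (le_of_lt hs') hs.2.1),
        (mazyaFactor_le_one hN hp hs.1 hs.2.1 hs.2.2 ht).2⟩
    · refine isTheta_one_of_bounds one_pos ?_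
      filter_upwards [self_mem_nhdsWithin] with s hs
      exact absurd ⟨s, hs⟩ hex
  · intro s q hs hs1 hq
    have hk := mazyaConst_pos hN hp hs hs1 hq
    have hsq : 0 < √(N : ℝ) := Real.sqrt_pos.2 (by exact_mod_cast hN)
    exact ⟨⟨_, by positivity, tendsto_mazyaFactor_sqrt hN q⟩,
      ⟨_, by positivity, tendsto_mazyaFactor_atTop q⟩⟩
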